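/- **Theorem (finding an optimal order in the generic case).** Let $\mathbb F$ be $\mathbb Q$, $\mathbb R$ or $\mathbb C$. For positive integers $n,d,w$ and a permutation $\sigma\in S_n$, say that $f\in\mathbb F[x_1,\dots,x_n]$ of individual degree at most $d$ *has an ROABP of width $w$ in the order $\sigma$* if there is a layered directed graph with layers $0,1,\dots,n$, each with at most $w$ vertices, the layers $0$ and $n$ consisting of a single vertex $s$, respectively $t$, and with edges only from layer $i-1$ to layer $i$, labelled by univariate polynomials of degree at most $d$ in $x_{\sigma(i)}$, such that $f$ is the sum over all $s$–$t$ paths of the product of the edge labels. Let $V_{w,\sigma}\subseteq\mathbb F^{(d+1)^n}$ be the smallest algebraic set containing the coefficient vectors of all such $f$. "A generic polynomial with a width-$w$ ROABP in the order $\sigma$" means: every such $f$ whose coefficient vector lies outside some algebraic set $Z\subsetneq V_{w,\sigma}$ (depending only on $\mathbb F,n,d,w,\sigma$). There are a randomized algorithm $R$ and a constant $C$ such that the following holds for all positive integers $n,d,w$ with $n\ge 3\log_{d+1}w$, every $\sigma\in S_n$ and every generic $f$ with a width-$w$ ROABP in the order $\sigma$. Given $n,d,w$ and $f$ as a black box (but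 not $\sigma$), with probability at least $1-2^{-n}$ over its coin tosses, $R$ halts after at most $$C\cdot n^{C(1+\log_{d+1}w)}\cdot (dw)^{C}\;=\;n^{O(1+\log_{d+1}w)}\cdot\mathrm{poly}(d,w)$$ steps and outputs a $\tau\in S_n$ such that $f$ has an ROABP of width at most $w$ in the order $\tau$. Here $R$ is a program for a random access machine with integer variables and arrays (constants, addition, truncated subtraction, indirect addressing, zero test), variables and arrays over $\mathbb F$ (the constants $0,1$, the four field operations, zero test), fair coin tosses, and queries evaluating $f$ at a point of $\mathbb F^n$; each instruction, test and query counts as one step. -/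

import Mathlib

open MeasureTheory

noncomputable section

/-! ### Read-once oblivious algebraic branching programs -/

/-- A read-once oblivious ABP with layers `0, …, n`: layer `i` has `layer i` vertices, there is a
single source and a single sink, and the edge from `u` in layer `i` to `v` in layer `i + 1` carries
a univariate polynomial of degree at most `d` (an absent edge has weight `0`). -/
structure ROABP (F : Type*) [Field F] (n d : ℕ) where
  layer : Fin (n + 1) → ℕ
  source : layer 0 = 1
  sink : layer (Fin.last n) = 1
  weight : (i : Fin n) → Fin (layer i.castSucc) → Fin (layer i.succ) → Polynomial F
  natDegree_le : ∀ i u v, (weight i u v).natDegree ≤ d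

namespace ROABP

variable {F : Type*} [Field F] {n d : ℕ}

/-- The maximal number of vertices in a layer. -/
def width (R : ROABP F n d) : ℕ := Finset.univ.sup R.layer

/-- The polynomial computed in the order `σ`: the sum over all source-sink paths `p` of the product
of the edge weights, where the `i`-th edge of a path reads the variable `x_{σ(i)}`. -/
def toPoly (R : ROABP F n d) (σ : Equiv.Perm (Fin n)) : MvPolynomial (Fin n) F :=
  ∑ p : (i : Fin (n + 1)) → Fin (R.layer i),
    ∏ i : Fin n, Polynomial.aeval (MvPolynomial.X (σ i) : MvPolynomial (Fin n) F)
      (R.weight i (p i.castSucc) (p i.succ))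

end ROABP

/-- `f`, an `n`-variate polynomial of individual degree (at most) `d`, has an ROABP of width
(at most) `w` in the order `σ`. -/
def HasROABP {F : Type*} [Field F] {n : ℕ} (d w : ℕ) (σ : Equiv.Perm (Fin n))
    (f : MvPolynomial (Fin n) F) : Prop :=
  ∃ R : ROABP F n d, R.width ≤ w ∧ R.toPoly σ = f

/-! ### The variety of polynomials with a small ROABP -/

/-- The vector of the `(d + 1) ^ n` coefficients of a polynomial of individual degree at most `d`,
indexed by the exponent vectors. -/
def coeffVector {F : Type*} [Field F] {n : ℕ} (d : ℕ) (f : MvPolynomial (Fin n) F) :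
    (Fin n → Fin (d + 1)) → F :=
  fun e => f.coeff (Finsupp.equivFunOnFinite.symm fun i => (e i : ℕ))

/-- An affine algebraic set: the common zeros of some polynomials with coefficients in `F`. -/
def IsAlgebraicSet {F : Type*} [Field F] {ι : Type*} (Z : Set (ι → F)) : Prop :=
  ∃ I : Ideal (MvPolynomial ι F), Z = MvPolynomial.zeroLocus F I

/-- The smallest algebraic set containing the coefficient vectors of all `n`-variate polynomials of
individual degree `d` that have an ROABP of width `w` in the order `σ`. -/
def roabpVariety (F : Type*) [Field F] {n : ℕ} (d w : ℕ) (σ : Equiv.Perm (Fin n)) :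
    Set ((Fin n → Fin (d + 1)) → F) :=
  ⋂₀ {Z | IsAlgebraicSet Z ∧
    ∀ f : MvPolynomial (Fin n) F, HasROABP d w σ f → coeffVector d f ∈ Z}

/-! ### Randomized algebraic random access machines with a black box

A program works on a memory of integer variables, integer arrays, variables over the field `F` and
arrays over the field `F` (every program text mentions only finitely many of them, by number). The
instructions are the usual ones of a random access machine on the integers, the field operations
and the zero test on field elements, a fair coin toss, and an evaluation of the black-box
polynomial. No field constants other than `0` and `1` are available. Each instruction and each
evaluation of a branching condition takes one step. -/

/-- The memory, with the not yet read part of the sequence of coin tosses. -/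
structure Store (F : Type*) where
  nat : ℕ → ℕ
  natArr : ℕ → ℕ → ℕ
  fld : ℕ → F
  fldArr : ℕ → ℕ → F
  coins : ℕ → Bool

/-- Instructions; `x y z` are numbers of integer variables, `a` of an integer array, `u v v'` of
field variables, `g` of a field array. -/
inductive Instr where
  /-- `x := c`, for a constant `c` of the program text -/
  | setNat (x c : ℕ)
  /-- `x := y + z` -/
  | addNat (x y z : ℕ)
  /-- `x := max (y - z) 0` -/
  | subNat (x y z : ℕ)
  /-- `x := a[y]` -/
  | readNat (x a y : ℕ)
  /-- `a[x] := y` -/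
  | writeNat (a x y : ℕ)
  /-- `x := ` the next coin, as `0` or `1` -/
  | toss (x : ℕ)
  /-- `u := 0` -/
  | zeroFld (u : ℕ)
  /-- `u := 1` -/
  | oneFld (u : ℕ)
  /-- `u := v + v'` -/
  | addFld (u v v' : ℕ)
  /-- `u := v - v'` -/
  | subFld (u v v' : ℕ)
  /-- `u := v * v'` -/
  | mulFld (u v v' : ℕ)
  /-- `u := v / v'`, where division by zero gives `0` -/
  | divFld (u v v' : ℕ)
  /-- `u := g[x]` -/
  | readFld (u g x : ℕ)
  /-- `g[x] := u` -/
  | writeFld (g x u : ℕ)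
  /-- `x := 0` if `u = 0`, and `x := 1` otherwise -/
  | testFld (x u : ℕ)
  /-- `u := f(g[0], …, g[n - 1])`, where `f` is the black box -/
  | query (u g : ℕ)

namespace Store

variable {F : Type*}

def putNat (s : Store F) (x c : ℕ) : Store F :=
  { s with nat := Function.update s.nat x c }

def putNatArr (s : Store F) (a j c : ℕ) : Store F :=
  { s with natArr := Function.update s.natArr a (Function.update (s.natArr a) j c) }

def putFld (s : Store F) (u : ℕ) (c : F) : Store F :=
  { s with fld := Function.update s.fld u c }

def putFldArr (s : Store F) (g j : ℕ) (c : F) : Store F :=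
  { s with fldArr := Function.update s.fldArr g (Function.update (s.fldArr g) j c) }

/-- The initial memory on input `n, d, w` with coin tosses `ω`. -/
def init [Zero F] (n d w : ℕ) (ω : ℕ → Bool) : Store F where
  nat x := if x = 0 then n else if x = 1 then d else if x = 2 then w else 0
  natArr _ _ := 0
  fld _ := 0
  fldArr _ _ := 0
  coins := ω

/-- The permutation `τ` of `{0, …, n - 1}` is written in the integer array number `0`. -/
def Outputs {n : ℕ} (s : Store F) (τ : Equiv.Perm (Fin n)) : Prop :=
  ∀ i : Fin n, s.natArr 0 i = τ i

end Store

open Classical in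
/-- The effect of an instruction, with black box `f`. -/
def Instr.step {F : Type*} [Field F] {n : ℕ} (f : MvPolynomial (Fin n) F) (s : Store F) :
    Instr → Store F
  | setNat x c => s.putNat x c
  | addNat x y z => s.putNat x (s.nat y + s.nat z)
  | subNat x y z => s.putNat x (s.nat y - s.nat z)
  | readNat x a y => s.putNat x (s.natArr a (s.nat y))
  | writeNat a x y => s.putNatArr a (s.nat x) (s.nat y)
  | toss x =>
      { s with
        nat := Function.update s.nat x (if s.coins 0 = true then 1 else 0)
        coins := fun j => s.coins (j + 1) }
  | zeroFld u => s.putFld u 0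
  | oneFld u => s.putFld u 1
  | addFld u v v' => s.putFld u (s.fld v + s.fld v')
  | subFld u v v' => s.putFld u (s.fld v - s.fld v')
  | mulFld u v v' => s.putFld u (s.fld v * s.fld v')
  | divFld u v v' => s.putFld u (s.fld v / s.fld v')
  | readFld u g x => s.putFld u (s.fldArr g (s.nat x))
  | writeFld g x u => s.putFldArr g (s.nat x) (s.fld u)
  | testFld x u => s.putNat x (if s.fld u = 0 then 0 else 1)
  | query u g => s.putFld u (MvPolynomial.eval (fun i : Fin n => s.fldArr g i) f)

/-- Programs; a condition is whether the integer variable `x` is nonzero. -/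
inductive Program where
  | instr (c : Instr)
  | seq (p q : Program)
  | ite (x : ℕ) (p q : Program)
  | while (x : ℕ) (p : Program)

/-- `Exec f p s t s'`: with black box `f`, the program `p` started in the memory `s` halts after
exactly `t` steps in the memory `s'`. -/
inductive Exec {F : Type*} [Field F] {n : ℕ} (f : MvPolynomial (Fin n) F) :
    Program → Store F → ℕ → Store F → Prop
  | instr (c : Instr) (s : Store F) : Exec f (.instr c) s 1 (c.step f s)
  | seq {p q : Program} {s s' s'' : Store F} {t t' : ℕ}
      (hp : Exec f p s t s') (hq : Exec f q s' t' s'') : Exec f (.seq p q) s (t + t') s''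
  | iteTrue {x : ℕ} {p q : Program} {s s' : Store F} {t : ℕ}
      (hx : s.nat x ≠ 0) (hp : Exec f p s t s') : Exec f (.ite x p q) s (t + 1) s'
  | iteFalse {x : ℕ} {p q : Program} {s s' : Store F} {t : ℕ}
      (hx : s.nat x = 0) (hq : Exec f q s t s') : Exec f (.ite x p q) s (t + 1) s'
  | whileDone {x : ℕ} {p : Program} {s : Store F}
      (hx : s.nat x = 0) : Exec f (.while x p) s 1 s
  | whileStep {x : ℕ} {p : Program} {s s' s'' : Store F} {t t' : ℕ}
      (hx : s.nat x ≠ 0) (hp : Exec f p s t s') (hq : Exec f (.while x p) s' t' s'') :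
      Exec f (.while x p) s (t + t' + 1) s''

/-- The law of an infinite sequence of independent fair coin tosses. -/
def coinMeasure : Measure (ℕ → Bool) :=
  Measure.infinitePi fun _ => (PMF.uniformOfFintype Bool).toMeasure

end

/-!
For a set `S` of variables, view `f` as a matrix whose rows are indexed by the values of the
variables in `S` and whose columns by the values of the others; call its rank the rank of the cut at
`S`. By Nisan's characterisation, `f` has an ROABP of width `w` in the order `τ` if and only if the
cuts at all prefixes of `τ` have rank at most `w` (`HasROABP.cutRankLE_prefixSet`,
`hasROABP_of_cutRankLE`). So an order has to be found along which the sets of small rank grow from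
`∅` to the set of all variables.

For a generic `f` with an ROABP of width `w > 1` in the order `σ`, the only cuts of rank at most `w`
are the forced ones: the prefixes and suffixes of `σ`, and the sets for which one side has so few
variables that it does not admit more than `w` monomials. For each of the other, transverse, cuts
there is an explicit polynomial of width `w` in the order `σ` and of larger rank at that cut
(`exists_large_cut`). Since the polynomials of width `w` are parametrised by the edge weights, which
form an irreducible space, one of them has large rank at all transverse cuts at once, and the
vanishing of a product of minors defines the exceptional set (`exists_exceptional_set`).
Consequently a set of small rank with more than `log_{d+1} w` variables always extends by some
variable to another such set (`HasROABP.exists_insert`): it is a prefix or a suffix of `σ`, or its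
complement is small; for `w = 1` all cuts have rank at most `1`. A greedy extension therefore never
gets stuck, from whatever set of small rank with `k = ⌊log_{d+1} w⌋ + 1` variables it starts; it
remains to guess the first `k` variables of `σ`, for which there are at most `(n + 1)ᵏ`
possibilities (`exists_attempt_length_eq`). Wrong guesses are harmless, because every set on the way
is tested.

The rank of a cut is tested by the determinant of the `(w + 1) × (w + 1)` matrix of the values of
`f` at the points that combine two of `w + 1` random points. The same random points serve for all
cuts. They are so chosen that with probability at least `1 - 2⁻ⁿ` no leading minor vanishes at any
cut of rank greater than `w` (`coinMeasure_testValue`, by the Schwartz–Zippel lemma and a union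
bound over all cuts, in the form of a product of polynomials); hence elimination without pivoting
suffices. The random access machine is handled by a program logic in which `Runs f p T s Q` bounds
the number of steps and a frame condition says what a program leaves unchanged; it leads to
`Runs.findOrder`.
-/

/-! ### Ranks of the cuts of a function -/

/-- The matrix of the values of `g` at the points that agree with `p i` on `S` and with `p j` off
`S`. One family of points serves for the rows and the columns, since a row reads only the
coordinates in `S` and a column only the others. -/
def cutMatrix {F : Type*} {n : ℕ} (g : (Fin n → F) → F) (S : Finset (Fin n)) {r : ℕ}
    (p : Fin r → Fin n → F) : Matrix (Fin r) (Fin r) F :=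
  Matrix.of fun i j => g (S.piecewise (p i) (p j))

/-- The function `g`, seen as an (infinite) matrix with rows `Fˢ` and columns `Fˢᶜ`, has rank at
most `w`: its minors of order `w + 1` vanish. -/
def CutRankLE {F : Type*} [Field F] {n : ℕ} (g : (Fin n → F) → F) (S : Finset (Fin n)) (w : ℕ) :
    Prop :=
  ∀ p : Fin (w + 1) → Fin n → F, (cutMatrix g S p).det = 0

/-- The function `g` is a sum of `r` products of a function of the coordinates in `S` and a
function of the other coordinates. -/
def IsCutSum {F : Type*} [Field F] {n : ℕ} (g : (Fin n → F) → F) (S : Finset (Fin n)) (r : ℕ) :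
    Prop :=
  ∃ A B : Fin r → (Fin n → F) → F, ∀ p q, g (S.piecewise p q) = ∑ v, A v p * B v q

section Cuts

variable {F : Type*} [Field F] {n : ℕ}

theorem IsCutSum.of_fintype {g : (Fin n → F) → F} {S : Finset (Fin n)} {V : Type*} [Fintype V]
    {r : ℕ} (hr : Fintype.card V = r) (A B : V → (Fin n → F) → F)
    (h : ∀ p q, g (S.piecewise p q) = ∑ v, A v p * B v q) : IsCutSum g S r := by
  let e := (Fintype.equivFinOfCardEq hr).symm
  refine ⟨fun v => A (e v), fun v => B (e v), fun p q => ?_⟩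
  rw [h, ← e.sum_comp]

theorem IsCutSum.mono {g : (Fin n → F) → F} {S : Finset (Fin n)} {r s : ℕ} (h : IsCutSum g S r)
    (hrs : r ≤ s) : IsCutSum g S s := by
  obtain ⟨A, B, h⟩ := h
  obtain ⟨t, rfl⟩ := Nat.exists_eq_add_of_le hrs
  refine ⟨Fin.append A fun _ _ => 0, Fin.append B fun _ _ => 0, fun p q => ?_⟩
  simp [Fin.sum_univ_add, h]

theorem IsCutSum.add {g₁ g₂ : (Fin n → F) → F} {S : Finset (Fin n)} {r s : ℕ}
    (h₁ : IsCutSum g₁ S r) (h₂ : IsCutSum g₂ S s) :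
    IsCutSum (fun y => g₁ y + g₂ y) S (r + s) := by
  obtain ⟨A₁, B₁, h₁⟩ := h₁
  obtain ⟨A₂, B₂, h₂⟩ := h₂
  refine ⟨Fin.append A₁ A₂, Fin.append B₁ B₂, fun p q => ?_⟩
  simp [Fin.sum_univ_add, h₁, h₂]

theorem IsCutSum.mul {g₁ g₂ : (Fin n → F) → F} {S : Finset (Fin n)} {r s : ℕ}
    (h₁ : IsCutSum g₁ S r) (h₂ : IsCutSum g₂ S s) :
    IsCutSum (fun y => g₁ y * g₂ y) S (r * s) := by
  obtain ⟨A₁, B₁, h₁⟩ := h₁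
  obtain ⟨A₂, B₂, h₂⟩ := h₂
  refine .of_fintype (V := Fin r × Fin s) (by simp) (fun v p => A₁ v.1 p * A₂ v.2 p)
    (fun v q => B₁ v.1 q * B₂ v.2 q) fun p q => ?_
  simp only [h₁, h₂, Finset.sum_mul_sum, Fintype.sum_prod_type]
  exact Finset.sum_congr rfl fun _ _ => Finset.sum_congr rfl fun _ _ => by ring

theorem IsCutSum.const (c : F) (S : Finset (Fin n)) : IsCutSum (fun _ => c) S 1 :=
  ⟨fun _ _ => c, fun _ _ => 1, by simp⟩

theorem IsCutSum.coord (φ : F → F) (i : Fin n) (S : Finset (Fin n)) :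
    IsCutSum (fun y => φ (y i)) S 1 := by
  by_cases hi : i ∈ S
  · exact ⟨fun _ p => φ (p i), fun _ _ => 1, by simp [hi]⟩
  · exact ⟨fun _ _ => 1, fun _ p => φ (p i), by simp [hi]⟩

theorem IsCutSum.sum {ι : Type*} (s : Finset ι) {g : ι → (Fin n → F) → F} {S : Finset (Fin n)}
    {r : ι → ℕ} (h : ∀ i ∈ s, IsCutSum (g i) S (r i)) :
    IsCutSum (fun y => ∑ i ∈ s, g i y) S (∑ i ∈ s, r i) := by
  classical
  induction s using Finset.induction_on with
  | empty => exact .of_fintype (V := Empty) (by simp) Empty.elim Empty.elim (by simp)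
  | insert a s ha ih =>
    simp only [Finset.sum_insert ha]
    exact (h a (by simp)).add (ih fun i hi => h i (by simp [hi]))

theorem IsCutSum.prod {ι : Type*} (s : Finset ι) {g : ι → (Fin n → F) → F} {S : Finset (Fin n)}
    {r : ι → ℕ} (h : ∀ i ∈ s, IsCutSum (g i) S (r i)) :
    IsCutSum (fun y => ∏ i ∈ s, g i y) S (∏ i ∈ s, r i) := by
  classical
  induction s using Finset.induction_on with
  | empty => simpa using IsCutSum.const (1 : F) S
  | insert a s ha ih =>
    simp only [Finset.prod_insert ha]
    exact (h a (by simp)).mul (ih fun i hi => h i (by simp [hi]))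

theorem IsCutSum.cutRankLE {g : (Fin n → F) → F} {S : Finset (Fin n)} {r w : ℕ}
    (h : IsCutSum g S r) (hr : r ≤ w) : CutRankLE g S w := by
  obtain ⟨A, B, h⟩ := h
  intro p
  have hM : cutMatrix g S p =
      (Matrix.of fun i v => A v (p i)) * (Matrix.of fun v j => B v (p j)) := by
    ext i j
    simp [cutMatrix, Matrix.mul_apply, h]
  by_contra hdet
  have hu : IsUnit (cutMatrix g S p) :=
    (Matrix.isUnit_iff_isUnit_det _).2 (isUnit_iff_ne_zero.2 hdet)
  have h1 := Matrix.rank_of_isUnit _ hu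
  have h2 := Matrix.rank_mul_le_left (Matrix.of fun (i : Fin (w + 1)) v => A v (p i))
    (Matrix.of fun v j => B v (p j))
  have h3 := Matrix.rank_le_width (Matrix.of fun (i : Fin (w + 1)) v => A v (p i))
  rw [← hM, h1, Fintype.card_fin] at h2
  omega

theorem CutRankLE.compl {g : (Fin n → F) → F} {S : Finset (Fin n)} {w : ℕ}
    (h : CutRankLE g S w) : CutRankLE g Sᶜ w := by
  intro p
  have : cutMatrix g Sᶜ p = (cutMatrix g S p).transpose := by
    ext i j
    simp [cutMatrix, Finset.piecewise_compl]
  rw [this, Matrix.det_transpose, h]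

theorem cutRankLE_compl_iff {g : (Fin n → F) → F} {S : Finset (Fin n)} {w : ℕ} :
    CutRankLE g Sᶜ w ↔ CutRankLE g S w :=
  ⟨fun h => by simpa using h.compl, CutRankLE.compl⟩

/-- By Laplace expansion, vanishing minors of one order force those of the next to vanish. -/
theorem CutRankLE.succ {g : (Fin n → F) → F} {S : Finset (Fin n)} {w : ℕ}
    (h : CutRankLE g S w) : CutRankLE g S (w + 1) := by
  intro p
  rw [Matrix.det_succ_row_zero]
  refine Finset.sum_eq_zero fun j _ => ?_
  have : (cutMatrix g S p).submatrix Fin.succ j.succAbove =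
      cutMatrix g S fun i => S.piecewise (p i.succ) (p (j.succAbove i)) := by
    ext a b
    simp only [cutMatrix, Matrix.submatrix_apply, Matrix.of_apply]
    congr 1
    ext x
    by_cases hx : x ∈ S <;> simp [hx]
  rw [this, h, mul_zero]

theorem CutRankLE.mono {g : (Fin n → F) → F} {S : Finset (Fin n)} {r w : ℕ} (hrw : r ≤ w)
    (h : CutRankLE g S r) : CutRankLE g S w :=
  Nat.le_induction h (fun _ _ ih => ih.succ) w hrw

/-- Linearly independent functions are told apart by their values at equally many points. -/
theorem exists_det_ne_zero {Y : Type*} {r : ℕ} {v : Fin r → Y → F} (hv : LinearIndependent F v) :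
    ∃ b : Fin r → Y, (Matrix.of fun i j => v i (b j)).det ≠ 0 := by
  let c : Y → Fin r → F := fun y i => v i y
  have htop : Submodule.span F (Set.range c) = ⊤ := by
    by_contra hne
    obtain ⟨φ, hφ, hle⟩ := Submodule.exists_le_ker_of_lt_top _ (lt_top_iff_ne_top.2 hne)
    apply hφ
    have hz := Fintype.linearIndependent_iff.1 hv (fun i => φ (Pi.single i 1)) (by
      ext y
      have : φ (c y) = 0 := hle (Submodule.subset_span (Set.mem_range_self y))
      rw [LinearMap.pi_apply_eq_sum_univ φ (c y)] at this
      have hs : ∀ i : Fin r, (fun j => if i = j then (1 : F) else 0) = Pi.single i 1 := by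
        intro i; ext j; simp [Pi.single_apply, eq_comm]
      simp only [hs, smul_eq_mul] at this
      simpa [mul_comm, c] using this)
    refine LinearMap.ext fun x => ?_
    rw [LinearMap.pi_apply_eq_sum_univ φ x]
    have hs : ∀ i : Fin r, (fun j => if i = j then (1 : F) else 0) = Pi.single i 1 := by
      intro i; ext j; simp [Pi.single_apply, eq_comm]
    simp [hs, hz]
  obtain ⟨b, hb, hspan, hli⟩ := exists_linearIndependent F (Set.range c)
  rw [htop] at hspan
  let e := Module.Basis.mk hli (by simp [hspan])
  have : Finite b := Module.Finite.finite_basis e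
  have : Fintype b := Fintype.ofFinite b
  have hcard : Fintype.card b = r := by
    rw [← Module.finrank_eq_card_basis e]; simp
  let ε := (Fintype.equivFinOfCardEq hcard).symm
  choose y hy using fun x : b => hb x.2
  refine ⟨fun j => y (ε j), ?_⟩
  have hli' : LinearIndependent F (Matrix.of fun i j => v i (y (ε j))).col := by
    have heq : (Matrix.of fun i j => v i (y (ε j))).col = Subtype.val ∘ ε :=
      funext fun j => hy (ε j)
    rw [heq]
    exact hli.comp ε ε.injective
  have := Matrix.linearIndependent_cols_iff_isUnit.1 hli'
  exact ((Matrix.isUnit_iff_isUnit_det _).1 this).ne_zero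

/-- If the cut at `S` has rank at most `w`, then `w` functions span its row space. -/
theorem CutRankLE.exists_span {g : (Fin n → F) → F} {S : Finset (Fin n)} {w : ℕ}
    (h : CutRankLE g S w) :
    ∃ b : Fin w → (Fin n → F) → F,
      (∀ v, b v ∈ Submodule.span F (Set.range fun a y => g (S.piecewise a y))) ∧
      Submodule.span F (Set.range fun a y => g (S.piecewise a y)) ≤
        Submodule.span F (Set.range b) := by
  obtain ⟨b, hb, hspan, hli⟩ :=
    exists_linearIndependent F (Set.range fun (a : Fin n → F) y => g (S.piecewise a y))
  have hcard : ¬ Nonempty (Fin (w + 1) ↪ b) := by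
    rintro ⟨e⟩
    choose a ha using fun x : b => hb x.2
    obtain ⟨z, hz⟩ := exists_det_ne_zero (hli.comp e e.injective)
    apply hz
    rw [← h fun i => S.piecewise (a (e i)) (z i)]
    congr 1
    ext i j
    simp only [cutMatrix, Matrix.of_apply, Function.comp_apply]
    rw [← ha (e i)]
    simp only
    congr 1
    ext x
    by_cases hx : x ∈ S <;> simp [hx]
  have hfin : Finite b := by
    by_contra hinf
    rw [not_finite_iff_infinite] at hinf
    exact hcard ⟨(Fin.valEmbedding.trans (Infinite.natEmbedding b))⟩
  have : Fintype b := Fintype.ofFinite b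
  have hle : Fintype.card b ≤ w := by
    by_contra hlt
    exact hcard (Function.Embedding.nonempty_of_card_le (by rw [Fintype.card_fin]; omega))
  obtain ⟨e⟩ : Nonempty (b ↪ Fin w) := Function.Embedding.nonempty_of_card_le (by simpa using hle)
  refine ⟨Function.extend e (fun x => (x : (Fin n → F) → F)) 0, fun v => ?_, ?_⟩
  · by_cases hv : ∃ x, e x = v
    · obtain ⟨x, rfl⟩ := hv
      rw [e.injective.extend_apply]
      exact Submodule.subset_span (hb x.2)
    · rw [Function.extend_apply' _ _ _ hv]
      exact Submodule.zero_mem _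
  · rw [← hspan]
    refine Submodule.span_mono fun x hx => ⟨e ⟨x, hx⟩, ?_⟩
    rw [e.injective.extend_apply]

end Cuts

/-! ### ROABPs and the ranks of prefix cuts -/

/-- The set of the first `m` variables in the order `σ`. -/
def prefixSet {n : ℕ} (σ : Equiv.Perm (Fin n)) (m : ℕ) : Finset (Fin n) :=
  Finset.univ.filter fun x => (σ.symm x : ℕ) < m

/-- The layer sizes `1, w, …, w, 1`. -/
def fullLayer (n w : ℕ) (i : Fin (n + 1)) : ℕ :=
  if i = 0 ∨ i = Fin.last n then 1 else w

/-- The sum over all paths of the products of the edge weights is computed by the transfer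
recursion `h` from the last layer back to the first. -/
theorem sum_paths {F : Type*} [CommSemiring F] : ∀ {n : ℕ} (ℓ : Fin (n + 1) → ℕ)
    (W : ∀ i : Fin n, Fin (ℓ i.castSucc) → Fin (ℓ i.succ) → F) (h : ∀ i, Fin (ℓ i) → F)
    (_ : ∀ i u, h i.castSucc u = ∑ v, W i u v * h i.succ v) (g : Fin (ℓ 0) → F),
    ∑ p : (i : Fin (n + 1)) → Fin (ℓ i),
      g (p 0) * (∏ i : Fin n, W i (p i.castSucc) (p i.succ)) * h (Fin.last n) (p (Fin.last n)) =
      ∑ u, g u * h 0 u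
  | 0, ℓ, W, h, hr, g => by
    refine Fintype.sum_equiv (Equiv.piUnique fun i : Fin 1 => Fin (ℓ i)) _ _ fun p => ?_
    rw [Finset.univ_eq_empty, Finset.prod_empty, mul_one]
    rfl
  | n + 1, ℓ, W, h, hr, g => by
    rw [← (Fin.consEquiv fun i => Fin (ℓ i)).sum_comp, Fintype.sum_prod_type]
    have ih := sum_paths (fun i => ℓ i.succ) (fun i => W i.succ) (fun i => h i.succ)
      (fun i u => hr i.succ u) fun v => ∑ u, g u * W 0 u v
    have h0 : ∑ u, g u * h 0 u = ∑ v : Fin (ℓ (Fin.succ 0)),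
        (∑ u, g u * W 0 u v) * h (Fin.succ 0) v := by
      simp only [Finset.sum_mul]
      rw [Finset.sum_comm]
      refine Finset.sum_congr rfl fun u _ => ?_
      rw [show h 0 u = _ from hr 0 u, Finset.mul_sum]
      exact Finset.sum_congr rfl fun v _ => by ring
    refine Eq.trans ?_ (ih.trans h0.symm)
    rw [Finset.sum_comm]
    refine Finset.sum_congr rfl fun p _ => ?_
    rw [mul_assoc, Finset.sum_mul]
    refine Finset.sum_congr rfl fun u _ => ?_
    rw [Fin.prod_univ_succ]
    simp only [Fin.consEquiv, Equiv.coe_fn_mk]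
    have : (Fin.cons u p : ∀ i, Fin (ℓ i)) (Fin.last (n + 1)) = p (Fin.last n) := rfl
    rw [this]
    have h1 : (Fin.cons u p : ∀ i, Fin (ℓ i)) (Fin.castSucc 0) = u := rfl
    simp only [Fin.cons_succ, Fin.cons_zero]
    have h2 : ∀ i : Fin n, (Fin.cons u p : ∀ i, Fin (ℓ i)) i.succ.castSucc = p i.castSucc :=
      fun i => rfl
    simp only [h2]
    change g u * (W 0 u (p 0) * _) * h (Fin.last n).succ (p (Fin.last n)) = _
    ring

section Prefix

variable {F : Type*} [Field F] {n d w : ℕ}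

theorem mem_prefixSet {σ : Equiv.Perm (Fin n)} {m : ℕ} {x : Fin n} :
    x ∈ prefixSet σ m ↔ (σ.symm x : ℕ) < m := by
  simp [prefixSet]

theorem ROABP.eval_toPoly (R : ROABP F n d) (σ : Equiv.Perm (Fin n)) (y : Fin n → F) :
    MvPolynomial.eval y (R.toPoly σ) = ∑ p : (i : Fin (n + 1)) → Fin (R.layer i),
      ∏ i : Fin n, (R.weight i (p i.castSucc) (p i.succ)).eval (y (σ i)) := by
  simp only [ROABP.toPoly, map_sum, map_prod]
  refine Finset.sum_congr rfl fun p _ => Finset.prod_congr rfl fun i _ => ?_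
  rw [← MvPolynomial.coe_aeval_eq_eval, RingHom.coe_coe, ← Polynomial.aeval_algHom_apply,
    MvPolynomial.aeval_X, Polynomial.coe_aeval_eq_eval]

/-- A transfer recursion with polynomial weights evaluates the polynomial of an ROABP. -/
theorem ROABP.eval_toPoly_eq (R : ROABP F n d) (σ : Equiv.Perm (Fin n)) (y : Fin n → F)
    (h : ∀ i, Fin (R.layer i) → F)
    (hr : ∀ i u, h i.castSucc u = ∑ v, (R.weight i u v).eval (y (σ i)) * h i.succ v)
    (hlast : ∀ u, h (Fin.last n) u = 1) :
    MvPolynomial.eval y (R.toPoly σ) = h 0 ⟨0, by rw [R.source]; exact one_pos⟩ := by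
  have := sum_paths R.layer (fun i u v => (R.weight i u v).eval (y (σ i))) h hr fun _ => 1
  simp only [hlast, mul_one, one_mul] at this
  rw [ROABP.eval_toPoly, this]
  have hs : Subsingleton (Fin (R.layer 0)) := by
    rw [R.source]; infer_instance
  rw [Fintype.sum_subsingleton]

theorem ROABP.layer_le_width (R : ROABP F n d) (i : Fin (n + 1)) : R.layer i ≤ R.width :=
  Finset.le_sup (f := R.layer) (Finset.mem_univ i)

/-- A path from the source to the sink passes through one vertex of the layer `i`: cut there. -/
theorem ROABP.isCutSum_prefixSet (R : ROABP F n d) (σ : Equiv.Perm (Fin n)) (i : Fin (n + 1)) :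
    IsCutSum (fun y => MvPolynomial.eval y (R.toPoly σ)) (prefixSet σ i) (R.layer i) := by
  -- `h y j u` is the sum over the paths from the vertex `u` of layer `j` to the sink
  let h : (Fin n → F) → ∀ j, Fin (R.layer j) → F := fun y =>
    Fin.reverseInduction (motive := fun j => Fin (R.layer j) → F) (fun _ => 1)
      fun j hj u => ∑ v, (R.weight j u v).eval (y (σ j)) * hj v
  have hlast : ∀ y u, h y (Fin.last n) u = 1 := fun y u => by
    simp only [h, Fin.reverseInduction_last]
  have hrec : ∀ y (j : Fin n) u, h y j.castSucc u =
      ∑ v, (R.weight j u v).eval (y (σ j)) * h y j.succ v := fun y j u => by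
    simp only [h, Fin.reverseInduction_castSucc]
  have hsuffix : ∀ (p q : Fin n → F) (j : Fin (n + 1)), i ≤ j → ∀ u,
      h ((prefixSet σ i).piecewise p q) j u = h q j u := by
    intro p q j
    induction j using Fin.reverseInduction with
    | last => intro _ u; rw [hlast, hlast]
    | cast j ih =>
      intro hij u
      rw [hrec, hrec]
      have hj : σ j ∉ prefixSet σ i := by
        rw [mem_prefixSet, Equiv.symm_apply_apply, not_lt]
        exact hij
      refine Finset.sum_congr rfl fun v _ => ?_
      rw [ih (hij.trans (Fin.castSucc_le_succ j)), Finset.piecewise_eq_of_notMem _ _ _ hj]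
  have hprefix : ∀ j : Fin (n + 1), j ≤ i → ∀ u, ∃ T : Fin (R.layer i) → (Fin n → F) → F,
      ∀ p q, h ((prefixSet σ i).piecewise p q) j u = ∑ v, T v p * h q i v := by
    intro j
    induction j using Fin.reverseInduction with
    | last =>
      intro hj u
      obtain rfl : i = Fin.last n := le_antisymm (Fin.le_last i) hj
      refine ⟨fun v _ => if v = u then 1 else 0, fun p q => ?_⟩
      rw [hsuffix p q _ le_rfl]
      simp
    | cast j ih =>
      intro hj u
      rcases hj.eq_or_lt with rfl | hlt
      · refine ⟨fun v _ => if v = u then 1 else 0, fun p q => ?_⟩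
        rw [hsuffix p q _ le_rfl]
        simp
      · choose T hT using ih (Fin.castSucc_lt_iff_succ_le.1 hlt)
        refine ⟨fun v p => ∑ v', (R.weight j u v').eval (p (σ j)) * T v' v p, fun p q => ?_⟩
        have hjm : σ j ∈ prefixSet σ i := by
          rw [mem_prefixSet, Equiv.symm_apply_apply]
          exact hlt
        rw [hrec]
        simp only [hT, Finset.piecewise_eq_of_mem _ _ _ hjm, Finset.mul_sum, Finset.sum_mul]
        rw [Finset.sum_comm]
        exact Finset.sum_congr rfl fun _ _ => Finset.sum_congr rfl fun _ _ => by ring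
  obtain ⟨T, hT⟩ := hprefix 0 (Fin.zero_le i) ⟨0, by rw [R.source]; exact one_pos⟩
  refine ⟨T, fun v q => h q i v, fun p q => ?_⟩
  rw [← hT]
  exact R.eval_toPoly_eq σ _ _ (hrec _) (hlast _)

theorem HasROABP.cutRankLE_prefixSet {σ : Equiv.Perm (Fin n)} {f : MvPolynomial (Fin n) F}
    (hf : HasROABP d w σ f) (m : ℕ) :
    CutRankLE (fun y => MvPolynomial.eval y f) (prefixSet σ m) w := by
  obtain ⟨R, hw, rfl⟩ := hf
  have key := fun i : Fin (n + 1) =>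
    (R.isCutSum_prefixSet σ i).cutRankLE ((R.layer_le_width i).trans hw)
  rcases le_or_gt m n with hm | hm
  · exact key ⟨m, by omega⟩
  · have : prefixSet σ m = prefixSet σ n := by
      ext x; simp only [mem_prefixSet]; omega
    rw [this]
    exact key (Fin.last n)

/-- A product of univariate polynomials, one in each variable, has rank `1` at every cut. -/
theorem HasROABP.cutRankLE_of_width_one {σ : Equiv.Perm (Fin n)} {f : MvPolynomial (Fin n) F}
    (hf : HasROABP d 1 σ f) (S : Finset (Fin n)) :
    CutRankLE (fun y => MvPolynomial.eval y f) S 1 := by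
  obtain ⟨R, hw, rfl⟩ := hf
  simp only [ROABP.eval_toPoly]
  have hs : ∀ i, Subsingleton (Fin (R.layer i)) := fun i =>
    Fin.subsingleton_iff_le_one.2 ((R.layer_le_width i).trans hw)
  have hcut := fun p : (i : Fin (n + 1)) → Fin (R.layer i) =>
    IsCutSum.prod Finset.univ fun (i : Fin n) _ => IsCutSum.coord
      (fun z => (R.weight i (p i.castSucc) (p i.succ)).eval z) (σ i) S
  refine (IsCutSum.sum Finset.univ fun p _ => hcut p).cutRankLE ?_
  rw [Finset.sum_congr rfl fun p _ => Finset.prod_const_one, ← Finset.card_eq_sum_ones]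
  exact Fintype.card_le_one_iff_subsingleton.2
    (inferInstance : Subsingleton ((i : Fin (n + 1)) → Fin (R.layer i)))

/-! ### Individual degrees -/

theorem degreeOf_aeval_X_le (q : Polynomial F) (i j : Fin n) :
    (Polynomial.aeval (MvPolynomial.X i : MvPolynomial (Fin n) F) q).degreeOf j ≤
      if j = i then q.natDegree else 0 := by
  rw [Polynomial.aeval_eq_sum_range]
  refine (MvPolynomial.degreeOf_sum_le _ _ _).trans (Finset.sup_le fun k hk => ?_)
  rw [MvPolynomial.smul_eq_C_mul]
  refine (MvPolynomial.degreeOf_C_mul_le _ _ _).trans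
    ((MvPolynomial.degreeOf_pow_le _ _ _).trans ?_)
  rw [MvPolynomial.degreeOf_X]
  have := Finset.mem_range.1 hk
  split_ifs <;> omega

theorem HasROABP.degreeOf_le {σ : Equiv.Perm (Fin n)} {f : MvPolynomial (Fin n) F}
    (hf : HasROABP d w σ f) (i : Fin n) : f.degreeOf i ≤ d := by
  obtain ⟨R, -, rfl⟩ := hf
  refine (MvPolynomial.degreeOf_sum_le _ _ _).trans (Finset.sup_le fun p _ => ?_)
  refine (MvPolynomial.degreeOf_prod_le _ _ _).trans ?_
  calc _ ≤ ∑ j : Fin n, if i = σ j then d else 0 := by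
        refine Finset.sum_le_sum fun j _ => (degreeOf_aeval_X_le _ _ _).trans ?_
        split_ifs
        exacts [R.natDegree_le _ _ _, le_rfl]
    _ = d := by
        rw [Equiv.sum_comp σ fun j => if i = j then d else 0]
        simp

theorem eval_eq_sum_coeffVector {f : MvPolynomial (Fin n) F} (hf : ∀ i, f.degreeOf i ≤ d)
    (y : Fin n → F) :
    MvPolynomial.eval y f = ∑ e, coeffVector d f e * ∏ i, y i ^ (e i : ℕ) := by
  rw [MvPolynomial.eval_eq']
  symm
  refine Finset.sum_bij_ne_zero
    (fun e _ _ => Finsupp.equivFunOnFinite.symm fun i => (e i : ℕ)) ?_ ?_ ?_ ?_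
  · intro e _ he
    rw [MvPolynomial.mem_support_iff]
    exact left_ne_zero_of_mul he
  · intro e _ _ e' _ _ h
    ext i
    exact DFunLike.congr_fun h i
  · intro m hm _
    have hle : ∀ i, m i < d + 1 := fun i =>
      Nat.lt_succ_of_le ((MvPolynomial.le_degreeOf_of_mem_support i hm).trans (hf i))
    have hm' : (Finsupp.equivFunOnFinite.symm fun i => m i) = m := by ext; rfl
    refine ⟨fun i => ⟨m i, hle i⟩, Finset.mem_univ _, ?_, hm'⟩
    simp only [coeffVector, hm']
    assumption
  · intro e _ _
    rfl

theorem exists_polynomial_eval_update {f : MvPolynomial (Fin n) F} (hf : ∀ i, f.degreeOf i ≤ d)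
    (i : Fin n) (y : Fin n → F) :
    ∃ q : Polynomial F, q.natDegree ≤ d ∧
      ∀ z, MvPolynomial.eval (Function.update y i z) f = q.eval z := by
  refine ⟨∑ e : Fin n → Fin (d + 1), Polynomial.C (coeffVector d f e *
    ∏ j ∈ Finset.univ.erase i, y j ^ (e j : ℕ)) * Polynomial.X ^ (e i : ℕ), ?_, fun z => ?_⟩
  · refine Polynomial.natDegree_sum_le_of_forall_le _ _ fun e _ => ?_
    exact (Polynomial.natDegree_C_mul_X_pow_le _ _).trans (Nat.lt_succ_iff.1 (e i).2)
  · rw [eval_eq_sum_coeffVector hf, Polynomial.eval_finsetSum]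
    refine Finset.sum_congr rfl fun e _ => ?_
    rw [← Finset.mul_prod_erase _ _ (Finset.mem_univ i)]
    simp only [Function.update_self, Polynomial.eval_mul, Polynomial.eval_C, Polynomial.eval_pow,
      Polynomial.eval_X]
    rw [mul_comm (z ^ _), mul_assoc]
    congr 2
    refine Finset.prod_congr rfl fun j hj => ?_
    rw [Function.update_of_ne (Finset.ne_of_mem_erase hj)]

/-- The monomials in the variables of `S` span the column space of the cut. -/
theorem cutRankLE_of_pow_card_le {f : MvPolynomial (Fin n) F} (hf : ∀ i, f.degreeOf i ≤ d)
    {S : Finset (Fin n)} (hS : (d + 1) ^ S.card ≤ w) :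
    CutRankLE (fun y => MvPolynomial.eval y f) S w := by
  let e := Equiv.piEquivPiSubtypeProd (fun x => x ∈ S) fun _ : Fin n => Fin (d + 1)
  have key : IsCutSum (fun y => MvPolynomial.eval y f) S ((d + 1) ^ S.card) := by
    refine .of_fintype (V := {x // x ∈ S} → Fin (d + 1)) (by simp)
      (fun a p => ∏ i : {x // x ∈ S}, p i ^ (a i : ℕ))
      (fun a q => ∑ b, coeffVector d f (e.symm (a, b)) *
        ∏ i : {x // x ∉ S}, q i ^ (b i : ℕ)) fun p q => ?_
    rw [eval_eq_sum_coeffVector hf, ← e.symm.sum_comp, Fintype.sum_prod_type]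
    refine Finset.sum_congr rfl fun a _ => ?_
    rw [Finset.mul_sum]
    refine Finset.sum_congr rfl fun b _ => ?_
    rw [← Fintype.prod_subtype_mul_prod_subtype (fun x => x ∈ S), mul_left_comm]
    have h1 : ∀ i : {x // x ∈ S},
        S.piecewise p q i ^ (e.symm (a, b) i : ℕ) = p i ^ (a i : ℕ) := fun i => by
      simp [e, Equiv.piEquivPiSubtypeProd]
    have h2 : ∀ i : {x // x ∉ S},
        S.piecewise p q i ^ (e.symm (a, b) i : ℕ) = q i ^ (b i : ℕ) := fun i => by
      simp [e, Equiv.piEquivPiSubtypeProd, i.2]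
    simp only [h1, h2]
    congr!
  exact key.cutRankLE hS

end Prefix

/-! ### Small prefix ranks give an ROABP -/

/-- The Lagrange basis polynomials for the nodes `0, …, d`. -/
noncomputable def gridBasis (F : Type*) [Field F] (d : ℕ) (m : Fin (d + 1)) : Polynomial F :=
  Lagrange.basis Finset.univ (fun j : Fin (d + 1) => ((j : ℕ) : F)) m

theorem fullLayer_le {n w : ℕ} (hw : 0 < w) (i : Fin (n + 1)) : fullLayer n w i ≤ w := by
  unfold fullLayer
  split_ifs <;> omega

theorem hasROABP_of_layer {F : Type*} [Field F] {n d w : ℕ} {R : ROABP F n d}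
    (hw : 0 < w) (hR : R.layer = fullLayer n w) (τ : Equiv.Perm (Fin n)) :
    HasROABP d w τ (R.toPoly τ) :=
  ⟨R, Finset.sup_le fun i _ => by rw [hR]; exact fullLayer_le hw i, rfl⟩

section Converse

variable {F : Type*} [Field F] [CharZero F] {n d w : ℕ}

theorem natCast_fin_injective (d : ℕ) :
    Function.Injective fun j : Fin (d + 1) => ((j : ℕ) : F) :=
  fun _ _ h => Fin.ext (Nat.cast_injective h)

theorem natDegree_gridBasis_le (m : Fin (d + 1)) : (gridBasis F d m).natDegree ≤ d := by
  refine Polynomial.natDegree_le_of_degree_le ?_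
  rw [gridBasis, Lagrange.degree_basis (natCast_fin_injective d).injOn (Finset.mem_univ m)]
  simp

theorem eval_gridBasis (m j : Fin (d + 1)) :
    (gridBasis F d m).eval ((j : ℕ) : F) = if m = j then 1 else 0 := by
  split_ifs with h
  · subst h
    exact Lagrange.eval_basis_self (natCast_fin_injective d).injOn (Finset.mem_univ _)
  · exact Lagrange.eval_basis_of_ne (v := fun j : Fin (d + 1) => ((j : ℕ) : F)) h
      (Finset.mem_univ _)

theorem eval_eq_sum_gridBasis {q : Polynomial F} (hq : q.natDegree ≤ d) (z : F) :
    q.eval z = ∑ m : Fin (d + 1), q.eval ((m : ℕ) : F) * (gridBasis F d m).eval z := by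
  conv_lhs => rw [Lagrange.eq_interpolate (s := Finset.univ) (f := q)
    (natCast_fin_injective (F := F) d).injOn (by
      refine lt_of_le_of_lt Polynomial.degree_le_natDegree ?_
      rw [Finset.card_univ, Fintype.card_fin]
      exact_mod_cast Nat.lt_succ_of_le hq)]
  simp [Lagrange.interpolate_apply, Polynomial.eval_finsetSum, gridBasis]

/-- The functions of the last variables that arise by fixing the variables in `S`. -/
def sectionSpan (g : (Fin n → F) → F) (S : Finset (Fin n)) : Submodule F ((Fin n → F) → F) :=
  Submodule.span F (Set.range fun a y => g (S.piecewise a y))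

/-- Reading one more variable: a section at `S` is a combination, with coefficients that are
polynomials of degree at most `d` in the variable `x`, of sections at `insert x S`. -/
theorem exists_transfer {f : MvPolynomial (Fin n) F} (hf : ∀ i, f.degreeOf i ≤ d)
    {S : Finset (Fin n)} {x : Fin n} (hx : x ∉ S) {ι : Type*} [Fintype ι]
    {b : ι → (Fin n → F) → F}
    (hb : sectionSpan (fun y => MvPolynomial.eval y f) (insert x S) ≤
      Submodule.span F (Set.range b))
    {g : (Fin n → F) → F} (hg : g ∈ sectionSpan (fun y => MvPolynomial.eval y f) S) :
    ∃ W : ι → Polynomial F, (∀ v, (W v).natDegree ≤ d) ∧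
      ∀ y, g y = ∑ v, (W v).eval (y x) * b v y := by
  induction hg using Submodule.span_induction with
  | mem g hg =>
    obtain ⟨a, rfl⟩ := hg
    have hmem : ∀ m : Fin (d + 1), ∃ c : ι → F, ∑ v, c v • b v = fun y =>
        MvPolynomial.eval ((insert x S).piecewise (Function.update a x ((m : ℕ) : F)) y) f :=
      fun m => (Submodule.mem_span_range_iff_exists_fun F).1
        (hb (Submodule.subset_span (Set.mem_range_self _)))
    choose c hc using hmem
    refine ⟨fun v => ∑ m, Polynomial.C (c m v) * gridBasis F d m, fun v => ?_, fun y => ?_⟩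
    · exact Polynomial.natDegree_sum_le_of_forall_le _ _ fun m _ =>
        (Polynomial.natDegree_C_mul_le _ _).trans (natDegree_gridBasis_le m)
    · obtain ⟨q, hq, hqe⟩ := exists_polynomial_eval_update hf x (S.piecewise a y)
      have h1 : Function.update (S.piecewise a y) x (y x) = S.piecewise a y := by
        rw [Function.update_eq_self_iff, Finset.piecewise_eq_of_notMem _ _ _ hx]
      have h2 : ∀ m : Fin (d + 1), q.eval ((m : ℕ) : F) = ∑ v, c m v * b v y := fun m => by
        have := congrFun (hc m) y
        simp only [Finset.sum_apply, Pi.smul_apply, smul_eq_mul] at this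
        rw [this, ← hqe]
        congr 2
        ext z
        by_cases hz : z = x
        · subst hz; simp
        · by_cases hzS : z ∈ S <;> simp [hz, hzS]
      change MvPolynomial.eval (S.piecewise a y) f = _
      rw [← h1, hqe, eval_eq_sum_gridBasis hq]
      simp only [h2, Polynomial.eval_finsetSum, Polynomial.eval_mul, Polynomial.eval_C,
        Finset.sum_mul]
      rw [Finset.sum_comm]
      exact Finset.sum_congr rfl fun _ _ => Finset.sum_congr rfl fun _ _ => by ring
  | zero => exact ⟨fun _ => 0, by simp, by simp⟩
  | add g₁ g₂ _ _ h₁ h₂ =>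
    obtain ⟨W₁, hd₁, h₁⟩ := h₁
    obtain ⟨W₂, hd₂, h₂⟩ := h₂
    refine ⟨fun v => W₁ v + W₂ v, fun v => Polynomial.natDegree_add_le_of_degree_le (hd₁ v) (hd₂ v),
      fun y => ?_⟩
    simp [h₁, h₂, add_mul, Finset.sum_add_distrib]
  | smul c g _ h =>
    obtain ⟨W, hd, h⟩ := h
    refine ⟨fun v => Polynomial.C c * W v, fun v =>
      (Polynomial.natDegree_C_mul_le _ _).trans (hd v), fun y => ?_⟩
    simp [h, Finset.mul_sum, mul_assoc]

theorem prefixSet_succ (τ : Equiv.Perm (Fin n)) (i : Fin n) :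
    prefixSet τ ((i : ℕ) + 1) = insert (τ i) (prefixSet τ i) := by
  ext x
  rw [Finset.mem_insert, mem_prefixSet, mem_prefixSet, Nat.lt_succ_iff_lt_or_eq, or_comm,
    ← Equiv.symm_apply_eq, Fin.ext_iff]

/-- A polynomial all of whose prefix cuts have rank at most `w` has an ROABP of width `w`. The
vertices of a layer stand for functions that span the sections at the prefix. -/
theorem exists_roabp_of_cutRankLE (hn : 0 < n) {τ : Equiv.Perm (Fin n)}
    {f : MvPolynomial (Fin n) F} (hf : ∀ i, f.degreeOf i ≤ d)
    (h : ∀ m, CutRankLE (fun y => MvPolynomial.eval y f) (prefixSet τ m) w) :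
    ∃ R : ROABP F n d, R.layer = fullLayer n w ∧ R.toPoly τ = f := by
  have hne : (0 : Fin (n + 1)) ≠ Fin.last n := by
    intro h0
    have := congrArg Fin.val h0
    simp at this
    omega
  have hlayer : ∀ i : Fin (n + 1), ∃ b : Fin (fullLayer n w i) → (Fin n → F) → F,
      (i = 0 → ∀ v, b v = fun y => MvPolynomial.eval y f) ∧
      (i = Fin.last n → ∀ v, b v = 1) ∧
      (i ≠ Fin.last n →
        ∀ v, b v ∈ sectionSpan (fun y => MvPolynomial.eval y f) (prefixSet τ i)) ∧
      sectionSpan (fun y => MvPolynomial.eval y f) (prefixSet τ i) ≤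
        Submodule.span F (Set.range b) := by
    intro i
    by_cases h0 : i = 0
    · subst h0
      have hl : fullLayer n w 0 = 1 := by simp [fullLayer]
      rw [hl]
      have hS : prefixSet τ ((0 : Fin (n + 1)) : ℕ) = ∅ := by ext; simp [mem_prefixSet]
      rw [hS]
      refine ⟨fun _ y => MvPolynomial.eval y f, fun _ _ => rfl, fun h => absurd h hne,
        fun _ _ => Submodule.subset_span ⟨0, by simp⟩, Submodule.span_mono ?_⟩
      rintro _ ⟨a, rfl⟩
      exact ⟨0, by simp⟩
    by_cases h1 : i = Fin.last n
    · subst h1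
      have hl : fullLayer n w (Fin.last n) = 1 := by simp [fullLayer]
      rw [hl]
      refine ⟨fun _ => 1, fun h => absurd h h0, fun _ _ => rfl, fun h => absurd rfl h, ?_⟩
      refine Submodule.span_le.2 ?_
      rintro _ ⟨a, rfl⟩
      refine (Submodule.mem_span_range_iff_exists_fun F).2
        ⟨fun _ => MvPolynomial.eval a f, ?_⟩
      ext y
      have : (prefixSet τ n).piecewise a y = a := by
        ext x; simp [mem_prefixSet]
      simp [this]
    · have hl : fullLayer n w i = w := by simp [fullLayer, h0, h1]
      rw [hl]
      obtain ⟨b, hb, hspan⟩ := (h i).exists_span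
      exact ⟨b, fun h => absurd h h0, fun h => absurd h h1, fun _ => hb, hspan⟩
  choose b hb0 hb1 hbmem hbspan using hlayer
  have htr : ∀ (i : Fin n) (u : Fin (fullLayer n w i.castSucc)),
      ∃ W : Fin (fullLayer n w i.succ) → Polynomial F, (∀ v, (W v).natDegree ≤ d) ∧
        ∀ y, b i.castSucc u y = ∑ v, (W v).eval (y (τ i)) * b i.succ v y := by
    intro i u
    refine exists_transfer hf (S := prefixSet τ i) (by simp [mem_prefixSet]) ?_
      (hbmem i.castSucc (Fin.castSucc_ne_last i) u)
    rw [← prefixSet_succ]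
    exact hbspan i.succ
  choose W hWd hW using htr
  refine ⟨⟨fullLayer n w, by simp [fullLayer], by simp [fullLayer], W, hWd⟩, rfl, ?_⟩
  refine MvPolynomial.funext fun y => ?_
  rw [ROABP.eval_toPoly_eq _ τ y (fun i u => b i u y) (fun i u => hW i u y)
    (fun u => by rw [hb1 _ rfl]; rfl)]
  rw [hb0 0 rfl]

theorem hasROABP_of_cutRankLE (hn : 0 < n) (hw : 0 < w) {τ : Equiv.Perm (Fin n)}
    {f : MvPolynomial (Fin n) F} (hf : ∀ i, f.degreeOf i ≤ d)
    (h : ∀ m, CutRankLE (fun y => MvPolynomial.eval y f) (prefixSet τ m) w) :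
    HasROABP d w τ f := by
  obtain ⟨R, hR, rfl⟩ := exists_roabp_of_cutRankLE hn hf h
  exact hasROABP_of_layer hw hR τ

end Converse

/-! ### Cuts of large rank -/

/-- A cut that is neither a prefix nor a suffix of the order `σ`, and for which neither side is so
small that it forces the rank to be at most `w`. -/
def IsTransverse {n : ℕ} (d w : ℕ) (σ : Equiv.Perm (Fin n)) (S : Finset (Fin n)) : Prop :=
  1 < w ∧ w < (d + 1) ^ S.card ∧ w < (d + 1) ^ Sᶜ.card ∧
    (∀ m, S ≠ prefixSet σ m) ∧ ∀ m, Sᶜ ≠ prefixSet σ m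

/-- A set that contains the first variable of the order and is no prefix leaves out a variable
between two of its members. -/
theorem exists_alternation_of_mem {n : ℕ} {σ : Equiv.Perm (Fin n)} {S : Finset (Fin n)}
    (hS : ∀ m, S ≠ prefixSet σ m) (hn : 0 < n) (h0 : σ ⟨0, hn⟩ ∈ S) :
    ∃ x y z, x ∈ S ∧ y ∉ S ∧ z ∈ S ∧ σ.symm x < σ.symm y ∧ σ.symm y < σ.symm z := by
  have hex : ∃ m, ∃ h : m < n, σ ⟨m, h⟩ ∉ S := by
    by_contra hne
    push Not at hne
    refine hS n ?_
    ext x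
    simp only [mem_prefixSet, (σ.symm x).2, iff_true]
    simpa using hne (σ.symm x) (σ.symm x).2
  classical
  obtain ⟨hm, hmS⟩ := Nat.find_spec hex
  have hmin : ∀ x, (σ.symm x : ℕ) < Nat.find hex → x ∈ S := by
    intro x hx
    by_contra hxS
    exact Nat.find_min hex hx ⟨(σ.symm x).2, by simpa using hxS⟩
  have hz : ∃ z ∈ S, ¬ (σ.symm z : ℕ) < Nat.find hex := by
    by_contra hne
    push Not at hne
    refine hS (Nat.find hex) ?_
    ext x
    rw [mem_prefixSet]
    exact ⟨hne x, hmin x⟩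
  obtain ⟨z, hzS, hz⟩ := hz
  refine ⟨σ ⟨0, hn⟩, σ ⟨_, hm⟩, z, h0, hmS, hzS, ?_, ?_⟩
  · rw [Equiv.symm_apply_apply, Equiv.symm_apply_apply, Fin.mk_lt_mk, Nat.pos_iff_ne_zero]
    intro h
    apply hmS
    simp only [h]
    exact h0
  · rw [Equiv.symm_apply_apply, Fin.lt_def]
    refine lt_of_le_of_ne (not_lt.1 hz) fun h => hmS ?_
    have : σ ⟨_, hm⟩ = z := by
      rw [← Equiv.eq_symm_apply]
      exact Fin.ext h
    rwa [this]

theorem exists_injective_of_card {α : Type*} [DecidableEq α] {T : Finset α} {x z : α} (hx : x ∈ T)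
    (hz : z ∈ T) (hxz : x ≠ z) {k : ℕ} (hk : k + 2 ≤ T.card) :
    ∃ a : Fin (k + 2) → α, Function.Injective a ∧ (∀ i, a i ∈ T) ∧ a 0 = x ∧ a 1 = z := by
  have hcard : Fintype.card (Fin k) ≤ Fintype.card ((T.erase x).erase z) := by
    rw [Fintype.card_fin, Fintype.card_coe,
      Finset.card_erase_of_mem (Finset.mem_erase.2 ⟨hxz.symm, hz⟩), Finset.card_erase_of_mem hx]
    omega
  obtain ⟨e⟩ := Function.Embedding.nonempty_of_card_le hcard
  have hmem : ∀ i, (e i : α) ≠ z ∧ (e i : α) ≠ x ∧ (e i : α) ∈ T := fun i => by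
    have := (e i).2
    rwa [Finset.mem_erase, Finset.mem_erase] at this
  refine ⟨Fin.cons x (Fin.cons z fun i => (e i : α)), ?_, ?_, rfl, rfl⟩
  · rw [Fin.cons_injective_iff, Fin.cons_injective_iff]
    refine ⟨?_, ?_, Subtype.val_injective.comp e.injective⟩
    · rintro ⟨i, hi⟩
      refine Fin.cases (fun h => hxz h.symm) (fun i h => (hmem i).2.1 h) i hi
    · rintro ⟨i, hi⟩
      exact (hmem i).1 hi
  · intro i
    refine Fin.cases hx (fun i => Fin.cases hz (fun i => (hmem i).2.2) i) i

section Witness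

variable {F : Type*} [Field F] {n d w : ℕ}

theorem IsCutSum.coord₂ (φ : F → F → F) {i j : Fin n} {S : Finset (Fin n)}
    (hij : i ∈ S ↔ j ∈ S) : IsCutSum (fun y => φ (y i) (y j)) S 1 := by
  by_cases hi : i ∈ S
  · exact ⟨fun _ p => φ (p i) (p j), fun _ _ => 1, by simp [hi, hij.1 hi]⟩
  · exact ⟨fun _ _ => 1, fun _ p => φ (p i) (p j), by simp [hi, mt hij.2 hi]⟩

theorem eval_aeval_X (q : Polynomial F) (i : Fin n) (y : Fin n → F) :
    MvPolynomial.eval y (Polynomial.aeval (MvPolynomial.X i : MvPolynomial (Fin n) F) q) =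
      q.eval (y i) := by
  rw [← MvPolynomial.coe_aeval_eq_eval, RingHom.coe_coe, ← Polynomial.aeval_algHom_apply,
    MvPolynomial.aeval_X, Polynomial.coe_aeval_eq_eval]

theorem not_cutRankLE_of_eq_one {g : (Fin n → F) → F} {S : Finset (Fin n)}
    (p : Fin (w + 1) → Fin n → F)
    (h : ∀ i j, g (S.piecewise (p i) (p j)) = if i = j then 1 else 0) : ¬ CutRankLE g S w := by
  intro hg
  have : cutMatrix g S p = 1 := by
    ext i j
    simp [cutMatrix, h, Matrix.one_apply]
  simpa [this] using hg p

theorem degreeOf_sum_aeval_mul_aeval_le {ι : Type*} (s : Finset ι) {q q' : ι → Polynomial F}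
    (hq : ∀ u, (q u).natDegree ≤ d) (hq' : ∀ u, (q' u).natDegree ≤ d) (a b i : Fin n) :
    (∑ u ∈ s, Polynomial.aeval (MvPolynomial.X a : MvPolynomial (Fin n) F) (q u) *
      Polynomial.aeval (MvPolynomial.X b) (q' u)).degreeOf i ≤
      (if i = a then d else 0) + if i = b then d else 0 := by
  refine (MvPolynomial.degreeOf_sum_le _ _ _).trans (Finset.sup_le fun u _ => ?_)
  refine (MvPolynomial.degreeOf_mul_le _ _ _).trans (add_le_add ?_ ?_)
  all_goals
    refine (degreeOf_aeval_X_le _ _ _).trans ?_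
    split_ifs
    exacts [by first | exact hq u | exact hq' u, le_rfl]

variable [CharZero F]

/-- A polynomial of rank `w + 1` at a transverse cut, for widths below `d + 1`. With the Lagrange
basis polynomials `L u` it is `(1 - z) * ∑ u < w, L u (x) * L u (y) + z * L 0 (x) * L w (y)`: a
cut that keeps `x` with `y` or `y` with `z` sees rank at most `w`, but when `x` and `z` are set
together against `y`, the value `z = 1` adds a row `L w`. -/
theorem exists_large_cut_of_lt {σ : Equiv.Perm (Fin n)} {S : Finset (Fin n)} {x y z : Fin n}
    (hx : x ∈ S) (hy : y ∉ S) (hz : z ∈ S) (hxy : σ.symm x < σ.symm y)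
    (hyz : σ.symm y < σ.symm z) (hw : 1 < w) (hwd : w < d + 1) :
    ∃ f : MvPolynomial (Fin n) F, (∀ i, f.degreeOf i ≤ d) ∧
      (∀ m, CutRankLE (fun v => MvPolynomial.eval v f) (prefixSet σ m) w) ∧
      ¬ CutRankLE (fun v => MvPolynomial.eval v f) S w := by
  have hxy' : x ≠ y := by rintro rfl; exact hy hx
  have hyz' : y ≠ z := by rintro rfl; exact hy hz
  have hxz' : x ≠ z := by rintro rfl; exact absurd (hxy.trans hyz) (lt_irrefl _)
  let L : ℕ → Polynomial F := fun u => gridBasis F d (Fin.ofNat (d + 1) u)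
  have hL : ∀ u, (L u).natDegree ≤ d := fun u => natDegree_gridBasis_le _
  have hLe : ∀ u v : ℕ, u ≤ w → v ≤ w → (L u).eval (v : F) = if u = v then 1 else 0 := by
    intro u v hu hv
    have h1 : v = (Fin.ofNat (d + 1) v : ℕ) := by
      simp [Nat.mod_eq_of_lt (show v < d + 1 by omega)]
    have h2 : Fin.ofNat (d + 1) u = Fin.ofNat (d + 1) v ↔ u = v := by
      rw [Fin.ext_iff]
      simp [Nat.mod_eq_of_lt (show v < d + 1 by omega), Nat.mod_eq_of_lt (show u < d + 1 by omega)]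
    simp only [L]
    conv_lhs => rw [h1]
    rw [eval_gridBasis]
    simp only [h2]
  let f : MvPolynomial (Fin n) F :=
    (1 - MvPolynomial.X z) * (∑ u ∈ Finset.range w, Polynomial.aeval (MvPolynomial.X x) (L u) *
      Polynomial.aeval (MvPolynomial.X y) (L u)) +
    MvPolynomial.X z * ∑ u ∈ {0}, Polynomial.aeval (MvPolynomial.X x) (L u) *
      Polynomial.aeval (MvPolynomial.X y) (L w)
  have hf : ∀ v, MvPolynomial.eval v f =
      (1 - v z) * (∑ u ∈ Finset.range w, (L u).eval (v x) * (L u).eval (v y)) +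
      v z * ((L 0).eval (v x) * (L w).eval (v y)) := by
    intro v
    simp only [f, map_add, map_mul, map_sub, map_one, map_sum, MvPolynomial.eval_X,
      eval_aeval_X, Finset.sum_singleton]
  refine ⟨f, fun i => ?_, fun m => ?_, ?_⟩
  · have hz1 : (MvPolynomial.X z : MvPolynomial (Fin n) F).degreeOf i ≤ if i = z then 1 else 0 := by
      rw [MvPolynomial.degreeOf_X]
    have hz2 : (1 - MvPolynomial.X z : MvPolynomial (Fin n) F).degreeOf i ≤
        if i = z then 1 else 0 := by
      refine (MvPolynomial.degreeOf_sub_le _ _ _).trans (max_le ?_ hz1)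
      simp
    have htot : ((if i = z then 1 else 0) + ((if i = x then d else 0) + if i = y then d else 0)) ≤
        d := by
      split_ifs <;> omega
    refine (MvPolynomial.degreeOf_add_le _ _ _).trans (max_le ?_ ?_)
    · exact ((MvPolynomial.degreeOf_mul_le _ _ _).trans (add_le_add hz2
        (degreeOf_sum_aeval_mul_aeval_le _ hL hL x y i))).trans htot
    · exact ((MvPolynomial.degreeOf_mul_le _ _ _).trans (add_le_add hz1
        (degreeOf_sum_aeval_mul_aeval_le _ hL (fun _ => hL w) x y i))).trans htot
  · simp only [hf]
    set P := prefixSet σ m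
    by_cases hyP : y ∈ P
    · -- the cut separates at most the last variable from the others
      have hxP : x ∈ P := by
        rw [mem_prefixSet] at hyP ⊢
        exact lt_trans hxy hyP
      have h1 := (IsCutSum.coord (fun t : F => 1 - t) z P).mul (IsCutSum.coord₂ (i := x) (j := y)
        (fun s t => ∑ u ∈ Finset.range w, (L u).eval s * (L u).eval t) (by simp [hxP, hyP]))
      have h2 := (IsCutSum.coord (fun t : F => t) z P).mul (IsCutSum.coord₂ (i := x) (j := y)
        (fun s t => (L 0).eval s * (L w).eval t) (by simp [hxP, hyP]))
      exact (h1.add h2).cutRankLE (by omega)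
    · -- the cut separates at most the first variable from the others
      have hzP : z ∉ P := by
        rw [mem_prefixSet] at hyP ⊢
        have : (σ.symm y : ℕ) < σ.symm z := hyz
        omega
      have h1 := IsCutSum.sum (Finset.range w) fun u _ =>
        (IsCutSum.coord (fun t : F => (L u).eval t) x P).mul
          (IsCutSum.coord₂ (i := y) (j := z) (fun s t => (1 - t) * (L u).eval s +
            if u = 0 then t * (L w).eval s else 0) (by simp [hyP, hzP]))
      have h2 := h1.cutRankLE (w := w) (by simp)
      convert h2 using 2 with v
      simp only [mul_add, Finset.sum_add_distrib, mul_ite, mul_zero, Finset.sum_ite_eq',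
        Finset.mem_range, show 0 < w by omega, if_true, Finset.mul_sum]
      congr 1
      · exact Finset.sum_congr rfl fun _ _ => by ring
      · ring
  · simp only [hf]
    refine not_cutRankLE_of_eq_one (fun i t => if t = z then (if (i : ℕ) = w then 1 else 0) else
      if t = x then (if (i : ℕ) = w then 0 else ((i : ℕ) : F)) else ((i : ℕ) : F)) fun i j => ?_
    simp only [Finset.piecewise_eq_of_mem _ _ _ hx, Finset.piecewise_eq_of_mem _ _ _ hz,
      Finset.piecewise_eq_of_notMem _ _ _ hy, if_true, if_neg hxz', if_neg hyz', if_neg hxy'.symm]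
    have hj := Nat.lt_succ_iff.1 j.2
    have hi := Nat.lt_succ_iff.1 i.2
    by_cases hiw : (i : ℕ) = w
    · simp only [hiw, if_true]
      have := hLe 0 0 (by omega) (by omega)
      simp only [Nat.cast_zero] at this
      rw [this, hLe w j le_rfl hj]
      simp [Fin.ext_iff, hiw]
    · simp only [hiw, if_false]
      have : ∀ u ∈ Finset.range w, (L u).eval ((i : ℕ) : F) * (L u).eval ((j : ℕ) : F) =
          if u = i then (if i = j then 1 else 0) else 0 := fun u hu => by
        rw [hLe u i (Finset.mem_range.1 hu).le hi, hLe u j (Finset.mem_range.1 hu).le hj]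
        by_cases h : u = (i : ℕ)
        · simp [h, Fin.ext_iff]
        · simp [h]
      rw [Finset.sum_congr rfl this, Finset.sum_ite_eq', if_pos (Finset.mem_range.2 (by omega))]
      simp

/-- A polynomial of rank `(d + 1) ^ (k + 2)` at a transverse cut and of rank at most
`(d + 1) ^ (k + 1)` at every prefix: a product of `k + 2` equality tests between variables on
different sides of the cut, two of which concern disjoint intervals of the order. -/
theorem exists_large_cut_of_le {σ : Equiv.Perm (Fin n)} {S : Finset (Fin n)} {x y z : Fin n}
    (hx : x ∈ S) (hy : y ∉ S) (hz : z ∈ S) (hxy : σ.symm x < σ.symm y)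
    (hyz : σ.symm y < σ.symm z) {k : ℕ} (hk : (d + 1) ^ (k + 1) ≤ w) (hk' : w < (d + 1) ^ (k + 2))
    (hS : k + 2 ≤ S.card) (hSc : k + 2 ≤ Sᶜ.card) :
    ∃ f : MvPolynomial (Fin n) F, (∀ i, f.degreeOf i ≤ d) ∧
      (∀ m, CutRankLE (fun v => MvPolynomial.eval v f) (prefixSet σ m) w) ∧
      ¬ CutRankLE (fun v => MvPolynomial.eval v f) S w := by
  have hxz' : x ≠ z := by rintro rfl; exact absurd (hxy.trans hyz) (lt_irrefl _)
  obtain ⟨a, ha, haS, ha0, ha1⟩ := exists_injective_of_card hx hz hxz' hS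
  -- the first two pairs lie before and after the position of `y`
  obtain ⟨b, hb, hbS, hsep⟩ : ∃ b : Fin (k + 2) → Fin n, Function.Injective b ∧
      (∀ i, b i ∈ Sᶜ) ∧ ∀ m, ∃ t, a t ∈ prefixSet σ m ↔ b t ∈ prefixSet σ m := by
    obtain ⟨y', hy'S, hy'⟩ := Finset.exists_mem_ne (s := Sᶜ) (by omega) y
    have hyS : y ∈ Sᶜ := Finset.mem_compl.2 hy
    have hne : σ.symm y' ≠ σ.symm y := fun h => hy' (σ.symm.injective h)
    rw [Fin.lt_def] at hxy hyz
    rcases lt_or_gt_of_ne hne with hlt | hlt <;> rw [Fin.lt_def] at hlt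
    · obtain ⟨b, hb, hbS, hb0, hb1⟩ := exists_injective_of_card hy'S hyS hy' hSc
      refine ⟨b, hb, hbS, fun m => ?_⟩
      by_cases hyP : (σ.symm y : ℕ) < m
      · refine ⟨0, ?_⟩
        rw [ha0, hb0, mem_prefixSet, mem_prefixSet]; omega
      · refine ⟨1, ?_⟩
        rw [ha1, hb1, mem_prefixSet, mem_prefixSet]; omega
    · obtain ⟨b, hb, hbS, hb0, hb1⟩ := exists_injective_of_card hyS hy'S hy'.symm hSc
      refine ⟨b, hb, hbS, fun m => ?_⟩
      by_cases hyP : (σ.symm y : ℕ) < m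
      · refine ⟨0, ?_⟩
        rw [ha0, hb0, mem_prefixSet, mem_prefixSet]; omega
      · refine ⟨1, ?_⟩
        rw [ha1, hb1, mem_prefixSet, mem_prefixSet]; omega
  have hc : Function.Injective (Sum.elim a b) :=
    ha.sumElim hb fun i j h => Finset.mem_compl.1 (hbS j) (h ▸ haS i)
  let f : MvPolynomial (Fin n) F := ∏ t, ∑ e ∈ Finset.univ,
    Polynomial.aeval (MvPolynomial.X (a t)) (gridBasis F d e) *
      Polynomial.aeval (MvPolynomial.X (b t)) (gridBasis F d e)
  have hf : ∀ v, MvPolynomial.eval v f = ∏ t, ∑ e,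
      (gridBasis F d e).eval (v (a t)) * (gridBasis F d e).eval (v (b t)) := by
    intro v
    simp only [f, map_prod, map_sum, map_mul, eval_aeval_X]
  refine ⟨f, fun i => ?_, fun m => ?_, ?_⟩
  · refine (MvPolynomial.degreeOf_prod_le _ _ _).trans ((Finset.sum_le_sum fun t _ =>
      degreeOf_sum_aeval_mul_aeval_le _ natDegree_gridBasis_le natDegree_gridBasis_le _ _ _).trans
      ?_)
    rw [Finset.sum_add_distrib]
    have : ∑ s, (if i = Sum.elim a b s then d else 0) =
        (∑ t, if i = a t then d else 0) + ∑ t, if i = b t then d else 0 := by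
      rw [Fintype.sum_sum_type]
      rfl
    rw [← this, ← Finset.sum_filter, Finset.sum_const, smul_eq_mul]
    refine (Nat.mul_le_mul_right d (Finset.card_le_one.2 fun s hs t ht => ?_)).trans (one_mul d).le
    exact hc ((Finset.mem_filter.1 hs).2.symm.trans (Finset.mem_filter.1 ht).2)
  · simp only [hf]
    obtain ⟨t₀, ht₀⟩ := hsep m
    have hcut : ∀ t ∈ Finset.univ, IsCutSum (fun v : Fin n → F => ∑ e,
        (gridBasis F d e).eval (v (a t)) * (gridBasis F d e).eval (v (b t))) (prefixSet σ m)
        (if t = t₀ then 1 else d + 1) := by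
      intro t _
      split_ifs with ht
      · subst ht
        exact IsCutSum.coord₂ (fun r s => ∑ e, (gridBasis F d e).eval r * (gridBasis F d e).eval s)
          ht₀
      · refine (IsCutSum.sum Finset.univ fun e _ =>
          (IsCutSum.coord (fun r => (gridBasis F d e).eval r) (a t) _).mul
            (IsCutSum.coord (fun r => (gridBasis F d e).eval r) (b t) _)).mono ?_
        simp
    refine (IsCutSum.prod Finset.univ hcut).cutRankLE (le_trans (le_of_eq ?_) hk)
    rw [← Finset.mul_prod_erase _ _ (Finset.mem_univ t₀), if_pos rfl, one_mul,
      Finset.prod_congr rfl fun t ht => if_neg (Finset.ne_of_mem_erase ht), Finset.prod_const,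
      Finset.card_erase_of_mem (Finset.mem_univ _)]
    simp
  · simp only [hf]
    obtain ⟨ε⟩ : Nonempty (Fin (w + 1) ↪ (Fin (k + 2) → Fin (d + 1))) :=
      Function.Embedding.nonempty_of_card_le (by simpa using hk')
    let p : Fin (w + 1) → Fin n → F := fun i =>
      Function.extend (Sum.elim a b) (fun s => (((Sum.elim (ε i) (ε i) s : Fin (d + 1)) : ℕ) : F)) 0
    have hpa : ∀ i t, p i (a t) = ((ε i t : ℕ) : F) := fun i t =>
      hc.extend_apply _ _ (Sum.inl t)
    have hpb : ∀ i t, p i (b t) = ((ε i t : ℕ) : F) := fun i t =>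
      hc.extend_apply _ _ (Sum.inr t)
    refine not_cutRankLE_of_eq_one p fun i j => ?_
    have : ∀ t, (∑ e, (gridBasis F d e).eval (S.piecewise (p i) (p j) (a t)) *
        (gridBasis F d e).eval (S.piecewise (p i) (p j) (b t))) =
        if ε i t = ε j t then 1 else 0 := fun t => by
      rw [Finset.piecewise_eq_of_mem _ _ _ (haS t),
        Finset.piecewise_eq_of_notMem _ _ _ (Finset.mem_compl.1 (hbS t)), hpa, hpb]
      simp [eval_gridBasis, eq_comm]
    simp only [this]
    by_cases hij : i = j
    · simp [hij]
    · obtain ⟨t, ht⟩ := Function.ne_iff.1 (ε.injective.ne hij)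
      rw [if_neg hij]
      exact Finset.prod_eq_zero (Finset.mem_univ t) (if_neg ht)

/-- Transverse cuts are not constrained by the widths in the order `σ`. -/
theorem exists_large_cut {σ : Equiv.Perm (Fin n)} {S : Finset (Fin n)}
    (hS : IsTransverse d w σ S) :
    ∃ f : MvPolynomial (Fin n) F, (∀ i, f.degreeOf i ≤ d) ∧
      (∀ m, CutRankLE (fun v => MvPolynomial.eval v f) (prefixSet σ m) w) ∧
      ¬ CutRankLE (fun v => MvPolynomial.eval v f) S w := by
  have key : ∀ T : Finset (Fin n), w < (d + 1) ^ T.card → w < (d + 1) ^ Tᶜ.card →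
      (∃ x y z, x ∈ T ∧ y ∉ T ∧ z ∈ T ∧ σ.symm x < σ.symm y ∧ σ.symm y < σ.symm z) →
      ∃ f : MvPolynomial (Fin n) F, (∀ i, f.degreeOf i ≤ d) ∧
      (∀ m, CutRankLE (fun v => MvPolynomial.eval v f) (prefixSet σ m) w) ∧
      ¬ CutRankLE (fun v => MvPolynomial.eval v f) T w := by
    rintro T hT hTc ⟨x, y, z, hx, hy, hz, hxy, hyz⟩
    by_cases hwd : w < d + 1
    · exact exists_large_cut_of_lt hx hy hz hxy hyz hS.1 hwd
    · have hw := hS.1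
      have hd : 1 < d + 1 := by
        rcases Nat.eq_zero_or_pos d with rfl | h
        · simp at hT; omega
        · omega
      obtain ⟨k, hk⟩ : ∃ k, Nat.log (d + 1) w = k + 1 :=
        Nat.exists_eq_succ_of_ne_zero (Nat.log_pos hd (not_lt.1 hwd)).ne'
      have h1 : (d + 1) ^ (k + 1) ≤ w := hk ▸ Nat.pow_log_le_self _ (by omega)
      have h2 : w < (d + 1) ^ (k + 2) := by
        have := Nat.lt_pow_succ_log_self hd w
        rwa [hk] at this
      exact exists_large_cut_of_le hx hy hz hxy hyz h1 h2
        ((Nat.pow_lt_pow_iff_right hd).1 (h1.trans_lt hT))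
        ((Nat.pow_lt_pow_iff_right hd).1 (h1.trans_lt hTc))
  obtain ⟨-, h1, h2, h3, h4⟩ := hS
  have hn : 0 < n := by
    rcases Nat.eq_zero_or_pos n with rfl | h
    · exact absurd (Subsingleton.elim _ _) (h3 0)
    · exact h
  by_cases h0 : σ ⟨0, hn⟩ ∈ S
  · exact key S h1 h2 (exists_alternation_of_mem h3 hn h0)
  · obtain ⟨f, hf, hfP, hfS⟩ := key Sᶜ h2 (by rwa [compl_compl])
      (exists_alternation_of_mem h4 hn (Finset.mem_compl.2 h0))
    exact ⟨f, hf, hfP, fun h => hfS h.compl⟩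

end Witness

/-! ### The generic condition -/

/-- The coefficients of the edge weights of an ROABP with layers `1, w, …, w, 1`. -/
abbrev WeightIndex (n d w : ℕ) : Type :=
  Σ i : Fin n, Fin (fullLayer n w i.castSucc) × Fin (fullLayer n w i.succ) × Fin (d + 1)

section Generic

variable {F : Type*} [Field F] {n d w : ℕ}

/-- The ROABP with prescribed coefficients of the edge weights. -/
noncomputable def weightROABP (θ : WeightIndex n d w → F) : ROABP F n d where
  layer := fullLayer n w
  source := by simp [fullLayer]
  sink := by simp [fullLayer]
  weight i u v := ∑ m : Fin (d + 1), Polynomial.C (θ ⟨i, u, v, m⟩) * Polynomial.X ^ (m : ℕ)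
  natDegree_le i u v := Polynomial.natDegree_sum_le_of_forall_le _ _ fun m _ =>
    (Polynomial.natDegree_C_mul_X_pow_le _ _).trans (Nat.lt_succ_iff.1 m.2)

theorem exists_weightROABP_eq {R : ROABP F n d} (hR : R.layer = fullLayer n w) :
    ∃ θ : WeightIndex n d w → F, weightROABP θ = R := by
  obtain ⟨layer, h0, h1, W, hW⟩ := R
  subst hR
  refine ⟨fun t => (W t.1 t.2.1 t.2.2.1).coeff t.2.2.2, ?_⟩
  unfold weightROABP
  congr 1
  ext i u v : 3
  conv_rhs => rw [(W i u v).as_sum_range' (d + 1) (Nat.lt_succ_of_le (hW i u v))]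
  simp only [← Polynomial.C_mul_X_pow_eq_monomial]
  exact Fin.sum_univ_eq_sum_range
    (fun m => Polynomial.C ((W i u v).coeff m) * Polynomial.X ^ m) (d + 1)

/-- The value at the point `y` of the polynomial of an ROABP, as a polynomial in the coefficients
of the edge weights. -/
noncomputable def genericValue (d w : ℕ) (σ : Equiv.Perm (Fin n)) (y : Fin n → F) :
    MvPolynomial (WeightIndex n d w) F :=
  ∑ p : (i : Fin (n + 1)) → Fin (fullLayer n w i), ∏ i : Fin n, ∑ m : Fin (d + 1),
    MvPolynomial.X ⟨i, p i.castSucc, p i.succ, m⟩ * MvPolynomial.C (y (σ i) ^ (m : ℕ))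

theorem eval_genericValue (σ : Equiv.Perm (Fin n)) (y : Fin n → F) (θ : WeightIndex n d w → F) :
    MvPolynomial.eval θ (genericValue d w σ y) =
      MvPolynomial.eval y ((weightROABP θ).toPoly σ) := by
  rw [ROABP.eval_toPoly]
  simp only [genericValue, map_sum, map_prod, map_mul, MvPolynomial.eval_X, MvPolynomial.eval_C]
  refine Finset.sum_congr rfl fun p _ => Finset.prod_congr rfl fun i _ => ?_
  simp [weightROABP, Polynomial.eval_finsetSum]

/-- The value at `y` of a polynomial of individual degree `d`, as a polynomial in its
coefficients. -/
noncomputable def coeffValue (d : ℕ) (y : Fin n → F) :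
    MvPolynomial (Fin n → Fin (d + 1)) F :=
  ∑ e, MvPolynomial.X e * MvPolynomial.C (∏ i, y i ^ (e i : ℕ))

theorem eval_coeffValue {f : MvPolynomial (Fin n) F} (hf : ∀ i, f.degreeOf i ≤ d)
    (y : Fin n → F) :
    MvPolynomial.eval (coeffVector d f) (coeffValue d y) = MvPolynomial.eval y f := by
  rw [eval_eq_sum_coeffVector hf]
  simp [coeffValue]

/-- A determinant of values, as a polynomial in the coefficients. -/
noncomputable def coeffMinor (d : ℕ) (S : Finset (Fin n)) (p : Fin (w + 1) → Fin n → F) :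
    MvPolynomial (Fin n → Fin (d + 1)) F :=
  (Matrix.of fun i j => coeffValue d (S.piecewise (p i) (p j))).det

theorem eval_coeffMinor {f : MvPolynomial (Fin n) F} (hf : ∀ i, f.degreeOf i ≤ d)
    (S : Finset (Fin n)) (p : Fin (w + 1) → Fin n → F) :
    MvPolynomial.eval (coeffVector d f) (coeffMinor d S p) =
      (cutMatrix (fun y => MvPolynomial.eval y f) S p).det := by
  rw [coeffMinor, RingHom.map_det]
  congr 1
  ext i j
  simp [cutMatrix, eval_coeffValue hf]

/-- An intersection of algebraic sets is algebraic. -/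
theorem isAlgebraicSet_roabpVariety (σ : Equiv.Perm (Fin n)) :
    IsAlgebraicSet (roabpVariety F d w σ) := by
  refine ⟨MvPolynomial.vanishingIdeal F (roabpVariety F d w σ), Set.Subset.antisymm ?_ ?_⟩
  · intro x hx q hq
    exact hq x hx
  · rintro x hx Z ⟨⟨I, rfl⟩, hZ⟩
    intro q hq
    refine hx q fun y hy => ?_
    exact hy _ ⟨⟨I, rfl⟩, hZ⟩ q hq

theorem IsAlgebraicSet.inter_zero {ι : Type*} {Z : Set (ι → F)} (hZ : IsAlgebraicSet Z)
    (q : MvPolynomial ι F) : IsAlgebraicSet (Z ∩ {x | MvPolynomial.eval x q = 0}) := by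
  obtain ⟨I, rfl⟩ := hZ
  refine ⟨I ⊔ Ideal.span {q}, Set.Subset.antisymm ?_ fun x hx => ⟨?_, ?_⟩⟩
  · rintro x ⟨hx, hq⟩ r hr
    obtain ⟨a, ha, b, hb, rfl⟩ := Submodule.mem_sup.1 hr
    obtain ⟨c, rfl⟩ := Ideal.mem_span_singleton'.1 hb
    have hq' : MvPolynomial.aeval x q = 0 :=
      (RingHom.congr_fun (MvPolynomial.coe_aeval_eq_eval x) q).trans hq
    rw [map_add, hx a ha, map_mul, hq', mul_zero, add_zero]
  · exact fun r hr => hx r (Ideal.mem_sup_left hr)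
  · have := hx q (Ideal.mem_sup_right (Ideal.mem_span_singleton_self q))
    exact (RingHom.congr_fun (MvPolynomial.coe_aeval_eq_eval x) q).symm.trans this

/-- Outside the exceptional set, a set of variables at which the cut has small rank can be extended
by one variable, once it is so large that it has to be a prefix or a suffix. -/
theorem HasROABP.exists_insert {σ : Equiv.Perm (Fin n)} {f : MvPolynomial (Fin n) F}
    (hw : 0 < w) (hf : HasROABP d w σ f)
    (hgen : ∀ S, IsTransverse d w σ S → ¬ CutRankLE (fun y => MvPolynomial.eval y f) S w)
    {S : Finset (Fin n)} (hS : CutRankLE (fun y => MvPolynomial.eval y f) S w)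
    (hcard : w < (d + 1) ^ S.card) (hne : S ≠ Finset.univ) :
    ∃ x ∉ S, CutRankLE (fun y => MvPolynomial.eval y f) (insert x S) w := by
  obtain ⟨x₀, hx₀⟩ : ∃ x, x ∉ S := by
    by_contra hall
    push Not at hall
    exact hne (Finset.eq_univ_of_forall hall)
  by_cases hw1 : w ≤ 1
  · obtain rfl : w = 1 := by omega
    exact ⟨x₀, hx₀, hf.cutRankLE_of_width_one _⟩
  by_cases hc : (d + 1) ^ Sᶜ.card ≤ w
  · refine ⟨x₀, hx₀, ?_⟩
    rw [← cutRankLE_compl_iff]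
    refine cutRankLE_of_pow_card_le hf.degreeOf_le (le_trans ?_ hc)
    exact Nat.pow_le_pow_right (Nat.succ_pos d) (Finset.card_le_card
      (Finset.compl_subset_compl.2 (Finset.subset_insert _ _)))
  by_cases hp : ∃ m, S = prefixSet σ m
  · obtain ⟨m, rfl⟩ := hp
    have hm : m < n := by
      by_contra hmn
      refine hne (Finset.eq_univ_of_forall fun x => ?_)
      rw [mem_prefixSet]
      have := (σ.symm x).2
      omega
    refine ⟨σ ⟨m, hm⟩, by simp [mem_prefixSet], ?_⟩
    have := prefixSet_succ σ ⟨m, hm⟩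
    simp only at this
    rw [← this]
    exact hf.cutRankLE_prefixSet _
  by_cases hs : ∃ m, Sᶜ = prefixSet σ m
  · -- `m` is the number of missing variables: it is made at most `n` first
    obtain ⟨m, hm⟩ := hs
    have hm' : Sᶜ = prefixSet σ (min m n) := by
      rw [hm]
      ext x
      have := (σ.symm x).2
      simp only [mem_prefixSet]
      omega
    have hpos : min m n ≠ 0 := by
      intro h0
      rw [h0] at hm'
      have : x₀ ∈ prefixSet σ 0 := hm' ▸ Finset.mem_compl.2 hx₀
      simp [mem_prefixSet] at this
    obtain ⟨k, hk⟩ := Nat.exists_eq_succ_of_ne_zero hpos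
    have hkn : k < n := by omega
    have hins := prefixSet_succ σ ⟨k, hkn⟩
    simp only at hins
    rw [hk, Nat.succ_eq_add_one, hins] at hm'
    refine ⟨σ ⟨k, hkn⟩, ?_, ?_⟩
    · rw [← Finset.mem_compl, hm']
      exact Finset.mem_insert_self _ _
    · rw [← cutRankLE_compl_iff, Finset.compl_insert, hm', Finset.erase_insert
        (by simp [mem_prefixSet])]
      exact hf.cutRankLE_prefixSet _
  · push Not at hp hs hc
    exact absurd hS (hgen S ⟨by omega, hcard, hc, hp, hs⟩)

variable [CharZero F]

/-- The minors that detect the transverse cuts are nonzero polynomials on the irreducible space of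
all edge weights, so that a single ROABP makes them all nonzero; they cut out the exceptional
set. -/
theorem exists_exceptional_set (hn : 0 < n) (hw : 0 < w) (σ : Equiv.Perm (Fin n)) :
    ∃ Z : Set ((Fin n → Fin (d + 1)) → F), IsAlgebraicSet Z ∧ Z ⊂ roabpVariety F d w σ ∧
      ∀ f : MvPolynomial (Fin n) F, HasROABP d w σ f → coeffVector d f ∉ Z →
        ∀ S, IsTransverse d w σ S → ¬ CutRankLE (fun y => MvPolynomial.eval y f) S w := by
  classical
  have hwit : ∀ S : Finset (Fin n), ∃ p : Fin (w + 1) → Fin n → F, IsTransverse d w σ S →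
      ∃ θ : WeightIndex n d w → F,
        (cutMatrix (fun y => MvPolynomial.eval y ((weightROABP θ).toPoly σ)) S p).det ≠ 0 := by
    intro S
    by_cases hS : IsTransverse d w σ S
    · obtain ⟨f, hf, hfP, hfS⟩ := exists_large_cut (F := F) hS
      obtain ⟨R, hR, rfl⟩ := exists_roabp_of_cutRankLE hn hf hfP
      obtain ⟨θ, rfl⟩ := exists_weightROABP_eq hR
      unfold CutRankLE at hfS
      push Not at hfS
      obtain ⟨p, hp⟩ := hfS
      exact ⟨p, fun _ => ⟨θ, hp⟩⟩
    · exact ⟨0, fun h => absurd h hS⟩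
  choose p hp using hwit
  let T := Finset.univ.filter fun S : Finset (Fin n) => IsTransverse d w σ S
  have hne : ∏ S ∈ T,
      (Matrix.of fun i j => genericValue d w σ (S.piecewise (p S i) (p S j))).det ≠ 0 := by
    refine Finset.prod_ne_zero_iff.2 fun S hS h0 => ?_
    obtain ⟨θ, hθ⟩ := hp S (Finset.mem_filter.1 hS).2
    apply hθ
    have := congrArg (MvPolynomial.eval θ) h0
    rw [RingHom.map_det, map_zero] at this
    rw [← this]
    congr 1
    ext i j
    simp [cutMatrix, eval_genericValue]
  obtain ⟨θ, hθ⟩ : ∃ θ : WeightIndex n d w → F, MvPolynomial.eval θ (∏ S ∈ T,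
      (Matrix.of fun i j => genericValue d w σ (S.piecewise (p S i) (p S j))).det) ≠ 0 := by
    by_contra hall
    push Not at hall
    exact hne (MvPolynomial.funext fun θ => by rw [hall, map_zero])
  have hR : HasROABP d w σ ((weightROABP θ).toPoly σ) := hasROABP_of_layer hw rfl σ
  refine ⟨roabpVariety F d w σ ∩ {x | MvPolynomial.eval x (∏ S ∈ T, coeffMinor d S (p S)) = 0},
    (isAlgebraicSet_roabpVariety σ).inter_zero _, ⟨Set.inter_subset_left, fun hsub => ?_⟩, ?_⟩
  · have hmem : coeffVector d ((weightROABP θ).toPoly σ) ∈ roabpVariety F d w σ :=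
      fun Z hZ => hZ.2 _ hR
    have h0 := (hsub hmem).2
    apply hθ
    rw [Set.mem_ofPred_eq, map_prod] at h0
    rw [map_prod, ← h0]
    refine Finset.prod_congr rfl fun S _ => ?_
    rw [eval_coeffMinor hR.degreeOf_le, RingHom.map_det]
    congr 1
    ext i j
    simp [cutMatrix, eval_genericValue]
  · intro f hf hfZ S hS hcut
    apply hfZ
    refine ⟨fun Z hZ => hZ.2 _ hf, ?_⟩
    rw [Set.mem_ofPred_eq, map_prod]
    refine Finset.prod_eq_zero (Finset.mem_filter.2 ⟨Finset.mem_univ S, hS⟩) ?_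
    rw [eval_coeffMinor hf.degreeOf_le, hcut]

end Generic

/-! ### Elimination without pivoting -/

/-- The `r`-th Schur complement of the matrix `M`: the result of `r` steps of Gaussian elimination
without row exchanges. -/
def schur {F : Type*} [Field F] (M : ℕ → ℕ → F) : ℕ → ℕ → ℕ → F
  | 0, i, j => M i j
  | r + 1, i, j => schur M r i j - schur M r r j * (schur M r i r / schur M r r r)

section Elimination

variable {F : Type*} [Field F]

theorem schur_succ_eq (M : ℕ → ℕ → F) (r i j : ℕ) :
    schur (fun i j => schur M 1 (i + 1) (j + 1)) r i j = schur M (r + 1) (i + 1) (j + 1) := by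
  induction r generalizing i j with
  | zero => rfl
  | succ r ih =>
    rw [schur, ih, ih, ih, ih]
    rfl

theorem det_eq_prod_schur (K : ℕ) (M : ℕ → ℕ → F) (hM : ∀ r, r + 1 < K → schur M r r r ≠ 0) :
    (Matrix.of fun i j : Fin K => M i j).det = ∏ r ∈ Finset.range K, schur M r r r := by
  induction K generalizing M with
  | zero => simp
  | succ K ih =>
    rw [Finset.prod_range_succ']
    rcases Nat.eq_zero_or_pos K with rfl | hK
    · simp [schur]
    · have h0 : M 0 0 ≠ 0 := hM 0 (by omega)
      let B : Matrix (Fin (K + 1)) (Fin (K + 1)) F :=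
        Matrix.of fun i j => if i = 0 then M 0 j else schur M 1 i j
      have hdet : (Matrix.of fun i j : Fin (K + 1) => M i j).det = B.det := by
        refine Matrix.det_eq_of_forall_row_eq_smul_add_const
          (fun i => if i = 0 then 0 else M i 0 / M 0 0) 0 (by simp) fun i j => ?_
        by_cases hi : i = 0
        · simp [B, hi]
        · simp only [B, Matrix.of_apply, hi, if_false, if_true, schur]
          ring
      have hcol : ∀ i : Fin K, B i.succ 0 = 0 := fun i => by
        simp only [B, Matrix.of_apply, Fin.succ_ne_zero, if_false, schur, Fin.val_zero]
        field_simp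
        ring
      rw [hdet, Matrix.det_succ_column_zero, Fin.sum_univ_succ]
      simp only [hcol, mul_zero, zero_mul, Finset.sum_const_zero, add_zero]
      have hsub : B.submatrix (Fin.succAbove 0) Fin.succ =
          Matrix.of fun i j : Fin K => (fun i j => schur M 1 (i + 1) (j + 1)) (i : ℕ) (j : ℕ) := by
        ext i j
        simp [B]
      rw [hsub, ih (fun i j => schur M 1 (i + 1) (j + 1))]
      · simp only [schur_succ_eq]
        simp [B, schur, mul_comm]
      · intro r hr
        rw [schur_succ_eq]
        exact hM (r + 1) (by omega)

/-- A zero pivot, after which the elimination is meaningless, makes the product of the pivots zero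
as well. -/
theorem prod_schur_eq_zero {K : ℕ} {M : ℕ → ℕ → F}
    (h : (Matrix.of fun i j : Fin K => M i j).det = 0) :
    ∏ r ∈ Finset.range K, schur M r r r = 0 := by
  by_contra hne
  refine hne ?_
  rw [← det_eq_prod_schur K M, h]
  intro r hr
  exact Finset.prod_ne_zero_iff.1 hne r (Finset.mem_range.2 (by omega))

/-- If no leading minor vanishes, then the elimination never meets a zero pivot. -/
theorem prod_schur_ne_zero {K : ℕ} {M : ℕ → ℕ → F}
    (h : ∀ r < K, (Matrix.of fun i j : Fin (r + 1) => M i j).det ≠ 0) :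
    ∏ r ∈ Finset.range K, schur M r r r ≠ 0 := by
  rw [Finset.prod_ne_zero_iff]
  intro r hr
  rw [Finset.mem_range] at hr
  induction r using Nat.strong_induction_on with
  | _ r ih =>
    have := h r hr
    rw [det_eq_prod_schur (r + 1) M fun s hs => ih s (by omega) (by omega)] at this
    exact Finset.prod_ne_zero_iff.1 this r (Finset.mem_range.2 (by omega))

end Elimination

/-! ### Random points -/

/-- The number with the binary digits `c 0, …, c (m - 1)`, the most significant one first. -/
def bitsNat (c : ℕ → Bool) : ℕ → ℕ
  | 0 => 0
  | m + 1 => 2 * bitsNat c m + (c m).toNat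

theorem bitsNat_lt (c : ℕ → Bool) (m : ℕ) : bitsNat c m < 2 ^ m := by
  induction m with
  | zero => simp [bitsNat]
  | succ m ih =>
    have := (c m).toNat_lt
    rw [bitsNat, pow_succ]
    omega

theorem bitsNat_injective {c c' : ℕ → Bool} {m : ℕ} (h : bitsNat c m = bitsNat c' m) :
    ∀ b < m, c b = c' b := by
  induction m with
  | zero => intro b hb; omega
  | succ m ih =>
    rw [bitsNat, bitsNat] at h
    have h1 := (c m).toNat_lt
    have h2 := (c' m).toNat_lt
    intro b hb
    rcases Nat.lt_succ_iff_lt_or_eq.1 hb with hb | rfl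
    · exact ih (by omega) b hb
    · have h3 : (c b).toNat = (c' b).toNat := by omega
      cases hc : c b <;> cases hc' : c' b <;> simp_all

theorem bitsNat_congr {c c' : ℕ → Bool} {m : ℕ} (h : ∀ b < m, c b = c' b) :
    bitsNat c m = bitsNat c' m := by
  induction m with
  | zero => rfl
  | succ m ih => rw [bitsNat, bitsNat, ih fun b hb => h b (by omega), h m (by omega)]

/-- The `q`-th block of `m` coins, read as a binary number. -/
def coinNat (m : ℕ) (ω : ℕ → Bool) (q : ℕ) : ℕ :=
  bitsNat (fun b => ω (q * m + b)) m

theorem coinNat_congr {m q Q : ℕ} (hq : q < Q) {ω ω' : ℕ → Bool} (h : ∀ l < Q * m, ω l = ω' l) :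
    coinNat m ω q = coinNat m ω' q := by
  refine bitsNat_congr fun b hb => h _ ?_
  have := Nat.mul_le_mul_right m (Nat.succ_le_of_lt hq)
  rw [Nat.succ_mul] at this
  omega

theorem coinMeasure_cylinder (L : ℕ) (x : ℕ → Bool) :
    coinMeasure {ω | ∀ l < L, ω l = x l} = (2 ^ L : ENNReal)⁻¹ := by
  have hset : {ω : ℕ → Bool | ∀ l < L, ω l = x l} =
      Set.pi (Finset.range L : Set ℕ) fun l => {x l} := by
    ext ω
    simp [Set.mem_pi]
  rw [hset, coinMeasure, Measure.infinitePi_pi _ fun _ _ => measurableSet_singleton _]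
  rw [Finset.prod_congr rfl fun l _ => PMF.toMeasure_apply_singleton _ _
    (measurableSet_singleton _)]
  simp [ENNReal.inv_pow]

instance : IsProbabilityMeasure coinMeasure := by
  unfold coinMeasure
  infer_instance

/-- A Schwartz–Zippel bound for points whose coordinates are given by blocks of fair coins. -/
theorem coinMeasure_eval_ne_zero {F : Type*} [Field F] [CharZero F] {Q m n : ℕ}
    {D : MvPolynomial (Fin Q) F} (hD : D ≠ 0) (hdeg : D.totalDegree * 2 ^ n ≤ 2 ^ m) :
    1 - (1 / 2 : ℝ) ^ n ≤ coinMeasure.real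
      {ω | MvPolynomial.eval (fun q : Fin Q => (coinNat m ω q : F)) D ≠ 0} := by
  classical
  set G : Set (ℕ → Bool) := {ω | MvPolynomial.eval (fun q : Fin Q => (coinNat m ω q : F)) D ≠ 0}
  let pad : (Fin (Q * m) → Bool) → ℕ → Bool := fun x l => if h : l < Q * m then x ⟨l, h⟩ else false
  let A := Finset.univ.filter fun x : Fin (Q * m) → Bool =>
    MvPolynomial.eval (fun q : Fin Q => (coinNat m (pad x) q : F)) D = 0
  have hcompl : Gᶜ = ⋃ x ∈ A, {ω | ∀ l < Q * m, ω l = pad x l} := by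
    ext ω
    simp only [G, Set.mem_compl_iff, Set.mem_ofPred_eq, not_not, Set.mem_iUnion, exists_prop]
    constructor
    · intro h
      have hω : ∀ l < Q * m, ω l = pad (fun l => ω l) l := fun l hl => by simp [pad, hl]
      refine ⟨fun l => ω l, Finset.mem_filter.2 ⟨Finset.mem_univ _, ?_⟩, hω⟩
      rw [← h]
      congr 2
      ext q
      rw [coinNat_congr q.2 hω]
    · rintro ⟨x, hx, hω⟩
      rw [← (Finset.mem_filter.1 hx).2]
      congr 2
      ext q
      rw [coinNat_congr q.2 hω]
  have hmeas : MeasurableSet Gᶜ := by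
    rw [hcompl]
    refine Finset.measurableSet_biUnion _ fun x _ => ?_
    have : {ω : ℕ → Bool | ∀ l < Q * m, ω l = pad x l} =
        Set.pi (Finset.range (Q * m) : Set ℕ) fun l => {pad x l} := by
      ext ω
      simp [Set.mem_pi]
    rw [this]
    exact MeasurableSet.pi (Finset.countable_toSet _) fun _ _ => measurableSet_singleton _
  -- distinct coin sequences give distinct points of the grid
  let grid : Finset F := (Finset.range (2 ^ m)).map ⟨fun k : ℕ => (k : F), Nat.cast_injective⟩
  have hgrid : grid.card = 2 ^ m := by simp [grid]
  have hA : A.card ≤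
      (Finset.filter (fun y => MvPolynomial.eval y D = 0)
        (Fintype.piFinset fun _ : Fin Q => grid)).card := by
    refine Finset.card_le_card_of_injOn (fun x (q : Fin Q) => (coinNat m (pad x) q : F)) ?_ ?_
    · intro x hx
      refine Finset.mem_coe.2 (Finset.mem_filter.2 ⟨Fintype.mem_piFinset.2 fun q => ?_,
        (Finset.mem_filter.1 hx).2⟩)
      exact Finset.mem_map.2 ⟨_, Finset.mem_range.2 (bitsNat_lt _ _), rfl⟩
    · intro x _ x' _ h
      ext1 l
      have hm : 0 < m := Nat.pos_of_ne_zero fun h0 => by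
        have := l.2
        simp [h0] at this
      have hq : (l : ℕ) / m < Q := Nat.div_lt_of_lt_mul (l.2.trans_eq (mul_comm _ _))
      have := bitsNat_injective (Nat.cast_injective (congrFun h ⟨l / m, hq⟩)) (l % m)
        (Nat.mod_lt _ hm)
      simpa [pad, Nat.div_add_mod'] using this
  have hSZ := MvPolynomial.schwartz_zippel_totalDegree hD grid
  rw [hgrid] at hSZ
  have hcount : A.card * 2 ^ n ≤ 2 ^ (Q * m) := by
    have h1 : (A.card : ℚ≥0) / ((2 ^ m : ℕ) : ℚ≥0) ^ Q ≤ D.totalDegree / ((2 ^ m : ℕ) : ℚ≥0) :=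
      le_trans (by gcongr) hSZ
    have h2 : (D.totalDegree : ℚ≥0) / ((2 ^ m : ℕ) : ℚ≥0) ≤ 1 / 2 ^ n := by
      rw [div_le_div_iff₀ (by positivity) (by positivity), one_mul]
      exact_mod_cast hdeg
    have h3 := h1.trans h2
    rw [div_le_div_iff₀ (by positivity) (by positivity), one_mul] at h3
    refine le_trans ?_ (le_of_eq (show (2 ^ m) ^ Q = 2 ^ (Q * m) by rw [mul_comm, pow_mul]))
    exact_mod_cast h3
  have hbound : coinMeasure.real Gᶜ ≤ (1 / 2 : ℝ) ^ n := by
    have h1 : coinMeasure Gᶜ ≤ A.card * (2 ^ (Q * m) : ENNReal)⁻¹ := by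
      rw [hcompl]
      refine (measure_biUnion_finset_le _ _).trans ?_
      simp [coinMeasure_cylinder]
    have h2 := ENNReal.toReal_mono (by
      refine ENNReal.mul_ne_top (by simp) ?_
      simp) h1
    refine h2.trans ?_
    rw [ENNReal.toReal_mul, ENNReal.toReal_inv, ENNReal.toReal_pow, ENNReal.toReal_natCast,
      ENNReal.toReal_ofNat, ← div_eq_mul_inv, one_div, inv_pow, ← one_div,
      div_le_div_iff₀ (by positivity) (by positivity), one_mul]
    exact_mod_cast hcount
  have hG : coinMeasure.real G = 1 - coinMeasure.real Gᶜ := by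
    rw [← probReal_compl_eq_one_sub hmeas, compl_compl]
  rw [hG]
  linarith

/-! ### The test of a cut at random points -/

section Test

variable {F : Type*} [Field F] {n d w : ℕ}

/-- The points in a flat array: the `i`-th point of length `n` starts at position `i * n`. -/
def flatPoint (n : ℕ) (P : ℕ → F) (i : ℕ) : Fin n → F := fun v => P (i * n + v)

/-- The matrix of the values of `f` at the points in a flat array. -/
noncomputable def testMatrix (f : MvPolynomial (Fin n) F) (P : ℕ → F) (S : Finset (Fin n))
    (i j : ℕ) : F :=
  MvPolynomial.eval (S.piecewise (flatPoint n P i) (flatPoint n P j)) f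

/-- The product of the pivots of the elimination; the cut passes the test if it is zero. -/
noncomputable def testValue (f : MvPolynomial (Fin n) F) (w : ℕ) (P : ℕ → F)
    (S : Finset (Fin n)) : F :=
  ∏ r ∈ Finset.range (w + 1), schur (testMatrix f P S) r r r

theorem testValue_eq_zero {f : MvPolynomial (Fin n) F} {S : Finset (Fin n)}
    (h : CutRankLE (fun y => MvPolynomial.eval y f) S w) (P : ℕ → F) :
    testValue f w P S = 0 :=
  prod_schur_eq_zero (h fun i => flatPoint n P i)

/-- A leading minor of the test matrix, as a polynomial in the entries of the array. -/
noncomputable def testMinor (f : MvPolynomial (Fin n) F) (w : ℕ) (S : Finset (Fin n))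
    (r : Fin (w + 1)) : MvPolynomial (Fin ((w + 1) * n)) F :=
  (Matrix.of fun i j : Fin (r + 1) => MvPolynomial.rename (fun v : Fin n => finProdFinEquiv
    ((if v ∈ S then ⟨i, by omega⟩ else ⟨j, by omega⟩ : Fin (w + 1)), v)) f).det

theorem eval_testMinor (f : MvPolynomial (Fin n) F) (S : Finset (Fin n)) (r : Fin (w + 1))
    (P : Fin ((w + 1) * n) → F) :
    MvPolynomial.eval P (testMinor f w S r) =
      (cutMatrix (fun y => MvPolynomial.eval y f) S fun (i : Fin (r + 1)) v =>
        P (finProdFinEquiv (⟨i, by omega⟩, v))).det := by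
  rw [testMinor, RingHom.map_det]
  congr 1
  ext i j
  simp only [cutMatrix, Matrix.of_apply, RingHom.mapMatrix_apply, Matrix.map_apply,
    MvPolynomial.eval_rename]
  congr 2
  ext v
  by_cases hv : v ∈ S <;> simp [hv]

theorem testMinor_ne_zero {f : MvPolynomial (Fin n) F} {S : Finset (Fin n)}
    (h : ¬ CutRankLE (fun y => MvPolynomial.eval y f) S w) (r : Fin (w + 1)) :
    testMinor f w S r ≠ 0 := by
  have hr : ¬ CutRankLE (fun y => MvPolynomial.eval y f) S r :=
    fun hr => h (hr.mono (Nat.lt_succ_iff.1 r.2))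
  unfold CutRankLE at hr
  push Not at hr
  obtain ⟨p, hp⟩ := hr
  intro h0
  apply hp
  let P : Fin ((w + 1) * n) → F := fun q =>
    if h : ((finProdFinEquiv.symm q).1 : ℕ) < r + 1 then p ⟨_, h⟩ (finProdFinEquiv.symm q).2 else 0
  have := eval_testMinor f S r P
  rw [h0, map_zero] at this
  rw [this]
  congr 2
  ext i v
  simp only [P, Equiv.symm_apply_apply]
  rw [dif_pos i.2]

theorem testValue_ne_zero {f : MvPolynomial (Fin n) F} {S : Finset (Fin n)} {P : ℕ → F}
    (h : ∀ r, MvPolynomial.eval (fun q : Fin _ => P q) (testMinor f w S r) ≠ 0) :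
    testValue f w P S ≠ 0 := by
  refine prod_schur_ne_zero fun r hr => ?_
  have := h ⟨r, hr⟩
  have hP : (fun (i : Fin (r + 1)) (v : Fin n) => P (finProdFinEquiv
      ((⟨i, by omega⟩ : Fin (w + 1)), v) : Fin ((w + 1) * n))) =
      fun i : Fin (r + 1) => flatPoint n P i := by
    ext i v
    simp [flatPoint, add_comm, mul_comm]
  rw [eval_testMinor, hP] at this
  exact this

theorem totalDegree_det_le {ι : Type*} {r e : ℕ} {M : Matrix (Fin r) (Fin r) (MvPolynomial ι F)}
    (h : ∀ i j, (M i j).totalDegree ≤ e) : M.det.totalDegree ≤ r * e := by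
  rw [Matrix.det_apply']
  refine MvPolynomial.totalDegree_finsetSum_le fun τ _ => ?_
  refine (MvPolynomial.totalDegree_mul _ _).trans ?_
  rw [show ((Equiv.Perm.sign τ : ℤ) : MvPolynomial ι F) =
    MvPolynomial.C ((Equiv.Perm.sign τ : ℤ) : F) by simp, MvPolynomial.totalDegree_C, zero_add]
  refine (MvPolynomial.totalDegree_finsetProd _ _).trans
    ((Finset.sum_le_sum fun i _ => h _ i).trans ?_)
  simp

theorem totalDegree_le_of_degreeOf_le {f : MvPolynomial (Fin n) F} (hf : ∀ i, f.degreeOf i ≤ d) :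
    f.totalDegree ≤ n * d := by
  refine Finset.sup_le fun s hs => ?_
  rw [Finsupp.sum_fintype _ _ fun _ => rfl]
  refine (Finset.sum_le_sum fun i _ =>
    (MvPolynomial.le_degreeOf_of_mem_support i hs).trans (hf i)).trans ?_
  simp

/-- The number of coins that are used for each coordinate of the random points. The product over
all cuts of all leading minors has degree at most `2ⁿ * (w + 1)² * n * d`, and this many coins make
a grid that is `2ⁿ` times larger; they are counted by additions alone. -/
def numCoins (n d w : ℕ) : ℕ := n + n + n + d + (w + 1) + (w + 1)

/-- With probability at least `1 - 2⁻ⁿ`, the random points expose the rank of every cut. -/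
theorem coinMeasure_testValue [CharZero F] {f : MvPolynomial (Fin n) F}
    (hf : ∀ i, f.degreeOf i ≤ d) :
    1 - (1 / 2 : ℝ) ^ n ≤ coinMeasure.real {ω | ∀ P : ℕ → F,
      (∀ q < (w + 1) * n, P q = coinNat (numCoins n d w) ω q) → ∀ S,
        testValue f w P S = 0 ↔ CutRankLE (fun y => MvPolynomial.eval y f) S w} := by
  classical
  let T := Finset.univ.filter fun S => ¬ CutRankLE (fun y => MvPolynomial.eval y f) S w
  let D : MvPolynomial (Fin ((w + 1) * n)) F := ∏ S ∈ T, ∏ r, testMinor f w S r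
  have hD : D ≠ 0 := Finset.prod_ne_zero_iff.2 fun S hS =>
    Finset.prod_ne_zero_iff.2 fun r _ => testMinor_ne_zero (Finset.mem_filter.1 hS).2 r
  have hdeg : D.totalDegree ≤ 2 ^ n * ((w + 1) * ((w + 1) * (n * d))) := by
    refine (MvPolynomial.totalDegree_finsetProd _ _).trans ((Finset.sum_le_card_nsmul _ _
      ((w + 1) * ((w + 1) * (n * d))) fun S _ => ?_).trans ?_)
    · refine (MvPolynomial.totalDegree_finsetProd _ _).trans ((Finset.sum_le_card_nsmul _ _
        ((w + 1) * (n * d)) fun r _ => ?_).trans (by simp))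
      refine (totalDegree_det_le (e := n * d) fun i j => ?_).trans
        (Nat.mul_le_mul_right _ (by omega))
      exact (MvPolynomial.totalDegree_rename_le _ _).trans (totalDegree_le_of_degreeOf_le hf)
    · rw [smul_eq_mul]
      refine Nat.mul_le_mul_right _ ((Finset.card_le_univ _).trans ?_)
      simp
  have hbits : D.totalDegree * 2 ^ n ≤ 2 ^ numCoins n d w := by
    have h1 := (Nat.lt_two_pow_self (n := w + 1)).le
    have h2 := (Nat.lt_two_pow_self (n := n)).le
    have h3 := (Nat.lt_two_pow_self (n := d)).le
    calc D.totalDegree * 2 ^ n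
        ≤ 2 ^ n * (2 ^ (w + 1) * (2 ^ (w + 1) * (2 ^ n * 2 ^ d))) * 2 ^ n := by
          refine Nat.mul_le_mul_right _ (hdeg.trans ?_)
          gcongr
      _ = 2 ^ numCoins n d w := by
          simp only [numCoins, pow_add]
          ring
  refine (coinMeasure_eval_ne_zero hD hbits).trans (measureReal_mono ?_)
  intro ω hω P hP S
  refine ⟨fun h0 => ?_, fun h => testValue_eq_zero h P⟩
  by_contra hS
  refine testValue_ne_zero (fun r h1 => hω ?_) h0
  rw [map_prod]
  refine Finset.prod_eq_zero (Finset.mem_filter.2 ⟨Finset.mem_univ S, hS⟩) ?_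
  rw [map_prod]
  refine Finset.prod_eq_zero (Finset.mem_univ r) ?_
  rw [← h1, show (fun q : Fin ((w + 1) * n) => P q) =
    fun q : Fin _ => (coinNat (numCoins n d w) ω q : F) from funext fun q => hP q q.2]

end Test

/-! ### A program logic with step counts -/

section Logic

variable {F : Type*} {n : ℕ}

/-- The program `p`, started in `s`, halts after at most `T` steps in a memory that satisfies
`Q`. -/
def Runs [Field F] (f : MvPolynomial (Fin n) F) (p : Program) (T : ℕ) (s : Store F)
    (Q : Store F → Prop) : Prop :=
  ∃ t s', Exec f p s t s' ∧ t ≤ T ∧ Q s'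

/-- The integer variables that an instruction writes. -/
def Instr.natVars : Instr → List ℕ
  | setNat x _ | addNat x _ _ | subNat x _ _ | readNat x _ _ | toss x | testFld x _ => [x]
  | _ => []

/-- The integer arrays that an instruction writes. -/
def Instr.natArrs : Instr → List ℕ
  | writeNat a _ _ => [a]
  | _ => []

/-- The field variables that an instruction writes. -/
def Instr.fldVars : Instr → List ℕ
  | zeroFld u | oneFld u | addFld u _ _ | subFld u _ _ | mulFld u _ _ | divFld u _ _
  | readFld u _ _ | query u _ => [u]
  | _ => []

/-- The field arrays that an instruction writes. -/
def Instr.fldArrs : Instr → List ℕ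
  | writeFld g _ _ => [g]
  | _ => []

/-- The integer variables into which an instruction tosses a coin. -/
def Instr.tosses : Instr → List ℕ
  | toss x => [x]
  | _ => []

/-- The values of `m` at the instructions of a program, collected in a list. -/
def Program.collect (m : Instr → List ℕ) : Program → List ℕ
  | .instr c => m c
  | .seq p q => p.collect m ++ q.collect m
  | .ite _ p q => p.collect m ++ q.collect m
  | .while _ p => p.collect m

/-- The memories `s` and `s'` agree outside the variables and arrays that `p` may write, and in the
unread coins if `p` does not toss any. -/
structure Frame (p : Program) (s s' : Store F) : Prop where
  nat : ∀ x, x ∉ p.collect Instr.natVars → s'.nat x = s.nat x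
  natArr : ∀ a, a ∉ p.collect Instr.natArrs → s'.natArr a = s.natArr a
  fld : ∀ u, u ∉ p.collect Instr.fldVars → s'.fld u = s.fld u
  fldArr : ∀ g, g ∉ p.collect Instr.fldArrs → s'.fldArr g = s.fldArr g
  coins : p.collect Instr.tosses = [] → s'.coins = s.coins

theorem Frame.refl (p : Program) (s : Store F) : Frame p s s :=
  ⟨fun _ _ => rfl, fun _ _ => rfl, fun _ _ => rfl, fun _ _ => rfl, fun _ => rfl⟩

theorem Frame.trans {p : Program} {s s' s'' : Store F} (h : Frame p s s') (h' : Frame p s' s'') :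
    Frame p s s'' :=
  ⟨fun x hx => (h'.nat x hx).trans (h.nat x hx),
    fun x hx => (h'.natArr x hx).trans (h.natArr x hx),
    fun x hx => (h'.fld x hx).trans (h.fld x hx),
    fun x hx => (h'.fldArr x hx).trans (h.fldArr x hx),
    fun hx => (h'.coins hx).trans (h.coins hx)⟩

theorem Frame.mono {p q : Program} {s s' : Store F} (h : Frame p s s')
    (hpq : ∀ m, p.collect m ⊆ q.collect m) : Frame q s s' :=
  ⟨fun x hx => h.nat x fun h => hx (hpq _ h), fun x hx => h.natArr x fun h => hx (hpq _ h),
    fun x hx => h.fld x fun h => hx (hpq _ h), fun x hx => h.fldArr x fun h => hx (hpq _ h),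
    fun hx => h.coins (List.eq_nil_of_subset_nil (hx ▸ hpq _))⟩

variable [Field F]

theorem Instr.frame (f : MvPolynomial (Fin n) F) (c : Instr) (s : Store F) :
    Frame (.instr c) s (c.step f s) := by
  cases c <;> constructor <;> intros <;>
    simp_all [Program.collect, Instr.natVars, Instr.natArrs, Instr.fldVars, Instr.fldArrs,
      Instr.tosses, Instr.step, Store.putNat, Store.putNatArr, Store.putFld, Store.putFldArr]

theorem Exec.frame {f : MvPolynomial (Fin n) F} {p : Program} {s s' : Store F} {t : ℕ}
    (h : Exec f p s t s') : Frame p s s' := by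
  induction h with
  | instr c s => exact c.frame f s
  | seq _ _ hp hq =>
    exact (hp.mono fun m => List.subset_append_left _ _).trans
      (hq.mono fun m => List.subset_append_right _ _)
  | iteTrue _ _ hp => exact hp.mono fun m => List.subset_append_left _ _
  | iteFalse _ _ hq => exact hq.mono fun m => List.subset_append_right _ _
  | whileDone _ => exact Frame.refl _ _
  | whileStep _ _ _ hp hq =>
    exact Frame.trans (p := .while _ _) (hp.mono fun m => List.Subset.refl _) hq

variable {f : MvPolynomial (Fin n) F}

theorem Runs.mono {p : Program} {T T' : ℕ} {s : Store F} {Q Q' : Store F → Prop}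
    (h : Runs f p T s Q) (hT : T ≤ T') (hQ : ∀ s', Frame p s s' → Q s' → Q' s') :
    Runs f p T' s Q' := by
  obtain ⟨t, s', he, ht, hs⟩ := h
  exact ⟨t, s', he, ht.trans hT, hQ s' he.frame hs⟩

theorem Runs.seq {p q : Program} {T T₁ T₂ : ℕ} {s : Store F} {Q₁ Q : Store F → Prop}
    (h₁ : Runs f p T₁ s Q₁) (h₂ : ∀ s', Frame p s s' → Q₁ s' → Runs f q T₂ s' Q)
    (hT : T₁ + T₂ ≤ T) : Runs f (.seq p q) T s Q := by
  obtain ⟨t, s', he, ht, hs⟩ := h₁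
  obtain ⟨t', s'', he', ht', hs'⟩ := h₂ s' he.frame hs
  exact ⟨t + t', s'', .seq he he', by omega, hs'⟩

theorem Runs.ite {p q : Program} {T : ℕ} {s : Store F} {Q : Store F → Prop} {x : ℕ}
    (h₁ : s.nat x ≠ 0 → Runs f p T s Q) (h₂ : s.nat x = 0 → Runs f q T s Q) :
    Runs f (.ite x p q) (T + 1) s Q := by
  by_cases hx : s.nat x = 0
  · obtain ⟨t, s', he, ht, hs⟩ := h₂ hx
    exact ⟨t + 1, s', .iteFalse hx he, by omega, hs⟩
  · obtain ⟨t, s', he, ht, hs⟩ := h₁ hx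
    exact ⟨t + 1, s', .iteTrue hx he, by omega, hs⟩

theorem Runs.while {p : Program} {T : ℕ} {x : ℕ} (I : Store F → Prop) (μ : Store F → ℕ)
    (h : ∀ s, I s → s.nat x ≠ 0 → Runs f p T s fun s' => I s' ∧ μ s' < μ s) {s : Store F}
    (hs : I s) : Runs f (.while x p) (μ s * (T + 1) + 1) s fun s' => I s' ∧ s'.nat x = 0 := by
  induction hm : μ s using Nat.strong_induction_on generalizing s with
  | _ m ih =>
    by_cases hx : s.nat x = 0
    · exact ⟨1, s, .whileDone hx, by omega, hs, hx⟩
    · obtain ⟨t, s', he, ht, hI, hμ⟩ := h s hs hx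
      obtain ⟨t', s'', he', ht', hs'⟩ := ih (μ s') (hm ▸ hμ) hI rfl
      refine ⟨t + t' + 1, s'', .whileStep hx he he', ?_, hs'⟩
      have : (μ s' + 1) * (T + 1) ≤ m * (T + 1) := Nat.mul_le_mul_right _ (hm ▸ hμ)
      rw [Nat.add_mul] at this
      omega

/-- A nonempty list of instructions. -/
def Program.block (c : Instr) : List Instr → Program
  | [] => .instr c
  | c' :: cs => .seq (.instr c) (Program.block c' cs)

theorem Runs.block {c : Instr} {cs : List Instr} {T : ℕ} {s : Store F} {Q : Store F → Prop}
    (hT : cs.length + 1 ≤ T) (hQ : Q ((c :: cs).foldl (Instr.step f) s)) :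
    Runs f (.block c cs) T s Q := by
  induction cs generalizing c s T with
  | nil => exact ⟨1, _, .instr c s, hT, hQ⟩
  | cons c' cs ih =>
    rw [List.length_cons] at hT
    obtain ⟨t, s', he, ht, hs⟩ := ih (c := c') (T := T - 1) (s := c.step f s) (by omega) hQ
    exact ⟨1 + t, s', .seq (.instr c s) he, by omega, hs⟩

/-- An instruction without an effect on the variables in use. -/
def Program.skip : Program := .instr (.setNat 99 0)

/-- `for i = 0, …, N - 1 do p`, with the auxiliary variable `c`; the variable number `4` holds
the constant `1`. -/
def Program.for (i c N : ℕ) (p : Program) : Program :=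
  .seq (.block (.setNat i 0) [.subNat c N i])
    (.while c (.seq p (.block (.addNat i i 4) [.subNat c N i])))

theorem Runs.for {i c N : ℕ} {p : Program} {T : ℕ} {s : Store F} {m : ℕ}
    (J : ℕ → Store F → Prop) (hN : s.nat N = m) (h4 : s.nat 4 = 1)
    (hJ : ∀ k s x a, (x = i ∨ x = c) → J k s → J k (s.putNat x a)) (h0 : J 0 s)
    (hp : ∀ k s', k < m → Frame (.for i c N p) s s' → s'.nat i = k → J k s' →
      Runs f p T s' (J (k + 1)))
    (hi : i ∉ p.collect Instr.natVars) (hNF : N ∉ (Program.for i c N p).collect Instr.natVars)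
    (h4F : 4 ∉ (Program.for i c N p).collect Instr.natVars) (hic : i ≠ c) :
    Runs f (.for i c N p) (m * (T + 3) + 3) s (J m) := by
  have hcollect : ∀ x, x ∈ (Program.for i c N p).collect Instr.natVars ↔
      x = i ∨ x = c ∨ x ∈ p.collect Instr.natVars := by
    intro x
    simp [Program.for, Program.collect, Program.block, Instr.natVars]
    tauto
  rw [hcollect] at hNF h4F
  push Not at hNF h4F
  have hbody : ∀ m', Program.collect m' (.seq p (.block (.addNat i i 4) [.subNat c N i])) ⊆
      Program.collect m' (.for i c N p) := fun m' => List.subset_append_right _ _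
  refine Runs.seq (T₁ := 2) (T₂ := m * (T + 3) + 1)
    (Q₁ := fun s' => J 0 s' ∧ s'.nat i = 0 ∧ s'.nat c = m) (Runs.block le_rfl ?_) ?_ (by omega)
  · refine ⟨hJ _ _ _ _ (Or.inr rfl) (hJ _ _ _ _ (Or.inl rfl) h0), ?_, ?_⟩
    · simp [Instr.step, Store.putNat, hic]
    · simp [Instr.step, Store.putNat, Function.update_of_ne hNF.1, hN]
  · rintro s₁ hf₁ ⟨hJ₁, hi₁, hc₁⟩
    have hF₁ : Frame (.for i c N p) s s₁ := hf₁.mono fun m' => List.subset_append_left _ _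
    have hrun := Runs.while (f := f) (p := .seq p (.block (.addNat i i 4) [.subNat c N i]))
      (T := T + 2) (x := c)
      (fun s' => ∃ k ≤ m, Frame (.for i c N p) s s' ∧ s'.nat i = k ∧ s'.nat c = m - k ∧ J k s')
      (fun s' => s'.nat c) ?_ (s := s₁) ⟨0, Nat.zero_le _, hF₁, hi₁, by omega, hJ₁⟩
    · rw [hc₁] at hrun
      refine hrun.mono le_rfl ?_
      rintro s' - ⟨⟨k, hk, -, -, hc', hJ'⟩, hc0⟩
      obtain rfl : k = m := by omega
      exact hJ'
    · rintro s' ⟨k, hk, hF, hi', hc', hJ'⟩ hne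
      have hkm : k < m := by omega
      refine Runs.seq (T₁ := T) (T₂ := 2) (hp k s' hkm hF hi' hJ') (fun s'' hf'' hJ'' => ?_)
        le_rfl
      have hi'' : s''.nat i = k := (hf''.nat i hi).trans hi'
      have hF'' : Frame (.for i c N p) s s'' := hF.trans (hf''.mono fun m' =>
        List.Subset.trans (List.subset_append_left _ _) (hbody m'))
      have h4'' : s''.nat 4 = 1 := (hF''.nat 4 (by rw [hcollect]; tauto)).trans h4
      have hN'' : s''.nat N = m := (hF''.nat N (by rw [hcollect]; tauto)).trans hN
      refine (Runs.block (T := 2) (Q := fun s₃ => J (k + 1) s₃ ∧ s₃.nat i = k + 1 ∧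
        s₃.nat c = m - (k + 1)) le_rfl ?_).mono le_rfl ?_
      · refine ⟨hJ _ _ _ _ (Or.inr rfl) (hJ _ _ _ _ (Or.inl rfl) hJ''), ?_, ?_⟩
        · simp [Instr.step, Store.putNat, hic, hi'', h4'']
        · simp [Instr.step, Store.putNat, Function.update_of_ne hNF.1, hN'', hi'', h4'']
      · rintro s₃ hf₃ ⟨hJ₃, hi₃, hc₃⟩
        exact ⟨⟨k + 1, hkm, hF''.trans (hf₃.mono fun m' =>
          List.Subset.trans (List.subset_append_right _ _) (hbody m')), hi₃, hc₃, hJ₃⟩, by omega⟩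

/-! ### Arithmetic programs -/

/-- `r := x * y`, with the auxiliary variable `c`. -/
def Program.mul (r c x y : ℕ) : Program :=
  .seq (.block (.setNat r 0) [.addNat c y 3])
    (.while c (.block (.addNat r r x) [.subNat c c 4]))

theorem Runs.mul {r c x y : ℕ} {s : Store F} {T : ℕ} (h3 : s.nat 3 = 0) (h4 : s.nat 4 = 1)
    (hr : r ∉ [c, x, y, 3, 4]) (hc : c ∉ [x, 4]) (hT : 3 * s.nat y + 3 ≤ T) :
    Runs f (.mul r c x y) T s fun s' => s'.nat r = s.nat x * s.nat y := by
  simp only [List.mem_cons, List.not_mem_nil, or_false, not_or] at hr hc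
  obtain ⟨hrc, hrx, hry, hr3, hr4⟩ := hr
  obtain ⟨hcx, hc4⟩ := hc
  refine Runs.seq (T₁ := 2) (T₂ := s.nat y * 3 + 1) (Q₁ := fun s' => s'.nat r = 0 ∧
    s'.nat c = s.nat y ∧ s'.nat x = s.nat x ∧ s'.nat 4 = 1) (Runs.block le_rfl ?_) ?_ (by omega)
  · simp [Instr.step, Store.putNat, hrc, Function.update_of_ne (Ne.symm hry),
      Function.update_of_ne (Ne.symm hr3), Function.update_of_ne (Ne.symm hrx),
      Function.update_of_ne (Ne.symm hcx), Function.update_of_ne (Ne.symm hr4),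
      Function.update_of_ne (Ne.symm hc4), h3, h4]
  · rintro s₁ - ⟨hr₁, hc₁, hx₁, h4₁⟩
    have hrun := Runs.while (f := f) (p := .block (.addNat r r x) [.subNat c c 4]) (T := 2) (x := c)
      (fun s' => s'.nat r + s.nat x * s'.nat c = s.nat x * s.nat y ∧ s'.nat x = s.nat x ∧
        s'.nat 4 = 1) (fun s' => s'.nat c) ?_ (s := s₁) ⟨by rw [hr₁, hc₁, zero_add], hx₁, h4₁⟩
    · rw [hc₁] at hrun
      refine hrun.mono le_rfl ?_
      rintro s' - ⟨⟨h, -, -⟩, h0⟩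
      simpa [h0] using h
    · rintro s' ⟨h, hx, h4'⟩ hne
      obtain ⟨k, hk⟩ := Nat.exists_eq_succ_of_ne_zero hne
      refine Runs.block le_rfl ?_
      simp only [List.foldl_cons, List.foldl_nil, Instr.step, Store.putNat,
        Function.update_of_ne hrc, Function.update_self, Function.update_of_ne (Ne.symm hrx),
        Function.update_of_ne (Ne.symm hcx), Function.update_of_ne (Ne.symm hr4),
        Function.update_of_ne (Ne.symm hrc),
        Function.update_of_ne (Ne.symm hc4), hx, h4', hk, Nat.succ_sub_one, and_true]
      refine ⟨?_, by omega⟩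
      rw [← h, hk, Nat.succ_eq_add_one]
      ring

/-- Division with remainder by `n + 1`, where `n` is in the variable number `0`: replaces `c` by
the quotient and puts the remainder into `r`; `t` is auxiliary. -/
def Program.divMod (c r t : ℕ) : Program :=
  .seq (.block (.addNat r c 3) [.setNat c 0, .subNat t r 0])
    (.while t (.block (.subNat r r 0) [.subNat r r 4, .addNat c c 4, .subNat t r 0]))

theorem Runs.divMod {c r t : ℕ} {s : Store F} {T N : ℕ} (h0 : s.nat 0 = N) (h3 : s.nat 3 = 0)
    (h4 : s.nat 4 = 1) (hr : r ∉ [c, t, 0, 3, 4]) (hc : c ∉ [t, 0, 3, 4]) (ht : t ∉ [0, 4])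
    (hT : 5 * s.nat c + 4 ≤ T) :
    Runs f (.divMod c r t) T s fun s' => s'.nat c = s.nat c / (N + 1) ∧
      s'.nat r = s.nat c % (N + 1) := by
  simp only [List.mem_cons, List.not_mem_nil, or_false, not_or] at hr hc ht
  obtain ⟨hrc, hrt, hr0, hr3, hr4⟩ := hr
  obtain ⟨hct, hc0, hc3, hc4⟩ := hc
  obtain ⟨ht0, ht4⟩ := ht
  refine Runs.seq (T₁ := 3) (T₂ := s.nat c * 5 + 1) (Q₁ := fun s' => s'.nat r = s.nat c ∧
    s'.nat c = 0 ∧ s'.nat t = s.nat c - N ∧ s'.nat 0 = N ∧ s'.nat 4 = 1)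
    (Runs.block le_rfl ?_) ?_ (by omega)
  · simp [Instr.step, Store.putNat, hrc, hrt, hct, Ne.symm hr0, Ne.symm hr4,
      Ne.symm hc0, Ne.symm hc4, Ne.symm ht0, Ne.symm ht4, h0, h3, h4]
  · rintro s₁ - ⟨hr₁, hc₁, ht₁, h0₁, h4₁⟩
    have hrun := Runs.while (f := f)
      (p := .block (.subNat r r 0) [.subNat r r 4, .addNat c c 4, .subNat t r 0]) (T := 4) (x := t)
      (fun s' => s'.nat r + (N + 1) * s'.nat c = s.nat c ∧ s'.nat t = s'.nat r - N ∧
        s'.nat 0 = N ∧ s'.nat 4 = 1) (fun s' => s'.nat r) ?_ (s := s₁)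
        ⟨by rw [hr₁, hc₁, mul_zero, add_zero], by rw [ht₁, hr₁], h0₁, h4₁⟩
    · rw [hr₁] at hrun
      refine hrun.mono le_rfl ?_
      rintro s' - ⟨⟨h, ht', -, -⟩, htz⟩
      have hlt : s'.nat r < N + 1 := by omega
      rw [← h, Nat.add_mul_div_left _ _ (Nat.succ_pos N), Nat.add_mul_mod_self_left,
        Nat.div_eq_of_lt hlt, Nat.mod_eq_of_lt hlt, zero_add]
      exact ⟨rfl, rfl⟩
    · rintro s' ⟨h, ht', h0', h4'⟩ hne
      refine Runs.block le_rfl ?_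
      simp only [List.foldl_cons, List.foldl_nil, Instr.step, Store.putNat, Function.update_apply,
        hrc, hrt, hct, Ne.symm hrc, Ne.symm hr0, Ne.symm hr4, Ne.symm hc0, Ne.symm hc4,
        Ne.symm ht0, Ne.symm ht4, h0', h4', if_true, if_false, and_true]
      obtain ⟨k, hk⟩ := Nat.exists_eq_add_of_lt (show N < s'.nat r by omega)
      rw [hk] at h ⊢
      rw [show N + k + 1 - N - 1 = k by omega]
      refine ⟨?_, by omega⟩
      rw [← h]
      ring

end Logic

/-! ### The program for the test of a cut -/

/-- Fills the first layer of the array number `2` with the values of the black box at the points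
that combine two of the random points along the set in the integer array number `1`. -/
def Program.fillMatrix : Program :=
  .for 43 44 5 (.seq (.mul 45 46 43 0)
    (.for 47 48 5 (.seq (.mul 49 50 47 0)
      (.seq (.for 51 52 0 (.seq (.block (.readNat 53 1 51) [])
          (.seq (.ite 53 (.block (.addNat 54 45 51) []) (.block (.addNat 54 49 51) []))
            (.block (.readFld 0 1 54) [.writeFld 0 51 0]))))
        (.seq (.block (.query 0 0) []) (.seq (.mul 55 56 43 5)
          (.block (.addNat 55 55 47) [.writeFld 2 55 0])))))))

/-- Elimination without pivoting. Layer `r` of the array number `2` is the `r`-th Schur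
complement; no entry is written twice. The product of the pivots goes to the variable number
`2`. -/
def Program.eliminate : Program :=
  .seq (.block (.oneFld 2) [])
    (.for 43 44 5 (.seq (.mul 45 46 8 43) (.seq (.mul 47 48 43 5)
      (.seq (.block (.addNat 49 45 47) [.addNat 49 49 43, .readFld 0 2 49, .mulFld 2 2 0])
        (.for 50 51 5 (.seq (.mul 52 53 50 5)
          (.seq (.block (.addNat 54 45 52) [.addNat 54 54 43, .readFld 1 2 54, .divFld 1 1 0])
            (.for 55 56 5 (.block (.addNat 57 45 47) [.addNat 57 57 55, .readFld 3 2 57,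
              .mulFld 3 3 1, .addNat 57 45 52, .addNat 57 57 55, .readFld 4 2 57, .subFld 4 4 3,
              .addNat 57 57 8, .writeFld 2 57 4])))))))))

/-- Tests a cut; the result, `0` for a cut that passes, goes to the variable number `40`. -/
def Program.testCut : Program :=
  .seq .fillMatrix (.seq .eliminate (.block (.testFld 40 2) []))

section TestProgram

variable {F : Type*} {n K : ℕ}

/-- The constants in the memory: `n`, `0`, `1`, `K`, `K²` and the random points. -/
structure HasConstants (n K : ℕ) (P : ℕ → F) (s : Store F) : Prop where
  nat0 : s.nat 0 = n
  nat3 : s.nat 3 = 0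
  nat4 : s.nat 4 = 1
  nat5 : s.nat 5 = K
  nat8 : s.nat 8 = K * K
  points : s.fldArr 1 = P

theorem HasConstants.frame {P : ℕ → F} {s s' : Store F} {p : Program} (h : HasConstants n K P s)
    (hF : Frame p s s') (hnat : ∀ x ∈ [0, 3, 4, 5, 8], x ∉ p.collect Instr.natVars)
    (hfld : 1 ∉ p.collect Instr.fldArrs) : HasConstants n K P s' := by
  constructor
  · rw [hF.nat 0 (hnat 0 (by simp)), h.nat0]
  · rw [hF.nat 3 (hnat 3 (by simp)), h.nat3]
  · rw [hF.nat 4 (hnat 4 (by simp)), h.nat4]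
  · rw [hF.nat 5 (hnat 5 (by simp)), h.nat5]
  · rw [hF.nat 8 (hnat 8 (by simp)), h.nat8]
  · rw [hF.fldArr 1 hfld, h.points]

/-- The integer array number `1` is the indicator function of the set `S`. -/
def HoldsSet (S : Finset (Fin n)) (s : Store F) : Prop :=
  ∀ v : Fin n, s.natArr 1 v = if v ∈ S then 1 else 0

theorem HoldsSet.frame {S : Finset (Fin n)} {s s' : Store F} {p : Program} (h : HoldsSet S s)
    (hF : Frame p s s') (hp : 1 ∉ p.collect Instr.natArrs) : HoldsSet S s' := by
  intro v
  rw [hF.natArr 1 hp, h v]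

variable [Field F]

/-- The Schur complements of `M`, laid out in a flat array. -/
def schurArray (K : ℕ) (M : ℕ → ℕ → F) (x : ℕ) : F :=
  schur M (x / (K * K)) (x / K % K) (x % K)

theorem schurArray_apply (M : ℕ → ℕ → F) (r : ℕ) {i j : ℕ} (hi : i < K) (hj : j < K) :
    schurArray K M (K * K * r + i * K + j) = schur M r i j := by
  have h1 : (K * K * r + i * K + j) / K = K * r + i := by
    rw [show K * K * r + i * K + j = j + K * (K * r + i) by ring,
      Nat.add_mul_div_left _ _ (by omega), Nat.div_eq_of_lt hj, zero_add]
  have h2 : (K * K * r + i * K + j) % K = j := by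
    rw [show K * K * r + i * K + j = j + K * (K * r + i) by ring,
      Nat.add_mul_mod_self_left, Nat.mod_eq_of_lt hj]
  rw [schurArray, h2, ← Nat.div_div_eq_div_mul, h1, Nat.add_comm (K * r), Nat.add_mul_div_left _ _
    (by omega), Nat.div_eq_of_lt hi, zero_add, Nat.add_mul_mod_self_left, Nat.mod_eq_of_lt hi]

/-- The first `m` entries of the array number `2` are those of the Schur complements. -/
def HoldsSchur (K : ℕ) (M : ℕ → ℕ → F) (m : ℕ) (s : Store F) : Prop :=
  ∀ x < m, s.fldArr 2 x = schurArray K M x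

theorem Runs.fillMatrix {f : MvPolynomial (Fin n) F} {P : ℕ → F} {S : Finset (Fin n)}
    {s : Store F} {B : ℕ} (hE : HasConstants n K P s) (hS : HoldsSet S s) (hn : n ≤ B)
    (hK : K ≤ B) :
    Runs f .fillMatrix (14 * B ^ 3 + 18 * B ^ 2 + 9 * B + 3) s
      (HoldsSchur K (testMatrix f P S) (K * K)) := by
  set M := testMatrix f P S with hM
  refine (Runs.for (m := K) (T := 14 * B ^ 2 + 18 * B + 6)
    (fun i => HoldsSchur K M (i * K)) hE.nat5 hE.nat4 (fun _ _ _ _ _ h => h)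
    (fun x hx => by omega) ?_ (by decide) (by decide) (by decide) (by decide)).mono
    (by nlinarith [Nat.mul_le_mul_right (14 * B ^ 2 + 18 * B + 9) hK]) fun _ _ h => h
  intro i s₁ hi hF₁ hi₁ hJ₁
  have hE₁ := hE.frame hF₁ (by decide) (by decide)
  have hS₁ := hS.frame hF₁ (by decide)
  refine Runs.seq (T₁ := 3 * B + 3) (T₂ := 14 * B ^ 2 + 15 * B + 3)
    (Runs.mul hE₁.nat3 hE₁.nat4 (by decide) (by decide) (by rw [hE₁.nat0]; omega)) ?_ (by omega)
  intro s₂ hF₂ h45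
  rw [hi₁, hE₁.nat0] at h45
  have hE₂ := hE₁.frame hF₂ (by decide) (by decide)
  have hS₂ := hS₁.frame hF₂ (by decide)
  have hi₂ : s₂.nat 43 = i := (hF₂.nat 43 (by decide)).trans hi₁
  have hJ₂ : HoldsSchur K M (i * K) s₂ := fun x hx => by
    rw [hF₂.fldArr 2 (by decide)]; exact hJ₁ x hx
  refine (Runs.for (m := K) (T := 14 * B + 12)
    (fun j => HoldsSchur K M (i * K + j)) hE₂.nat5 hE₂.nat4 (fun _ _ _ _ _ h => h)
    hJ₂ ?_ (by decide) (by decide) (by decide) (by decide)).mono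
    (by nlinarith [Nat.mul_le_mul_right (14 * B + 15) hK])
    fun s' _ h => by rw [Nat.add_mul, one_mul]; exact h
  intro j s₃ hj hF₃ hj₃ hJ₃
  have hE₃ := hE₂.frame hF₃ (by decide) (by decide)
  have hS₃ := hS₂.frame hF₃ (by decide)
  have hi₃ : s₃.nat 43 = i := (hF₃.nat 43 (by decide)).trans hi₂
  have h45₃ : s₃.nat 45 = i * n := (hF₃.nat 45 (by decide)).trans h45
  refine Runs.seq (T₁ := 3 * B + 3) (T₂ := 11 * B + 9)
    (Runs.mul hE₃.nat3 hE₃.nat4 (by decide) (by decide) (by rw [hE₃.nat0]; omega)) ?_ (by omega)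
  intro s₄ hF₄ h49
  rw [hj₃, hE₃.nat0] at h49
  have hE₄ := hE₃.frame hF₄ (by decide) (by decide)
  have hS₄ := hS₃.frame hF₄ (by decide)
  have hi₄ : s₄.nat 43 = i := (hF₄.nat 43 (by decide)).trans hi₃
  have hj₄ : s₄.nat 47 = j := (hF₄.nat 47 (by decide)).trans hj₃
  have h45₄ : s₄.nat 45 = i * n := (hF₄.nat 45 (by decide)).trans h45₃
  have hJ₄ : HoldsSchur K M (i * K + j) s₄ := fun x hx => by
    rw [hF₄.fldArr 2 (by decide)]; exact hJ₃ x hx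
  refine Runs.seq (T₁ := n * (5 + 3) + 3) (T₂ := 3 * B + 6)
    (Q₁ := fun s' => ∀ v : Fin n, (v : ℕ) < n →
      s'.fldArr 0 v = S.piecewise (flatPoint n P i) (flatPoint n P j) v)
    (Runs.for (m := n) (T := 5) (fun k s' => ∀ v : Fin n, (v : ℕ) < k →
      s'.fldArr 0 v = S.piecewise (flatPoint n P i) (flatPoint n P j) v)
    hE₄.nat0 hE₄.nat4 (fun _ _ _ _ _ h => h) (fun v hv => by omega) ?_ (by decide) (by decide)
    (by decide) (by decide)) ?_ (by omega)
  · intro k s₅ hk hF₅ hk₅ hJ₅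
    have hS₅ := hS₄.frame hF₅ (by decide)
    have hE₅ := hE₄.frame hF₅ (by decide) (by decide)
    have h45₅ : s₅.nat 45 = i * n := (hF₅.nat 45 (by decide)).trans h45₄
    have h49₅ : s₅.nat 49 = j * n := (hF₅.nat 49 (by decide)).trans h49
    refine Runs.seq (T₁ := 1) (T₂ := 4)
      (Q₁ := fun s' => s'.nat 53 = if (⟨k, hk⟩ : Fin n) ∈ S then 1 else 0)
      (Runs.block le_rfl ?_) ?_ (by omega)
    · simpa [Instr.step, Store.putNat, hk₅] using hS₅ ⟨k, hk⟩
    intro s₆ hF₆ h53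
    have h45₆ : s₆.nat 45 = i * n := (hF₆.nat 45 (by decide)).trans h45₅
    have h49₆ : s₆.nat 49 = j * n := (hF₆.nat 49 (by decide)).trans h49₅
    have hk₆ : s₆.nat 51 = k := (hF₆.nat 51 (by decide)).trans hk₅
    refine Runs.seq (T₁ := 2) (T₂ := 2)
      (Q₁ := fun s' => s'.nat 54 = if (⟨k, hk⟩ : Fin n) ∈ S then i * n + k else j * n + k)
      (Runs.ite (T := 1) (fun h => Runs.block le_rfl ?_) fun h => Runs.block le_rfl ?_) ?_
      (by omega)
    · have hmem : (⟨k, hk⟩ : Fin n) ∈ S := by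
        by_contra hmem
        simp [h53, hmem] at h
      simp [Instr.step, Store.putNat, hmem, h45₆, hk₆]
    · have hmem : (⟨k, hk⟩ : Fin n) ∉ S := by
        intro hmem
        simp [h53, hmem] at h
      simp [Instr.step, Store.putNat, hmem, h49₆, hk₆]
    intro s₇ hF₇ h54
    have hk₇ : s₇.nat 51 = k := (hF₇.nat 51 (by decide)).trans hk₆
    have hP₇ : s₇.fldArr 1 = P := by
      rw [hF₇.fldArr 1 (by decide), hF₆.fldArr 1 (by decide), hE₅.points]
    have hJ₇ : s₇.fldArr 0 = s₅.fldArr 0 := by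
      rw [hF₇.fldArr 0 (by decide), hF₆.fldArr 0 (by decide)]
    refine Runs.block le_rfl fun v hv => ?_
    rcases Nat.lt_succ_iff_lt_or_eq.1 hv with hv | hv
    · have hvk : (v : ℕ) ≠ k := hv.ne
      simpa [Instr.step, Store.putFld, Store.putFldArr, hk₇, hvk, hJ₇] using hJ₅ v hv
    · obtain rfl : v = ⟨k, hk⟩ := Fin.ext hv
      by_cases hmem : (⟨k, hk⟩ : Fin n) ∈ S
      · simp [Instr.step, Store.putFld, Store.putFldArr, hk₇, hP₇, h54, hmem, flatPoint]
      · simp [Instr.step, Store.putFld, Store.putFldArr, hk₇, hP₇, h54, hmem, flatPoint]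
  intro s₅ hF₅ hpt
  have hE₅ := hE₄.frame hF₅ (by decide) (by decide)
  have hi₅ : s₅.nat 43 = i := (hF₅.nat 43 (by decide)).trans hi₄
  have hj₅ : s₅.nat 47 = j := (hF₅.nat 47 (by decide)).trans hj₄
  refine Runs.seq (T₁ := 1) (T₂ := 3 * B + 5) (Q₁ := fun s' => s'.fld 0 = M i j)
    (Runs.block le_rfl ?_) ?_ (by omega)
  · have : (fun v : Fin n => s₅.fldArr 0 v) =
      S.piecewise (flatPoint n P i) (flatPoint n P j) := funext fun v => hpt v v.2
    simp [Instr.step, Store.putFld, this, hM, testMatrix]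
  intro s₆ hF₆ hfld
  have hE₆ := hE₅.frame hF₆ (by decide) (by decide)
  have hi₆ : s₆.nat 43 = i := (hF₆.nat 43 (by decide)).trans hi₅
  have hj₆ : s₆.nat 47 = j := (hF₆.nat 47 (by decide)).trans hj₅
  refine Runs.seq (T₁ := 3 * B + 3) (T₂ := 2)
    (Runs.mul hE₆.nat3 hE₆.nat4 (by decide) (by decide) (by rw [hE₆.nat5]; omega)) ?_ (by omega)
  intro s₇ hF₇ h55
  rw [hi₆, hE₆.nat5] at h55
  have hj₇ : s₇.nat 47 = j := (hF₇.nat 47 (by decide)).trans hj₆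
  have hfld₇ : s₇.fld 0 = M i j := (hF₇.fld 0 (by decide)).trans hfld
  have hJ₇ : HoldsSchur K M (i * K + j) s₇ := fun x hx => by
    rw [hF₇.fldArr 2 (by decide), hF₆.fldArr 2 (by decide), hF₅.fldArr 2 (by decide)]
    exact hJ₄ x hx
  refine Runs.block le_rfl fun x hx => ?_
  rcases (by omega : x < i * K + j ∨ x = i * K + j) with hx | rfl
  · have hne : x ≠ i * K + j := hx.ne
    simpa [Instr.step, Store.putNat, Store.putFldArr, h55, hj₇, hne] using hJ₇ x hx
  · have := schurArray_apply M 0 hi hj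
    rw [mul_zero, zero_add] at this
    rw [this]
    simp [Instr.step, Store.putNat, Store.putFldArr, h55, hj₇, hfld₇, schur]

theorem Runs.eliminate {f : MvPolynomial (Fin n) F} {P : ℕ → F} {M : ℕ → ℕ → F}
    {s : Store F} {B : ℕ} (hE : HasConstants n K P s)
    (hM : HoldsSchur K M (K * K) s) (hK : K ≤ B) :
    Runs f .eliminate (16 * B ^ 3 + 19 * B ^ 2 + 16 * B + 4) s
      fun s' => s'.fld 2 = ∏ r ∈ Finset.range K, schur M r r r := by
  refine Runs.seq (T₁ := 1) (T₂ := 16 * B ^ 3 + 19 * B ^ 2 + 16 * B + 3)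
    (Q₁ := fun s' => s'.fld 2 = 1) (Runs.block le_rfl (by simp [Instr.step, Store.putFld])) ?_
    (by omega)
  intro s₀ hF₀ hone
  have hE₀ := hE.frame hF₀ (by decide) (by decide)
  have hM₀ : HoldsSchur K M (K * K) s₀ := fun x hx => by
    rw [hF₀.fldArr 2 (by decide)]; exact hM x hx
  refine (Runs.for (m := K) (T := 16 * B ^ 2 + 19 * B + 13)
    (fun r s' => HoldsSchur K M (K * K * r + K * K) s' ∧
      s'.fld 2 = ∏ r ∈ Finset.range r, schur M r r r) hE₀.nat5 hE₀.nat4 (fun _ _ _ _ _ h => h)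
    ⟨by simpa using hM₀, by simpa using hone⟩ ?_ (by decide) (by decide) (by decide)
    (by decide)).mono
    (by nlinarith [Nat.mul_le_mul_right (16 * B ^ 2 + 19 * B + 16) hK]) fun _ _ h => h.2
  rintro r s₁ hr hF₁ hr₁ ⟨hJ₁, hprod₁⟩
  have hE₁ := hE₀.frame hF₁ (by decide) (by decide)
  refine Runs.seq (T₁ := 3 * B + 3) (T₂ := 16 * B ^ 2 + 16 * B + 10)
    (Runs.mul hE₁.nat3 hE₁.nat4 (by decide) (by decide) (by rw [hr₁]; omega)) ?_ (by omega)
  intro s₂ hF₂ h45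
  rw [hr₁, hE₁.nat8] at h45
  have hE₂ := hE₁.frame hF₂ (by decide) (by decide)
  have hr₂ : s₂.nat 43 = r := (hF₂.nat 43 (by decide)).trans hr₁
  refine Runs.seq (T₁ := 3 * B + 3) (T₂ := 16 * B ^ 2 + 13 * B + 7)
    (Runs.mul hE₂.nat3 hE₂.nat4 (by decide) (by decide) (by rw [hE₂.nat5]; omega)) ?_ (by omega)
  intro s₃ hF₃ h47
  rw [hr₂, hE₂.nat5] at h47
  have hE₃ := hE₂.frame hF₃ (by decide) (by decide)
  have hr₃ : s₃.nat 43 = r := (hF₃.nat 43 (by decide)).trans hr₂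
  have h45₃ : s₃.nat 45 = K * K * r := (hF₃.nat 45 (by decide)).trans h45
  have hprod₃ : s₃.fld 2 = ∏ r ∈ Finset.range r, schur M r r r := by
    rw [hF₃.fld 2 (by decide), hF₂.fld 2 (by decide), hprod₁]
  have hJ₃ : HoldsSchur K M (K * K * r + K * K) s₃ := fun x hx => by
    rw [hF₃.fldArr 2 (by decide), hF₂.fldArr 2 (by decide)]; exact hJ₁ x hx
  have hidx : ∀ i j, i < K → j < K → K * K * r + i * K + j < K * K * r + K * K := by
    intro i j hi hj
    have := Nat.mul_le_mul_right K (Nat.succ_le_of_lt hi)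
    rw [Nat.succ_mul] at this
    omega
  refine Runs.seq (T₁ := 4) (T₂ := 16 * B ^ 2 + 13 * B + 3)
    (Q₁ := fun s' => s'.fld 0 = schur M r r r ∧
      s'.fld 2 = ∏ r ∈ Finset.range (r + 1), schur M r r r) (Runs.block le_rfl ?_) ?_ (by omega)
  · have := hJ₃ _ (hidx r r hr hr)
    rw [schurArray_apply M r hr hr] at this
    rw [Finset.prod_range_succ]
    simp [Instr.step, Store.putNat, Store.putFld, h45₃, h47, hr₃, this, hprod₃]
  rintro s₄ hF₄ ⟨hpiv, hprod⟩
  have hE₄ := hE₃.frame hF₄ (by decide) (by decide)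
  have hr₄ : s₄.nat 43 = r := (hF₄.nat 43 (by decide)).trans hr₃
  have h45₄ : s₄.nat 45 = K * K * r := (hF₄.nat 45 (by decide)).trans h45₃
  have h47₄ : s₄.nat 47 = r * K := (hF₄.nat 47 (by decide)).trans h47
  have hJ₄ : HoldsSchur K M (K * K * (r + 1)) s₄ := fun x hx => by
    rw [hF₄.fldArr 2 (by decide)]; exact hJ₃ x (by rwa [Nat.mul_succ] at hx)
  refine (Runs.for (m := K) (T := 16 * B + 10)
    (fun i => HoldsSchur K M (K * K * (r + 1) + i * K))
    hE₄.nat5 hE₄.nat4 (fun _ _ _ _ _ h => h) (by simpa using hJ₄) ?_ (by decide) (by decide)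
    (by decide) (by decide)).mono
    (by nlinarith [Nat.mul_le_mul_right (16 * B + 13) hK])
    fun s' hF h => ⟨h, by rw [hF.fld 2 (by decide), hprod]⟩
  intro i s₅ hi hF₅ hi₅ hJ₅
  have hE₅ := hE₄.frame hF₅ (by decide) (by decide)
  refine Runs.seq (T₁ := 3 * B + 3) (T₂ := 13 * B + 7)
    (Runs.mul hE₅.nat3 hE₅.nat4 (by decide) (by decide) (by rw [hE₅.nat5]; omega)) ?_ (by omega)
  intro s₆ hF₆ h52
  rw [hi₅, hE₅.nat5] at h52
  have hE₆ := hE₅.frame hF₆ (by decide) (by decide)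
  have hr₆ : s₆.nat 43 = r := by rw [hF₆.nat 43 (by decide), hF₅.nat 43 (by decide), hr₄]
  have h45₆ : s₆.nat 45 = K * K * r := by
    rw [hF₆.nat 45 (by decide), hF₅.nat 45 (by decide), h45₄]
  have h47₆ : s₆.nat 47 = r * K := by
    rw [hF₆.nat 47 (by decide), hF₅.nat 47 (by decide), h47₄]
  have hpiv₆ : s₆.fld 0 = schur M r r r := by
    rw [hF₆.fld 0 (by decide), hF₅.fld 0 (by decide), hpiv]
  have hJ₆ : HoldsSchur K M (K * K * (r + 1) + i * K) s₆ := fun x hx => by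
    rw [hF₆.fldArr 2 (by decide)]; exact hJ₅ x hx
  have hread : ∀ i' j', i' < K → j' < K → ∀ s' : Store F,
      HoldsSchur K M (K * K * (r + 1) + i * K) s' →
      s'.fldArr 2 (K * K * r + i' * K + j') = schur M r i' j' := by
    intro i' j' hi' hj' s' h
    rw [h _ (by have := hidx i' j' hi' hj'; rw [Nat.mul_succ]; omega),
      schurArray_apply M r hi' hj']
  refine Runs.seq (T₁ := 4) (T₂ := 13 * B + 3)
    (Q₁ := fun s' => s'.fld 1 = schur M r i r / schur M r r r) (Runs.block le_rfl ?_) ?_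
    (by omega)
  · simp [Instr.step, Store.putNat, Store.putFld, h45₆, h52, hr₆, hpiv₆, hread i r hi hr s₆ hJ₆]
  intro s₇ hF₇ hfac
  have hE₇ := hE₆.frame hF₇ (by decide) (by decide)
  have h45₇ : s₇.nat 45 = K * K * r := (hF₇.nat 45 (by decide)).trans h45₆
  have h47₇ : s₇.nat 47 = r * K := (hF₇.nat 47 (by decide)).trans h47₆
  have h52₇ : s₇.nat 52 = i * K := (hF₇.nat 52 (by decide)).trans h52
  have hJ₇ : HoldsSchur K M (K * K * (r + 1) + i * K) s₇ := fun x hx => by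
    rw [hF₇.fldArr 2 (by decide)]; exact hJ₆ x hx
  refine (Runs.for (m := K) (T := 10) (fun j => HoldsSchur K M (K * K * (r + 1) + i * K + j))
    hE₇.nat5 hE₇.nat4 (fun _ _ _ _ _ h => h) hJ₇ ?_ (by decide) (by decide) (by decide)
    (by decide)).mono (by omega) fun s' _ h => by
      rw [Nat.add_mul i, one_mul, ← Nat.add_assoc]; exact h
  intro j s₈ hj hF₈ hj₈ hJ₈
  have hE₈ := hE₇.frame hF₈ (by decide) (by decide)
  have h45₈ : s₈.nat 45 = K * K * r := (hF₈.nat 45 (by decide)).trans h45₇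
  have h47₈ : s₈.nat 47 = r * K := (hF₈.nat 47 (by decide)).trans h47₇
  have h52₈ : s₈.nat 52 = i * K := (hF₈.nat 52 (by decide)).trans h52₇
  have hfac₈ : s₈.fld 1 = schur M r i r / schur M r r r := (hF₈.fld 1 (by decide)).trans hfac
  have hJ₈' : HoldsSchur K M (K * K * (r + 1) + i * K) s₈ := fun x hx => hJ₈ x (by omega)
  have hptr : K * K * r + i * K + j + K * K = K * K * (r + 1) + i * K + j := by ring
  refine Runs.block le_rfl fun x hx => ?_
  rcases (by omega : x < K * K * (r + 1) + i * K + j ∨ x = K * K * (r + 1) + i * K + j)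
    with hx | rfl
  · have hne : x ≠ K * K * r + i * K + j + K * K := by omega
    simpa [Instr.step, Store.putNat, Store.putFld, Store.putFldArr, h45₈, h52₈, hj₈, hE₈.nat8,
      hne] using hJ₈ x hx
  · rw [schurArray_apply M (r + 1) hi hj, ← hptr]
    simp [Instr.step, Store.putNat, Store.putFld, Store.putFldArr, h45₈, h47₈, h52₈, hj₈,
      hE₈.nat8, hfac₈, hread i j hi hj s₈ hJ₈', hread r j hr hj s₈ hJ₈', schur]

theorem Runs.testCut {f : MvPolynomial (Fin n) F} {P : ℕ → F} {S : Finset (Fin n)}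
    {s : Store F} {w B : ℕ} (hE : HasConstants n (w + 1) P s) (hS : HoldsSet S s) (hn : n ≤ B)
    (hw : w + 1 ≤ B) :
    Runs f .testCut (100 * B ^ 3) s fun s' => s'.nat 40 = 0 ↔ testValue f w P S = 0 := by
  have hB : 1 ≤ B := by omega
  have h1 : B ≤ B ^ 3 := Nat.le_self_pow (by norm_num) B
  have h2 : B ^ 2 ≤ B ^ 3 := Nat.pow_le_pow_right hB (by norm_num)
  refine Runs.seq (Runs.fillMatrix hE hS hn hw)
    (T₂ := 16 * B ^ 3 + 19 * B ^ 2 + 16 * B + 5) ?_ (by omega)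
  intro s₁ hF₁ hJ₁
  have hE₁ := hE.frame hF₁ (by decide) (by decide)
  refine Runs.seq (Runs.eliminate hE₁ hJ₁ hw) (T₂ := 1) ?_ (by omega)
  intro s₂ hF₂ hprod
  refine Runs.block le_rfl ?_
  simp [Instr.step, Store.putNat, hprod, testValue]

end TestProgram

/-! ### The search for an order -/

section Search

variable {n : ℕ}

open Classical in
/-- Appends the variable `y` to the list `L`, unless it occurs in `L` or the cut at the enlarged
set is not good. -/
noncomputable def tryAppend (good : Finset (Fin n) → Prop) (L : List (Fin n)) (y : ℕ) :
    List (Fin n) :=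
  if h : y < n then
    if ⟨y, h⟩ ∉ L.toFinset ∧ good (insert ⟨y, h⟩ L.toFinset) then L ++ [⟨y, h⟩] else L
  else L

/-- One round of the greedy extension: all variables are tried once. -/
noncomputable def greedyRound (good : Finset (Fin n) → Prop) (L : List (Fin n)) : List (Fin n) :=
  (List.range n).foldl (tryAppend good) L

/-- A digit `y + 1` stands for trying the variable `y`, and the digit `0` for nothing: a number has
no leading zeros, so that every list of nonzero digits is the list of digits of a number. -/
noncomputable def tryDigit (good : Finset (Fin n) → Prop) (L : List (Fin n)) (r : ℕ) :
    List (Fin n) :=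
  if r = 0 then L else tryAppend good L (r - 1)

/-- The attempt number `c`: the digits of `c` to the base `n + 1` name the variables to start
with; the list is then extended greedily. -/
noncomputable def attempt (good : Finset (Fin n) → Prop) (c : ℕ) : List (Fin n) :=
  (greedyRound good)^[n] ((Nat.digits (n + 1) c).foldl (tryDigit good) [])

/-- A list without repetitions all of whose prefixes are good. -/
def GoodList (good : Finset (Fin n) → Prop) (L : List (Fin n)) : Prop :=
  L.Nodup ∧ ∀ m, good (L.take m).toFinset

variable {good : Finset (Fin n) → Prop}

theorem GoodList.nil (h : good ∅) : GoodList good [] :=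
  ⟨List.nodup_nil, fun m => by simpa using h⟩

theorem GoodList.toFinset_good {L : List (Fin n)} (h : GoodList good L) : good L.toFinset := by
  simpa using h.2 L.length

theorem GoodList.length_le {L : List (Fin n)} (h : GoodList good L) : L.length ≤ n := by
  simpa using h.1.length_le_card

theorem GoodList.tryAppend {L : List (Fin n)} (h : GoodList good L) (y : ℕ) :
    GoodList good (tryAppend good L y) := by
  unfold _root_.tryAppend
  split_ifs with hy hc
  · refine ⟨List.nodup_append.2 ⟨h.1, List.nodup_singleton _, ?_⟩, fun m => ?_⟩
    · intro a ha b hb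
      rw [List.mem_singleton] at hb
      rintro rfl
      exact hc.1 (List.mem_toFinset.2 (hb ▸ ha))
    · rcases Nat.lt_or_ge L.length m with hm | hm
      · rw [List.take_of_length_le (by simpa using hm), List.toFinset_append]
        simpa [Finset.union_comm, ← Finset.insert_eq] using hc.2
      · rw [List.take_append_of_le_length hm]
        exact h.2 m
  · exact h
  · exact h

theorem GoodList.tryDigit {L : List (Fin n)} (h : GoodList good L) (r : ℕ) :
    GoodList good (tryDigit good L r) := by
  unfold _root_.tryDigit
  split_ifs
  exacts [h, h.tryAppend _]

theorem GoodList.foldl {g : List (Fin n) → ℕ → List (Fin n)}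
    (hg : ∀ L r, GoodList good L → GoodList good (g L r)) (l : List ℕ) {L : List (Fin n)}
    (h : GoodList good L) : GoodList good (l.foldl g L) := by
  induction l generalizing L with
  | nil => exact h
  | cons r l ih => exact ih (hg L r h)

theorem GoodList.greedyRound {L : List (Fin n)} (h : GoodList good L) :
    GoodList good (greedyRound good L) :=
  GoodList.foldl (fun _ r h => h.tryAppend r) _ h

theorem goodList_attempt (h : good ∅) (c : ℕ) : GoodList good (attempt good c) :=
  Function.Iterate.rec (GoodList good)
    (GoodList.foldl (fun _ r h => h.tryDigit r) _ (GoodList.nil h))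
    (fun _ h => GoodList.greedyRound h) n

theorem prefix_tryAppend (L : List (Fin n)) (y : ℕ) : L <+: tryAppend good L y := by
  unfold tryAppend
  split_ifs
  exacts [List.prefix_append _ _, List.prefix_rfl, List.prefix_rfl]

theorem prefix_foldl_tryAppend (l : List ℕ) (L : List (Fin n)) :
    L <+: l.foldl (tryAppend good) L := by
  induction l generalizing L with
  | nil => exact List.prefix_rfl
  | cons y l ih => exact (prefix_tryAppend L y).trans (ih _)

theorem length_lt_greedyRound {L : List (Fin n)} {x : Fin n} (hx : x ∉ L.toFinset)
    (hgood : good (insert x L.toFinset)) : L.length < (greedyRound good L).length := by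
  have hsplit : List.range n = List.range x ++ (x : ℕ) ::
      (List.range (n - x - 1)).map (fun i => x + 1 + i) := by
    rw [← List.singleton_append, ← List.append_assoc, ← List.range_succ, ← List.range_add]
    congr 1
    have := x.2
    omega
  rw [greedyRound, hsplit, List.foldl_append, List.foldl_cons]
  set L' := (List.range x).foldl (tryAppend good) L with hL'
  have hpre : L <+: L' := prefix_foldl_tryAppend _ _
  refine lt_of_lt_of_le ?_ (prefix_foldl_tryAppend _ _).length_le
  rcases hpre.length_le.lt_or_eq with hlt | heq
  · exact hlt.trans_le (prefix_tryAppend L' x).length_le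
  · rw [← hpre.eq_of_length heq]
    have : tryAppend good L x = L ++ [x] := by
      unfold tryAppend
      rw [dif_pos x.2, if_pos ⟨hx, hgood⟩]
    rw [this]
    simp

theorem toFinset_take_ofFn (τ : Equiv.Perm (Fin n)) (m : ℕ) :
    ((List.ofFn τ).take m).toFinset = prefixSet τ m := by
  ext x
  rw [List.mem_toFinset, mem_prefixSet, List.mem_take_iff_getElem]
  constructor
  · rintro ⟨i, hi, rfl⟩
    rw [List.getElem_ofFn, Equiv.symm_apply_apply]
    exact lt_of_lt_of_le hi (min_le_left _ _)
  · intro hx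
    refine ⟨τ.symm x, by simpa using hx, ?_⟩
    rw [List.getElem_ofFn]
    simp

/-- A complete good list is an order in which every prefix cut is good. -/
theorem GoodList.exists_perm {L : List (Fin n)} (h : GoodList good L) (hL : L.length = n) :
    ∃ τ : Equiv.Perm (Fin n), L = List.ofFn τ ∧ ∀ m, good (prefixSet τ m) := by
  obtain ⟨g, rfl⟩ : ∃ g : Fin n → Fin n, L = List.ofFn g := by
    refine ⟨fun i => L[i], ?_⟩
    refine List.ext_getElem (by simpa using hL) fun i h1 h2 => ?_
    simp
  have hg : Function.Injective g := List.nodup_ofFn.1 h.1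
  refine ⟨Equiv.ofBijective g (Finite.injective_iff_bijective.1 hg), rfl, fun m => ?_⟩
  rw [← toFinset_take_ofFn]
  exact h.2 m

/-- No variable of the hidden order is rejected, since its prefixes are good. -/
theorem foldl_tryDigit_eq {σ : Equiv.Perm (Fin n)} (hpre : ∀ m, good (prefixSet σ m)) {m : ℕ}
    (hm : m ≤ n) :
    (((List.ofFn σ).take m).map fun x : Fin n => (x : ℕ) + 1).foldl (tryDigit good) [] =
      (List.ofFn σ).take m := by
  induction m with
  | zero => rfl
  | succ m ih =>
    have hget : (List.ofFn σ)[m]? = some (σ ⟨m, hm⟩) := by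
      rw [List.getElem?_eq_getElem (by simpa using hm), List.getElem_ofFn]
    rw [List.take_add_one, hget, Option.toList_some, List.map_append, List.foldl_append,
      ih (by omega)]
    simp only [List.map_cons, List.map_nil, List.foldl_cons, List.foldl_nil]
    rw [tryDigit, if_neg (Nat.succ_ne_zero _), Nat.add_sub_cancel, tryAppend, dif_pos (Fin.is_lt _),
      if_pos]
    rw [toFinset_take_ofFn]
    refine ⟨by simp [mem_prefixSet], ?_⟩
    have := prefixSet_succ σ ⟨m, hm⟩
    simp only at this
    rw [Fin.eta, ← this]
    exact hpre _

/-- The attempt that starts with the first `k` variables of the hidden order succeeds if every good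
set with at least `k` variables can be extended. -/
theorem exists_attempt_length_eq {σ : Equiv.Perm (Fin n)} (hpre : ∀ m, good (prefixSet σ m)) {k : ℕ}
    (hext : ∀ S, good S → k ≤ S.card → S ≠ Finset.univ → ∃ x ∉ S, good (insert x S)) :
    ∃ c < (n + 1) ^ k, (attempt good c).length = n := by
  have hempty : good ∅ := by
    have : prefixSet σ 0 = ∅ := by ext; simp [mem_prefixSet]
    exact this ▸ hpre 0
  set ds := ((List.ofFn σ).take (min n k)).map fun x : Fin n => (x : ℕ) + 1 with hds
  have hlen : ds.length = min n k := by simp [hds]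
  have hlt : ∀ r ∈ ds, r < n + 1 := by
    intro r hr
    obtain ⟨x, -, rfl⟩ := List.mem_map.1 hr
    exact Nat.succ_lt_succ x.2
  have hne : ∀ h : ds ≠ [], ds.getLast h ≠ 0 := by
    intro h
    obtain ⟨x, -, hx⟩ := List.mem_map.1 (List.getLast_mem h)
    omega
  rcases Nat.eq_zero_or_pos n with rfl | hn
  · refine ⟨0, by simp, ?_⟩
    exact Nat.le_zero.1 (goodList_attempt hempty 0).length_le
  refine ⟨Nat.ofDigits (n + 1) ds, ?_, ?_⟩
  · refine (Nat.ofDigits_lt_base_pow_length (by omega) hlt).trans_le ?_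
    rw [hlen]
    exact Nat.pow_le_pow_right (by omega) (min_le_right _ _)
  · have hdig : Nat.digits (n + 1) (Nat.ofDigits (n + 1) ds) = ds :=
      Nat.digits_ofDigits _ (by omega) _ hlt hne
    rw [attempt, hdig, hds, foldl_tryDigit_eq hpre (min_le_left _ _)]
    set L := (List.ofFn σ).take (min n k) with hL
    have hL0 : GoodList good L := by
      rw [hL, ← foldl_tryDigit_eq hpre (min_le_left _ _)]
      exact GoodList.foldl (fun _ r h => h.tryDigit r) _ (GoodList.nil hempty)
    have hLlen : L.length = min n k := by simp [hL]
    -- each round adds a variable until all `n` are there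
    have key : ∀ j, GoodList good ((greedyRound good)^[j] L) ∧
        min n (min n k + j) ≤ ((greedyRound good)^[j] L).length := by
      intro j
      induction j with
      | zero => exact ⟨hL0, by simp [hLlen]⟩
      | succ j ih =>
        rw [Function.iterate_succ_apply']
        refine ⟨ih.1.greedyRound, ?_⟩
        set L' := (greedyRound good)^[j] L
        have hmono : L'.length ≤ (greedyRound good L').length :=
          (prefix_foldl_tryAppend _ _).length_le
        by_cases hfull : L'.length = n
        · omega
        · have hle := ih.1.length_le
          have hcard : L'.toFinset.card = L'.length := List.toFinset_card_of_nodup ih.1.1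
          obtain ⟨x, hx, hxg⟩ := hext L'.toFinset ih.1.toFinset_good (by omega) (fun h => by
            rw [h, Finset.card_univ, Fintype.card_fin] at hcard
            omega)
          have := length_lt_greedyRound hx hxg
          omega
    have h1 := (key n).2
    have h2 := (key n).1.length_le
    omega

end Search

/-! ### The program for the search -/

/-- Appends the variable in the integer variable number `28` to the list in the integer array
number `0`, of length in the variable number `10`, if it is new and the enlarged set passes the
test. -/
def Program.tryAppend : Program :=
  .seq (.block (.readNat 29 1 28) [])
    (.ite 29 .skip (.seq (.block (.writeNat 1 28 4) []) (.seq .testCut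
      (.ite 40 (.block (.writeNat 1 28 3) []) (.block (.writeNat 0 10 28) [.addNat 10 10 4])))))

/-- Makes the list empty. -/
def Program.clear : Program :=
  .seq (.for 20 21 0 (.block (.writeNat 1 20 3) [])) (.block (.setNat 10 0) [])

/-- Tries the variables named by the digits of the number in the variable number `22`. -/
def Program.tryDigits : Program :=
  .while 22 (.seq (.divMod 22 23 24)
    (.ite 23 (.seq (.block (.subNat 28 23 4) []) .tryAppend) .skip))

/-- The rounds of the greedy extension. -/
def Program.greedy : Program :=
  .for 20 21 0 (.for 25 26 0 (.seq (.block (.addNat 28 25 3) []) .tryAppend))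

/-- One attempt, whose number is in the variable number `12`; puts the number of missing variables
into the variable number `11`. -/
def Program.attempt : Program :=
  .seq .clear (.seq (.block (.addNat 22 12 3) []) (.seq .tryDigits (.seq .greedy
    (.block (.subNat 11 0 10) [.addNat 12 12 4]))))

/-- Attempts until a complete list is found. -/
def Program.search : Program :=
  .seq (.block (.setNat 11 1) [.setNat 12 0]) (.while 11 .attempt)

/-- Computes the constants: the number of coins for a coordinate goes to the integer variable
number `6`, the number of coordinates to the variable number `7`; the field array number `3` is a
table of the field elements `0` and `1`. -/
def Program.setup : Program :=
  .seq (.block (.setNat 4 1) [.addNat 5 2 4, .addNat 6 0 0, .addNat 6 6 0, .addNat 6 6 1,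
      .addNat 6 6 5, .addNat 6 6 5, .oneFld 0, .writeFld 3 4 0])
    (.seq (.mul 7 9 5 0) (.mul 8 9 5 5))

/-- Tosses the coordinates of the random points, one binary digit after the other. -/
def Program.tossPoints : Program :=
  .for 20 21 7 (.seq (.block (.zeroFld 0) [])
    (.seq (.for 22 23 6 (.block (.toss 24) [.addFld 0 0 0, .readFld 1 3 24, .addFld 0 0 1]))
      (.block (.writeFld 1 20 0) [])))

/-- The algorithm: the random points are tossed once and used for all tests. -/
def Program.findOrder : Program :=
  .seq .setup (.seq .tossPoints .search)

section SearchProgram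

variable {F : Type*} {n : ℕ}

/-- The list `L` is held in the memory, together with the indicator function of its set. -/
structure HoldsList (L : List (Fin n)) (s : Store F) : Prop where
  set : HoldsSet L.toFinset s
  length : s.nat 10 = L.length
  get : ∀ i (h : i < L.length), s.natArr 0 i = L[i]

theorem HoldsList.frame {L : List (Fin n)} {s s' : Store F} {p : Program} (h : HoldsList L s)
    (hF : Frame p s s') (hp : ∀ a ∈ [0, 1], a ∉ p.collect Instr.natArrs)
    (h10 : 10 ∉ p.collect Instr.natVars) : HoldsList L s' :=
  ⟨h.set.frame hF (hp 1 (by simp)), by rw [hF.nat 10 h10, h.length],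
    fun i hi => by rw [hF.natArr 0 (hp 0 (by simp)), h.get i hi]⟩

variable [Field F] {f : MvPolynomial (Fin n) F} {P : ℕ → F} {w B : ℕ}

theorem Runs.tryAppend {s : Store F} {L : List (Fin n)} {y : ℕ}
    (hE : HasConstants n (w + 1) P s) (hL : HoldsList L s) (hy : s.nat 28 = y) (hyn : y < n)
    (hn : n ≤ B) (hw : w + 1 ≤ B) :
    Runs f .tryAppend (100 * B ^ 3 + 6) s
      (HoldsList (tryAppend (fun S => testValue f w P S = 0) L y)) := by
  set x : Fin n := ⟨y, hyn⟩ with hx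
  have hxy : (x : ℕ) = y := rfl
  rw [_root_.tryAppend, dif_pos hyn, ← hx]
  refine Runs.seq (T₁ := 1) (T₂ := 100 * B ^ 3 + 4 + 1)
    (Q₁ := fun s' => s'.nat 29 = if x ∈ L.toFinset then 1 else 0) (Runs.block le_rfl ?_) ?_
    (by omega)
  · simpa [Instr.step, Store.putNat, hy] using hL.set x
  intro s₁ hF₁ h29
  have hE₁ := hE.frame hF₁ (by decide) (by decide)
  have hL₁ := hL.frame hF₁ (by decide) (by decide)
  have hy₁ : s₁.nat 28 = y := (hF₁.nat 28 (by decide)).trans hy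
  refine Runs.ite (fun h => ?_) fun h => ?_
  · have hmem : x ∈ L.toFinset := by
      by_contra hmem
      simp [h29, hmem] at h
    rw [if_neg fun h => h.1 hmem]
    exact (Runs.block (c := .setNat 99 0) (cs := []) (Q := fun _ => True) le_rfl trivial).mono
      (by simp) fun s' hF _ => hL₁.frame hF (by decide) (by decide)
  have hmem : x ∉ L.toFinset := by
    intro hmem
    simp [h29, hmem] at h
  refine Runs.seq (T₁ := 1) (T₂ := 100 * B ^ 3 + 3)
    (Q₁ := fun s' => HoldsSet (insert x L.toFinset) s' ∧ s'.natArr 0 = s₁.natArr 0)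
    (Runs.block le_rfl ⟨fun v => ?_, ?_⟩) ?_ (by omega)
  · by_cases hv : v = x
    · subst hv
      simp [Instr.step, Store.putNatArr, hy₁, hE₁.nat4, ← hxy]
    · have hvy : (v : ℕ) ≠ y := fun h => hv (Fin.ext h)
      have := hL₁.set v
      simp only [List.mem_toFinset] at this
      simp [Instr.step, Store.putNatArr, hy₁, hv, hvy, this]
  · simp [Instr.step, Store.putNatArr]
  rintro s₂ hF₂ ⟨hset, harr⟩
  have hE₂ := hE₁.frame hF₂ (by decide) (by decide)
  refine Runs.seq (Runs.testCut hE₂ hset hn hw) (T₂ := 2 + 1) ?_ le_rfl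
  intro s₃ hF₃ h40
  have hE₃ := hE₂.frame hF₃ (by decide) (by decide)
  have hset₃ := hset.frame hF₃ (by decide)
  have hy₃ : s₃.nat 28 = y := by rw [hF₃.nat 28 (by decide), hF₂.nat 28 (by decide), hy₁]
  have hlen₃ : s₃.nat 10 = L.length := by
    rw [hF₃.nat 10 (by decide), hF₂.nat 10 (by decide), hL₁.length]
  have hget₃ : ∀ i (h : i < L.length), s₃.natArr 0 i = L[i] := by
    rw [hF₃.natArr 0 (by decide), harr]
    exact hL₁.get
  refine Runs.ite (fun h => ?_) fun h => ?_
  · rw [if_neg fun hg => h (h40.2 hg.2)]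
    refine Runs.block (by simp) ⟨fun v => ?_, ?_, fun i hi => ?_⟩
    · by_cases hv : v = x
      · subst hv
        rw [if_neg hmem]
        simp [Instr.step, Store.putNatArr, hy₃, hE₃.nat3, ← hxy]
      · have hvy : (v : ℕ) ≠ y := fun h => hv (Fin.ext h)
        have := hset₃ v
        simp only [Finset.mem_insert, hv, false_or] at this
        rw [← this]
        simp [Instr.step, Store.putNatArr, hy₃, hvy]
    · simp [Instr.step, Store.putNatArr, hlen₃]
    · simp [Instr.step, Store.putNatArr, hget₃ i hi]
  · rw [if_pos ⟨hmem, h40.1 h⟩]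
    refine Runs.block (by simp) ⟨fun v => ?_, ?_, fun i hi => ?_⟩
    · have : (L ++ [x]).toFinset = insert x L.toFinset := by
        ext v
        simp
      rw [this, ← hset₃ v]
      simp [Instr.step, Store.putNatArr, Store.putNat]
    · simp [Instr.step, Store.putNatArr, Store.putNat, hlen₃, hE₃.nat4]
    · rw [List.length_append, List.length_singleton] at hi
      rcases Nat.lt_succ_iff_lt_or_eq.1 hi with hi | rfl
      · simp [Instr.step, Store.putNatArr, Store.putNat, hlen₃, hi.ne, hget₃ i hi,
          List.getElem_append_left hi]
      · simp [Instr.step, Store.putNatArr, Store.putNat, hlen₃, hy₃, hx]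

theorem Runs.clear {s : Store F} (hE : HasConstants n (w + 1) P s) :
    Runs f .clear (4 * n + 4) s (HoldsList ([] : List (Fin n))) := by
  refine Runs.seq (T₁ := n * (1 + 3) + 3) (T₂ := 1) (Q₁ := fun s' => ∀ v < n, s'.natArr 1 v = 0)
    (Runs.for (m := n) (T := 1) (fun k s' => ∀ v < k, s'.natArr 1 v = 0) hE.nat0 hE.nat4
      (fun _ _ _ _ _ h => h) (fun v hv => by omega) ?_ (by decide) (by decide) (by decide)
      (by decide)) ?_ (by omega)
  · intro k s₁ hk hF₁ hk₁ hJ₁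
    have hE₁ := hE.frame hF₁ (by decide) (by decide)
    refine Runs.block le_rfl fun v hv => ?_
    rcases Nat.lt_succ_iff_lt_or_eq.1 hv with hv | rfl
    · simp [Instr.step, Store.putNatArr, hk₁, hv.ne, hJ₁ v hv]
    · simp [Instr.step, Store.putNatArr, hk₁, hE₁.nat3]
  · intro s₁ hF₁ h
    refine Runs.block le_rfl ⟨fun v => ?_, ?_, fun i hi => ?_⟩
    · simp [Instr.step, Store.putNat, h v v.2]
    · simp [Instr.step, Store.putNat]
    · simp at hi

theorem Runs.tryDigits {s : Store F} {L : List (Fin n)} {c : ℕ} (hE : HasConstants n (w + 1) P s)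
    (hL : HoldsList L s) (hc : s.nat 22 = c) (h0n : 0 < n) (hn : n ≤ B) (hw : w + 1 ≤ B) :
    Runs f .tryDigits (c * (5 * c + 100 * B ^ 3 + 13) + 1) s
      (HoldsList ((Nat.digits (n + 1) c).foldl
        (tryDigit fun S => testValue f w P S = 0) L)) := by
  set g := tryDigit fun S : Finset (Fin n) => testValue f w P S = 0 with hg
  have hrun := Runs.while (f := f) (x := 22) (T := 5 * c + 100 * B ^ 3 + 12)
    (p := .seq (.divMod 22 23 24)
      (.ite 23 (.seq (.block (.subNat 28 23 4) []) .tryAppend) .skip))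
    (fun s' => HasConstants n (w + 1) P s' ∧ s'.nat 22 ≤ c ∧ ∃ L', HoldsList L' s' ∧
      (Nat.digits (n + 1) (s'.nat 22)).foldl g L' = (Nat.digits (n + 1) c).foldl g L)
    (fun s' => s'.nat 22) ?_ ⟨hE, hc.le, L, hL, by rw [hc]⟩
  · rw [hc] at hrun
    refine hrun.mono le_rfl ?_
    rintro s' - ⟨⟨-, -, L', hL', h⟩, h0⟩
    rw [h0, Nat.digits_zero, List.foldl_nil] at h
    exact h ▸ hL'
  rintro s₁ ⟨hE₁, hc₁, L', hL', hfold⟩ hne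
  have hpos : 0 < s₁.nat 22 := Nat.pos_of_ne_zero hne
  have hlt : s₁.nat 22 / (n + 1) < s₁.nat 22 := Nat.div_lt_self hpos (by omega)
  have hmod : s₁.nat 22 % (n + 1) < n + 1 := Nat.mod_lt _ n.succ_pos
  rw [Nat.digits_def' (by omega) hpos, List.foldl_cons] at hfold
  refine Runs.seq (T₁ := 5 * c + 4) (T₂ := 100 * B ^ 3 + 7 + 1)
    (Runs.divMod hE₁.nat0 hE₁.nat3 hE₁.nat4 (by decide) (by decide) (by decide) (by omega)) ?_
    (by omega)
  rintro s₂ hF₂ ⟨hquot, hrem⟩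
  have hE₂ := hE₁.frame hF₂ (by decide) (by decide)
  have hL₂ := hL'.frame hF₂ (by decide) (by decide)
  set r := s₁.nat 22 % (n + 1) with hr
  have hfin : ∀ s' : Store F, HasConstants n (w + 1) P s' → s'.nat 22 = s₂.nat 22 →
      HoldsList (g L' r) s' → (HasConstants n (w + 1) P s' ∧ s'.nat 22 ≤ c ∧
        ∃ L', HoldsList L' s' ∧
          (Nat.digits (n + 1) (s'.nat 22)).foldl g L' = (Nat.digits (n + 1) c).foldl g L) ∧
        s'.nat 22 < s₁.nat 22 := by
    intro s' hE' h22 hL'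
    rw [h22, hquot]
    exact ⟨⟨hE', by omega, _, hL', hfold⟩, hlt⟩
  refine Runs.ite (fun h => ?_) fun h => ?_
  · rw [hrem] at h
    refine Runs.seq (T₁ := 1) (T₂ := 100 * B ^ 3 + 6) (Q₁ := fun s' => s'.nat 28 = r - 1)
      (Runs.block le_rfl ?_) ?_ (by omega)
    · simp [Instr.step, Store.putNat, hrem, hE₂.nat4]
    intro s₃ hF₃ h28
    have hE₃ := hE₂.frame hF₃ (by decide) (by decide)
    have hL₃ := hL₂.frame hF₃ (by decide) (by decide)
    refine (Runs.tryAppend hE₃ hL₃ h28 (by omega) hn hw).mono le_rfl fun s₄ hF₄ hL₄ => ?_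
    refine hfin s₄ (hE₃.frame hF₄ (by decide) (by decide)) ?_ ?_
    · rw [hF₄.nat 22 (by decide), hF₃.nat 22 (by decide)]
    · rwa [hg, tryDigit, if_neg h]
  · rw [hrem] at h
    refine (Runs.block (c := .setNat 99 0) (cs := []) (Q := fun _ => True) le_rfl trivial).mono
      (by simp) fun s' hF _ => ?_
    refine hfin s' (hE₂.frame hF (by decide) (by decide)) (hF.nat 22 (by decide)) ?_
    rw [hg, tryDigit, if_pos h]
    exact hL₂.frame hF (by decide) (by decide)

theorem Runs.greedy {s : Store F} {L : List (Fin n)} (hE : HasConstants n (w + 1) P s)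
    (hL : HoldsList L s) (hn : n ≤ B) (hw : w + 1 ≤ B) :
    Runs f .greedy (n * (n * (100 * B ^ 3 + 10) + 6) + 3) s
      (HoldsList ((greedyRound fun S => testValue f w P S = 0)^[n] L)) := by
  set good := fun S : Finset (Fin n) => testValue f w P S = 0 with hgood
  refine Runs.for (m := n) (T := n * (100 * B ^ 3 + 10) + 3)
    (fun k => HoldsList ((greedyRound good)^[k] L)) hE.nat0 hE.nat4 ?_ hL ?_ (by decide)
    (by decide) (by decide) (by decide)
  · rintro k s x a hx ⟨h1, h2, h3⟩
    refine ⟨h1, ?_, h3⟩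
    rcases hx with rfl | rfl <;> simpa [Store.putNat] using h2
  intro k s₁ hk hF₁ hk₁ hL₁
  have hE₁ := hE.frame hF₁ (by decide) (by decide)
  rw [Function.iterate_succ_apply']
  set L₁ := (greedyRound good)^[k] L
  refine Runs.for (m := n) (T := 100 * B ^ 3 + 7)
    (fun j => HoldsList ((List.range j).foldl (_root_.tryAppend good) L₁)) hE₁.nat0 hE₁.nat4 ?_
    hL₁ ?_ (by decide) (by decide) (by decide) (by decide)
  · rintro k s x a hx ⟨h1, h2, h3⟩
    refine ⟨h1, ?_, h3⟩
    rcases hx with rfl | rfl <;> simpa [Store.putNat] using h2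
  intro j s₂ hj hF₂ hj₂ hL₂
  have hE₂ := hE₁.frame hF₂ (by decide) (by decide)
  refine Runs.seq (T₁ := 1) (T₂ := 100 * B ^ 3 + 6) (Q₁ := fun s' => s'.nat 28 = j)
    (Runs.block le_rfl ?_) ?_ (by omega)
  · simp [Instr.step, Store.putNat, hj₂, hE₂.nat3]
  intro s₃ hF₃ h28
  rw [List.range_succ, List.foldl_append]
  exact Runs.tryAppend (hE₂.frame hF₃ (by decide) (by decide))
    (hL₂.frame hF₃ (by decide) (by decide)) h28 hj hn hw

theorem Runs.attempt {s : Store F} {c N : ℕ} (hE : HasConstants n (w + 1) P s)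
    (hc : s.nat 12 = c) (hcN : c ≤ N) (h0n : 0 < n) (hn : n ≤ B) (hw : w + 1 ≤ B) :
    Runs f .attempt (300 * B ^ 5 * (N + 1) ^ 2) s fun s' =>
      HoldsList (_root_.attempt (fun S => testValue f w P S = 0) c) s' ∧
      s'.nat 11 = n - (_root_.attempt (fun S => testValue f w P S = 0) c).length ∧
      s'.nat 12 = c + 1 := by
  set good := fun S : Finset (Fin n) => testValue f w P S = 0 with hgood
  have htime : (4 * n + 4) + (1 + ((c * (5 * c + 100 * B ^ 3 + 13) + 1) +
      ((n * (n * (100 * B ^ 3 + 10) + 6) + 3) + 2))) ≤ 300 * B ^ 5 * (N + 1) ^ 2 := by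
    have hB : 1 ≤ B := by omega
    have h3 : B ^ 3 ≤ B ^ 5 := Nat.pow_le_pow_right hB (by norm_num)
    have h2 : B ^ 2 ≤ B ^ 5 := Nat.pow_le_pow_right hB (by norm_num)
    have h1 : B ≤ B ^ 5 := Nat.le_self_pow (by norm_num) B
    calc _ ≤ (4 * B + 4) + (1 + ((N * (5 * N + 100 * B ^ 3 + 13) + 1) +
          ((B * (B * (100 * B ^ 3 + 10) + 6) + 3) + 2))) := by gcongr
      _ = 100 * B ^ 5 + 10 * B ^ 2 + 10 * B + 11 + N * (100 * B ^ 3 + 13) + 5 * N ^ 2 := by ring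
      _ ≤ 131 * B ^ 5 + N * (113 * B ^ 5) + 5 * B ^ 5 * N ^ 2 := by
          have : 1 ≤ B ^ 5 := hB.trans h1
          gcongr ?_ + N * ?_ + ?_ * N ^ 2 <;> omega
      _ ≤ 300 * B ^ 5 * (N + 1) ^ 2 := by
          have : 0 ≤ B ^ 5 * N := Nat.zero_le _
          have : 0 ≤ B ^ 5 * N ^ 2 := Nat.zero_le _
          nlinarith
  refine Runs.seq (Runs.clear hE) (fun s₁ hF₁ hL₁ => ?_) htime
  have hE₁ := hE.frame hF₁ (by decide) (by decide)
  have hc₁ : s₁.nat 12 = c := (hF₁.nat 12 (by decide)).trans hc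
  refine Runs.seq (T₁ := 1) (Q₁ := fun s' => s'.nat 22 = c) (Runs.block le_rfl ?_)
    (fun s₂ hF₂ h22 => ?_) le_rfl
  · simp [Instr.step, Store.putNat, hc₁, hE₁.nat3]
  have hE₂ := hE₁.frame hF₂ (by decide) (by decide)
  have hL₂ := hL₁.frame hF₂ (by decide) (by decide)
  have hc₂ : s₂.nat 12 = c := (hF₂.nat 12 (by decide)).trans hc₁
  refine Runs.seq (Runs.tryDigits hE₂ hL₂ h22 h0n hn hw) (fun s₃ hF₃ hL₃ => ?_) le_rfl
  have hE₃ := hE₂.frame hF₃ (by decide) (by decide)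
  have hc₃ : s₃.nat 12 = c := (hF₃.nat 12 (by decide)).trans hc₂
  refine Runs.seq (Runs.greedy hE₃ hL₃ hn hw) (fun s₄ hF₄ hL₄ => ?_) le_rfl
  have hE₄ := hE₃.frame hF₄ (by decide) (by decide)
  have hc₄ : s₄.nat 12 = c := (hF₄.nat 12 (by decide)).trans hc₃
  refine (Runs.block (T := 2) (Q := fun s' => s'.nat 11 = n - (_root_.attempt good c).length ∧
    s'.nat 12 = c + 1) le_rfl ?_).mono le_rfl fun s₅ hF₅ h => ?_
  · have := hL₄.length
    simp [Instr.step, Store.putNat, hc₄, hE₄.nat0, hE₄.nat4, this, _root_.attempt, hgood]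
  · exact ⟨hL₄.frame hF₅ (by decide) (by decide), h.1, h.2⟩

/-- If some attempt with a number at most `N` succeeds, then the search finds a complete good
list. -/
theorem Runs.search {s : Store F} {c N : ℕ} (hE : HasConstants n (w + 1) P s) (h0n : 0 < n)
    (hn : n ≤ B) (hw : w + 1 ≤ B) (hcN : c ≤ N)
    (hc : (_root_.attempt (fun S : Finset (Fin n) => testValue f w P S = 0) c).length = n)
    (hempty : testValue f w P ∅ = 0) :
    Runs f .search (400 * B ^ 5 * (N + 1) ^ 3) s fun s' => ∃ L : List (Fin n),
      GoodList (fun S => testValue f w P S = 0) L ∧ L.length = n ∧ HoldsList L s' := by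
  set good := fun S : Finset (Fin n) => testValue f w P S = 0 with hgood
  have htime : 2 + ((N + 1) * (300 * B ^ 5 * (N + 1) ^ 2 + 1) + 1) ≤
      400 * B ^ 5 * (N + 1) ^ 3 := by
    have hB : 1 ≤ B ^ 5 := Nat.one_le_pow _ _ (by omega)
    have h1 : 1 ≤ (N + 1) ^ 2 := Nat.one_le_pow _ _ (by omega)
    have h2 : N + 1 ≤ B ^ 5 * (N + 1) ^ 3 := by
      calc N + 1 = 1 * ((N + 1) * 1) := by ring
        _ ≤ B ^ 5 * ((N + 1) * (N + 1) ^ 2) := by gcongr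
        _ = _ := by ring
    calc _ = 300 * (B ^ 5 * (N + 1) ^ 3) + (N + 1) + 3 := by ring
      _ ≤ 300 * (B ^ 5 * (N + 1) ^ 3) + 100 * (B ^ 5 * (N + 1) ^ 3) := by omega
      _ = _ := by ring
  refine Runs.seq (T₁ := 2) (Q₁ := fun s' => s'.nat 11 = 1 ∧ s'.nat 12 = 0)
    (Runs.block le_rfl (by simp [Instr.step, Store.putNat])) ?_ htime
  rintro s₁ hF₁ ⟨h11, h12⟩
  have hE₁ := hE.frame hF₁ (by decide) (by decide)
  have hrun := Runs.while (f := f) (x := 11) (T := 300 * B ^ 5 * (N + 1) ^ 2)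
    (p := .attempt)
    (fun s' => HasConstants n (w + 1) P s' ∧ s'.nat 12 ≤ c + 1 ∧
      (s'.nat 11 ≠ 0 → s'.nat 12 ≤ c) ∧
      (s'.nat 11 = 0 → ∃ L : List (Fin n), GoodList good L ∧ L.length = n ∧ HoldsList L s'))
    (fun s' => c + 1 - s'.nat 12) ?_ (s := s₁) ⟨hE₁, by omega, by omega, by omega⟩
  · refine hrun.mono (Nat.succ_le_succ (Nat.mul_le_mul_right _ (by omega))) ?_
    rintro s' - ⟨⟨-, -, -, h⟩, h0⟩
    exact h h0
  rintro s₂ ⟨hE₂, -, hle, -⟩ hne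
  have hle := hle hne
  refine (Runs.attempt hE₂ rfl (hle.trans hcN) h0n hn hw).mono le_rfl ?_
  rintro s₃ hF₃ ⟨hL, h11, h12⟩
  have hL0 := goodList_attempt (good := good) hempty (s₂.nat 12)
  rw [← hgood] at hL h11
  refine ⟨⟨hE₂.frame hF₃ (by decide) (by decide), by omega, fun h => ?_, fun h => ?_⟩, by omega⟩
  · -- the search does not pass the number of the successful attempt
    rcases hle.lt_or_eq with h' | h'
    · omega
    · rw [h11, h', hc] at h
      omega
  · exact ⟨_, hL0, by have := hL0.length_le; omega, hL⟩

theorem Runs.setup {d w : ℕ} (ω : ℕ → Bool) (hn : n ≤ B) (hw : w + 1 ≤ B) :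
    Runs f .setup (6 * B + 15) (Store.init n d w ω) fun s => (∃ P, HasConstants n (w + 1) P s) ∧
      s.nat 6 = numCoins n d w ∧ s.nat 7 = (w + 1) * n ∧ s.fldArr 3 0 = 0 ∧ s.fldArr 3 1 = 1 ∧
      s.coins = ω := by
  refine Runs.seq (T₁ := 9) (T₂ := 6 * B + 6) (Q₁ := fun s => s.nat 0 = n ∧ s.nat 3 = 0 ∧
    s.nat 4 = 1 ∧ s.nat 5 = w + 1 ∧ s.nat 6 = numCoins n d w ∧ s.fldArr 3 0 = 0 ∧
    s.fldArr 3 1 = 1 ∧ s.coins = ω) (Runs.block le_rfl ?_) ?_ (by omega)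
  · simp [Instr.step, Store.putNat, Store.putFld, Store.putFldArr, Store.init, numCoins]
  rintro s₁ hF₁ ⟨h0, h3, h4, h5, h6, ha, hb, hω⟩
  refine Runs.seq (T₁ := 3 * B + 3) (T₂ := 3 * B + 3)
    (Runs.mul h3 h4 (by decide) (by decide) (by rw [h0]; omega)) ?_ (by omega)
  intro s₂ hF₂ h7
  refine (Runs.mul (s := s₂) (T := 3 * B + 3) (by rw [hF₂.nat 3 (by decide), h3])
    (by rw [hF₂.nat 4 (by decide), h4]) (by decide) (by decide)
    (by rw [hF₂.nat 5 (by decide), h5]; omega)).mono le_rfl ?_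
  intro s₃ hF₃ h8
  refine ⟨⟨s₃.fldArr 1, ?_, ?_, ?_, ?_, ?_, rfl⟩, ?_, ?_, ?_, ?_, ?_⟩
  · rw [hF₃.nat 0 (by decide), hF₂.nat 0 (by decide), h0]
  · rw [hF₃.nat 3 (by decide), hF₂.nat 3 (by decide), h3]
  · rw [hF₃.nat 4 (by decide), hF₂.nat 4 (by decide), h4]
  · rw [hF₃.nat 5 (by decide), hF₂.nat 5 (by decide), h5]
  · rw [h8, hF₂.nat 5 (by decide), h5]
  · rw [hF₃.nat 6 (by decide), hF₂.nat 6 (by decide), h6]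
  · rw [hF₃.nat 7 (by decide), h7, h5, h0]
  · rw [hF₃.fldArr 3 (by decide), hF₂.fldArr 3 (by decide), ha]
  · rw [hF₃.fldArr 3 (by decide), hF₂.fldArr 3 (by decide), hb]
  · rw [hF₃.coins (by decide), hF₂.coins (by decide), hω]

theorem Runs.tossPoints {s : Store F} {Q M : ℕ} {ω : ℕ → Bool} (h4 : s.nat 4 = 1)
    (h6 : s.nat 6 = M) (h7 : s.nat 7 = Q) (ha : s.fldArr 3 0 = 0) (hb : s.fldArr 3 1 = 1)
    (hω : s.coins = ω) :
    Runs f .tossPoints (Q * (7 * M + 8) + 3) s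
      fun s' => ∀ q < Q, s'.fldArr 1 q = (coinNat M ω q : F) := by
  refine (Runs.for (m := Q) (T := 7 * M + 5) (fun q (s' : Store F) =>
    s'.coins = (fun l => ω (q * M + l)) ∧ ∀ q' < q, s'.fldArr 1 q' = (coinNat M ω q' : F)) h7 h4
    (fun _ _ _ _ _ h => h)
    ⟨by simpa using hω, fun q hq => by omega⟩ ?_ (by decide) (by decide) (by decide)
    (by decide)).mono le_rfl fun _ _ h => h.2
  rintro q s₁ hq hF₁ hq₁ ⟨hω₁, hJ₁⟩
  refine Runs.seq (T₁ := 1) (T₂ := 7 * M + 4)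
    (Q₁ := fun s' => s'.fld 0 = 0) (Runs.block le_rfl (by simp [Instr.step, Store.putFld])) ?_
    (by omega)
  intro s₂ hF₂ h0
  have h4₂ : s₂.nat 4 = 1 := by rw [hF₂.nat 4 (by decide), hF₁.nat 4 (by decide), h4]
  have h6₂ : s₂.nat 6 = M := by rw [hF₂.nat 6 (by decide), hF₁.nat 6 (by decide), h6]
  have hq₂ : s₂.nat 20 = q := by rw [hF₂.nat 20 (by decide), hq₁]
  have ha₂ : s₂.fldArr 3 0 = 0 := by rw [hF₂.fldArr 3 (by decide), hF₁.fldArr 3 (by decide), ha]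
  have hb₂ : s₂.fldArr 3 1 = 1 := by rw [hF₂.fldArr 3 (by decide), hF₁.fldArr 3 (by decide), hb]
  refine Runs.seq (T₁ := M * (4 + 3) + 3) (T₂ := 1)
    (Runs.for (m := M) (T := 4) (fun m (s' : Store F) => s'.coins = (fun l => ω (q * M + m + l)) ∧
      s'.fld 0 = (bitsNat (fun b => ω (q * M + b)) m : F)) h6₂ h4₂ (fun _ _ _ _ _ h => h)
      ⟨by rw [hF₂.coins (by decide), hω₁]; rfl, by simp [h0, bitsNat]⟩ ?_ (by decide) (by decide)
      (by decide) (by decide)) ?_ (by omega)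
  · rintro m s₃ hm hF₃ hm₃ ⟨hω₃, hval⟩
    have ha₃ : s₃.fldArr 3 0 = 0 := by rw [hF₃.fldArr 3 (by decide), ha₂]
    have hb₃ : s₃.fldArr 3 1 = 1 := by rw [hF₃.fldArr 3 (by decide), hb₂]
    refine Runs.block le_rfl ⟨?_, ?_⟩
    · funext l
      simp [Instr.step, Store.putFld, hω₃, add_assoc, add_comm 1]
    · rw [bitsNat]
      cases hcoin : ω (q * M + m) <;>
        simp [Instr.step, Store.putFld, hω₃, hcoin, hval, ha₃, hb₃, two_mul]
  rintro s₃ hF₃ ⟨hω₃, hval⟩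
  have hq₃ : s₃.nat 20 = q := by rw [hF₃.nat 20 (by decide), hq₂]
  have harr : s₃.fldArr 1 = s₁.fldArr 1 := by
    rw [hF₃.fldArr 1 (by decide), hF₂.fldArr 1 (by decide)]
  refine Runs.block le_rfl ⟨?_, fun q' hq' => ?_⟩
  · simp [Instr.step, Store.putFldArr, hω₃, Nat.succ_mul]
  · rcases Nat.lt_succ_iff_lt_or_eq.1 hq' with hq' | rfl
    · simp [Instr.step, Store.putFldArr, hq₃, hq'.ne, harr, hJ₁ q' hq']
    · simp [Instr.step, Store.putFldArr, hq₃, hval, coinNat]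

end SearchProgram

/-! ### The algorithm -/

section Algorithm

variable {F : Type*} [Field F] {n d w : ℕ}

/-- If the test decides all cuts correctly at the random points and some attempt with a number at
most `N` succeeds, then the algorithm finds an order. -/
theorem Runs.findOrder {f : MvPolynomial (Fin n) F} {ω : ℕ → Bool} {c N B : ℕ} (h0n : 0 < n)
    (hB : n + d + w + 1 ≤ B) {good : Finset (Fin n) → Prop}
    (hω : ∀ P : ℕ → F, (∀ q < (w + 1) * n, P q = coinNat (numCoins n d w) ω q) →
      ∀ S, testValue f w P S = 0 ↔ good S)
    (hempty : good ∅) (hcN : c ≤ N) (hc : (_root_.attempt good c).length = n) :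
    Runs f .findOrder (500 * B ^ 5 * (N + 1) ^ 3) (Store.init n d w ω) fun s =>
      ∃ τ : Equiv.Perm (Fin n), s.Outputs τ ∧ ∀ m, good (prefixSet τ m) := by
  have htime : (6 * B + 15) + ((B ^ 2 * (21 * B + 8) + 3) + 400 * B ^ 5 * (N + 1) ^ 3) ≤
      500 * B ^ 5 * (N + 1) ^ 3 := by
    have hB1 : 1 ≤ B := by omega
    have h3 : B ^ 3 ≤ B ^ 5 := Nat.pow_le_pow_right hB1 (by norm_num)
    have h2 : B ^ 2 ≤ B ^ 5 := Nat.pow_le_pow_right hB1 (by norm_num)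
    have h1 : B ≤ B ^ 5 := Nat.le_self_pow (by norm_num) B
    have hN : B ^ 5 ≤ B ^ 5 * (N + 1) ^ 3 :=
      Nat.le_mul_of_pos_right _ (Nat.pow_pos N.succ_pos)
    have : B ^ 2 * (21 * B + 8) = 21 * B ^ 3 + 8 * B ^ 2 := by ring
    rw [this, mul_assoc 400, mul_assoc 500]
    omega
  refine Runs.seq (Runs.setup ω (by omega) (by omega)) ?_ htime
  rintro s₁ hF₁ ⟨⟨P₁, hE₁⟩, h6, h7, ha, hb, hcoins⟩
  refine Runs.seq ((Runs.tossPoints hE₁.nat4 h6 h7 ha hb hcoins).mono ?_ fun _ _ h => h) ?_ le_rfl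
  · have hM : numCoins n d w ≤ 3 * B := by
      unfold numCoins
      omega
    have hQ : (w + 1) * n ≤ B ^ 2 := by
      rw [pow_two]
      exact Nat.mul_le_mul (by omega) (by omega)
    calc _ ≤ B ^ 2 * (7 * (3 * B) + 8) + 3 := by gcongr
      _ = _ := by ring
  intro s₂ hF₂ hP
  have hE₂ : HasConstants n (w + 1) (s₂.fldArr 1) s₂ :=
    ⟨by rw [hF₂.nat 0 (by decide), hE₁.nat0], by rw [hF₂.nat 3 (by decide), hE₁.nat3],
      by rw [hF₂.nat 4 (by decide), hE₁.nat4], by rw [hF₂.nat 5 (by decide), hE₁.nat5],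
      by rw [hF₂.nat 8 (by decide), hE₁.nat8], rfl⟩
  obtain rfl : good = fun S => testValue f w (s₂.fldArr 1) S = 0 :=
    funext fun S => propext (hω _ hP S).symm
  refine (Runs.search hE₂ h0n (by omega) (by omega) hcN hc hempty).mono le_rfl ?_
  rintro s₃ hF₃ ⟨L, hL, hlen, hheld⟩
  obtain ⟨τ, rfl, hτ⟩ := hL.exists_perm hlen
  refine ⟨τ, fun i => ?_, hτ⟩
  rw [hheld.get i (by simp), List.getElem_ofFn]

/-- The number of steps, with `k` in the role of `⌊log_{d+1} w⌋` and `x` in that of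
`log_{d+1} w`. -/
theorem steps_le {k : ℕ} (hn : 0 < n) (hd : 0 < d) (hw : 0 < w) (hk : (d + 1) ^ k ≤ w)
    {x : ℝ} (hkx : (k : ℝ) ≤ x) :
    ((500 * (n + d + w + 1) ^ 5 * ((n + 1) ^ (k + 1)) ^ 3 : ℕ) : ℝ) ≤
      (4096000 : ℕ) * (n : ℝ) ^ (((4096000 : ℕ) : ℝ) * (1 + x)) *
        ((d : ℝ) * (w : ℝ)) ^ 4096000 := by
  -- `4096000 = 500 * 4 ^ 5 * 2 ^ 3`, from `n + d + w + 1 ≤ 4 * n * d * w` and `n + 1 ≤ 2 * n`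
  have hnat : 500 * (n + d + w + 1) ^ 5 * ((n + 1) ^ (k + 1)) ^ 3 ≤
      4096000 * n ^ (8 * (1 + k)) * (d * w) ^ 8 := by
    have hdw : 1 ≤ d * w := Nat.mul_pos hd hw
    have h1 : n + d + w + 1 ≤ 4 * (n * (d * w)) := by
      have e1 : n * 1 ≤ n * (d * w) := Nat.mul_le_mul_left _ hdw
      have e2 : d * 1 ≤ d * w := Nat.mul_le_mul_left _ hw
      have e3 : 1 * w ≤ d * w := Nat.mul_le_mul_right _ hd
      have e4 : 1 * (d * w) ≤ n * (d * w) := Nat.mul_le_mul_right _ hn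
      omega
    have h2 : 2 ^ k ≤ d * w :=
      (Nat.pow_le_pow_left (by omega) k).trans (hk.trans (Nat.le_mul_of_pos_left _ hd))
    calc 500 * (n + d + w + 1) ^ 5 * ((n + 1) ^ (k + 1)) ^ 3
        ≤ 500 * (4 * (n * (d * w))) ^ 5 * ((2 * n) ^ (k + 1)) ^ 3 := by gcongr; omega
      _ = 4096000 * (n ^ 5 * (n ^ (k + 1)) ^ 3) * ((d * w) ^ 5 * (2 ^ k) ^ 3) := by ring
      _ ≤ 4096000 * (n ^ 5 * (n ^ (k + 1)) ^ 3) * ((d * w) ^ 5 * (d * w) ^ 3) := by gcongr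
      _ = 4096000 * n ^ (5 + (k + 1) * 3) * (d * w) ^ 8 := by ring
      _ ≤ _ := by
          gcongr
          omega
  have hn1 : (1 : ℝ) ≤ n := by exact_mod_cast hn
  have hdw1 : (1 : ℝ) ≤ (d : ℝ) * w := by exact_mod_cast Nat.mul_pos hd hw
  have hx : 0 ≤ 1 + x := by
    have : (0 : ℝ) ≤ k := Nat.cast_nonneg k
    linarith
  calc ((500 * (n + d + w + 1) ^ 5 * ((n + 1) ^ (k + 1)) ^ 3 : ℕ) : ℝ)
      ≤ ((4096000 * n ^ (8 * (1 + k)) * (d * w) ^ 8 : ℕ) : ℝ) := Nat.cast_le.2 hnat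
    _ = (4096000 : ℕ) * (n : ℝ) ^ ((8 : ℝ) * (1 + k)) * ((d : ℝ) * w) ^ 8 := by
        rw [Nat.cast_mul, Nat.cast_mul, Nat.cast_pow, Nat.cast_pow, ← Real.rpow_natCast]
        push_cast
        rfl
    _ ≤ _ := by
        refine mul_le_mul (mul_le_mul_of_nonneg_left ?_ (Nat.cast_nonneg _)) ?_ (by positivity)
          (by positivity)
        · refine Real.rpow_le_rpow_of_exponent_le hn1 ?_
          calc (8 : ℝ) * (1 + k) ≤ 8 * (1 + x) := by gcongr
            _ ≤ ((4096000 : ℕ) : ℝ) * (1 + x) := by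
              refine mul_le_mul_of_nonneg_right ?_ hx
              norm_num
        · exact pow_le_pow_right₀ hdw1 (by norm_num)

end Algorithm

theorem mainTheorem6 (F : Type) [Field F]
    (hF : Nonempty (F ≃+* ℚ) ∨ Nonempty (F ≃+* ℝ) ∨ Nonempty (F ≃+* ℂ)) :
    -- one program and one constant for all parameters and orders
    ∃ (R : Program) (C : ℕ), ∀ (n d w : ℕ) (σ : Equiv.Perm (Fin n)),
      0 < n → 0 < d → 0 < w → 3 * Real.logb ((d : ℝ) + 1) (w : ℝ) ≤ (n : ℝ) →
      -- the exceptional set of the generic condition: a proper subvariety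
      ∃ Z : Set ((Fin n → Fin (d + 1)) → F),
        IsAlgebraicSet Z ∧ Z ⊂ roabpVariety F d w σ ∧
        ∀ f : MvPolynomial (Fin n) F, HasROABP d w σ f → coeffVector d f ∉ Z →
          1 - (1 / 2 : ℝ) ^ n ≤ coinMeasure.real
            {ω | ∃ (t : ℕ) (s : Store F) (τ : Equiv.Perm (Fin n)),
              Exec f R (Store.init n d w ω) t s ∧ s.Outputs τ ∧ HasROABP d w τ f ∧
              (t : ℝ) ≤ C * (n : ℝ) ^ ((C : ℝ) * (1 + Real.logb ((d : ℝ) + 1) (w : ℝ))) *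
                ((d : ℝ) * (w : ℝ)) ^ C} := by
  have hchar : CharZero F := by
    rcases hF with ⟨⟨e⟩⟩ | ⟨⟨e⟩⟩ | ⟨⟨e⟩⟩
    exacts [charZero_of_injective_ringHom (f := e.symm.toRingHom) e.symm.injective,
      (RingHom.charZero_iff (ϕ := e.toRingHom) e.injective).2 inferInstance,
      (RingHom.charZero_iff (ϕ := e.toRingHom) e.injective).2 inferInstance]
  refine ⟨.findOrder, 4096000, fun n d w σ hn hd hw _ => ?_⟩
  obtain ⟨Z, hZ, hZV, hgen⟩ := exists_exceptional_set (F := F) (d := d) hn hw σ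
  refine ⟨Z, hZ, hZV, fun f hf hfZ => ?_⟩
  have hgen := hgen f hf hfZ
  set k := Nat.log (d + 1) w with hk
  set good := fun S : Finset (Fin n) => CutRankLE (fun y => MvPolynomial.eval y f) S w with hgood
  obtain ⟨c, hcN, hc⟩ := exists_attempt_length_eq (good := good) (σ := σ) (k := k + 1)
    (fun m => hf.cutRankLE_prefixSet m) (fun S hS hcard hne => hf.exists_insert hw hgen hS
      ((Nat.lt_pow_succ_log_self (by omega) w).trans_le (Nat.pow_le_pow_right (by omega) hcard))
      hne)
  have hempty : good ∅ := by
    have : prefixSet σ 0 = ∅ := by ext; simp [mem_prefixSet]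
    exact this ▸ hf.cutRankLE_prefixSet 0
  refine (coinMeasure_testValue (f := f) (d := d) (w := w) hf.degreeOf_le).trans
    (measureReal_mono fun ω hω => ?_)
  -- the numbers of the attempts are less than `(n + 1) ^ (k + 1)`
  obtain ⟨t, s, hexec, ht, τ, hτ, hpre⟩ := Runs.findOrder (c := c)
    (N := (n + 1) ^ (k + 1) - 1) hn le_rfl hω hempty (by omega) hc
  refine ⟨t, s, τ, hexec, hτ, hasROABP_of_cutRankLE hn hw hf.degreeOf_le hpre, ?_⟩
  rw [Nat.sub_add_cancel (Nat.pow_pos n.succ_pos)] at ht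
  refine (Nat.cast_le.2 ht).trans (steps_le hn hd hw (Nat.pow_log_le_self _ hw.ne') ?_)
  have := Real.natLog_le_logb w (d + 1)
  push_cast at this
  exact this
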